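/- Assume the Riemann hypothesis. Then for every real number $c_3 < \sqrt{2/3}$ there is a constant $C > 0$ (depending only on $c_3$) such that, for infinitely many ordinates $\gamma = \operatorname{Im}\rho$ of non-trivial zeros $\rho$ of the Riemann zeta function (the zeros in the strip $0 < \operatorname{Re} s < 1$), one has $$|\zeta'(\rho)| \le C \exp\left(-c_3 \sqrt{\frac{\log|\gamma|}{\log\log|\gamma|}}\right).$$ -/

import Mathlib

/-- `ρ` is a non-trivial zero of the Riemann zeta function: a zero in the open critical strip
`0 < Re ρ < 1`. -/
def IsNontrivialZetaZero (ρ : ℂ) : Prop :=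
  riemannZeta ρ = 0 ∧ 0 < ρ.re ∧ ρ.re < 1

/-! The proof is a resonance argument by contradiction. If the set of ordinates were finite, every
zero above some height `T₀` would satisfy `1/|ζ'(ρ)| < exp(c √(log γ / log log γ))`; in particular
all these zeros would be simple. Let `R(u) = ∑_{n ≤ N} r(n) n^{-iu}` and let `K(s)` be the entire
function that equals a Gaussian of width `H` about height `T` times `|R(γ)|²` at `s = 1/2 + iγ`. Two
estimates of the sum of `K(ρ)/ζ'(ρ)` over zeros are compared.

Lower bound: by the residue theorem the sum is a contour integral of `K/ζ`. On `Re s = 3`, expanding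
`1/ζ = ∑ μ(n) n^{-s}` leaves, when `H/N` is large, only the diagonal `k = hn`, that is `√π H ∑ μ(n)
n^{-1/2} r(h) r(hn)` (`resonatorForm`). The other edges are small: on `Re s = -2` the functional
equation makes `ζ` large, and on the horizontal edges the Gaussian beats a crude lower bound for
`|ζ|` at well-chosen heights. This is `exists_zeros_resonatorForm_le`.

Upper bound: under the assumption the sum is at most the largest admissible `1/|ζ'|` near `T` times
a Gaussian mean square of `R` over zeros, and a large sieve gives `H (log T)^{O(1)} ∑ r²` for the
latter (`exists_sum_gaussian_resonator_le`).

Resonator: with `r(n) = μ(n) ∏_{p ∣ n} f(p)` all diagonal terms are nonnegative, and `f(p) = λ/(√p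
log p)` on primes slightly larger than `log N` makes `resonatorForm` at least `exp(a √(log N / log
log N)) ∑ r²` for any `a < 1` (`exists_resonator_le_resonatorForm`).

The parameters are `N = X^8`, `H = X^9`, `T = X^12`. Since `log N = (2/3) log T`, the two bounds
contradict each other as soon as `c < √(2/3)`. -/

/-! ### Linear growth of zeta in `Re s ≥ 1/10` -/

section

open Complex MeasureTheory Filter Topology Set Asymptotics

/-- The fractional part cut off at `1`, as a complex-valued function. -/
noncomputable def fractTail (t : ℝ) : ℂ := (Ioi (1 : ℝ)).indicator (fun t => ((Int.fract t : ℝ) : ℂ)) t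

lemma norm_fractTail_le (t : ℝ) : ‖fractTail t‖ ≤ (Ioi (1 : ℝ)).indicator (fun _ => (1 : ℝ)) t := by
  unfold fractTail
  by_cases h : t ∈ Ioi (1 : ℝ)
  · simp only [h, indicator_of_mem, Complex.norm_real, Real.norm_eq_abs,
      abs_of_nonneg (Int.fract_nonneg t)]
    exact (Int.fract_lt_one t).le
  · simp [h]

lemma measurable_fractTail : Measurable fractTail :=
  (Complex.measurable_ofReal.comp measurable_fract).indicator measurableSet_Ioi

lemma norm_fractTail_le_one (t : ℝ) : ‖fractTail t‖ ≤ 1 :=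
  (norm_fractTail_le t).trans (indicator_le_self' (by simp) t)

lemma differentiableAt_mellin_fractTail {s : ℂ} (hs : 0 < s.re) :
    DifferentiableAt ℂ (fun s => mellin fractTail (-s)) s := by
  have h : DifferentiableAt ℂ (mellin fractTail) (-s) := by
    refine mellin_differentiableAt_of_isBigO_rpow (a := 0) (b := -s.re - 1) ?_ ?_ (by simpa) ?_
      (by simp)
    · refine LocallyIntegrable.locallyIntegrableOn ?_ _
      refine (locallyIntegrable_const (1 : ℝ)).mono measurable_fractTail.aestronglyMeasurable ?_
      exact Eventually.of_forall fun t => by simpa using norm_fractTail_le_one t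
    · refine IsBigO.of_bound 1 (Eventually.of_forall fun t => ?_)
      simpa using norm_fractTail_le_one t
    · refine IsBigO.of_bound 1 ?_
      filter_upwards [nhdsWithin_le_nhds (Iio_mem_nhds (zero_lt_one (α := ℝ)))] with t ht
      have : fractTail t = 0 := by
        unfold fractTail
        rw [indicator_of_notMem]
        simpa using (le_of_lt ht)
      rw [this]; simp
  exact h.comp s (differentiableAt_id.neg)

lemma mellin_fractTail (s : ℂ) :
    mellin fractTail (-s) = ∫ t in Ioi (1 : ℝ), (t : ℂ) ^ (-(s + 1)) * ((Int.fract t : ℝ) : ℂ) := by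
  have h : ∀ t : ℝ, (t : ℂ) ^ (-s - 1) • fractTail t =
      (Ioi (1 : ℝ)).indicator (fun t => (t : ℂ) ^ (-(s + 1)) * ((Int.fract t : ℝ) : ℂ)) t := by
    intro t
    by_cases h : t ∈ Ioi (1 : ℝ)
    · simp only [fractTail, h, indicator_of_mem, smul_eq_mul]; ring_nf
    · simp only [fractTail, h, not_false_eq_true, indicator_of_notMem, smul_zero]
  unfold mellin
  simp_rw [h]
  rw [setIntegral_indicator measurableSet_Ioi]
  congr 2
  rw [Ioi_inter_Ioi]; simp

lemma norm_mellin_fractTail_le {s : ℂ} (hs : 0 < s.re) : ‖mellin fractTail (-s)‖ ≤ 1 / s.re := by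
  rw [mellin_fractTail]
  refine (norm_integral_le_integral_norm _).trans ?_
  have h1 : ∫ t in Ioi (1 : ℝ), t ^ (-s.re - 1) = 1 / s.re := by
    rw [integral_Ioi_rpow_of_lt (by linarith) one_pos]
    simp only [sub_add_cancel, Real.one_rpow]
    rw [neg_div_neg_eq]
  rw [← h1]
  refine integral_mono_of_nonneg (Eventually.of_forall fun _ => norm_nonneg _)
    (integrableOn_Ioi_rpow_of_lt (by linarith) one_pos) ?_
  filter_upwards [ae_restrict_mem measurableSet_Ioi] with t ht
  have ht0 : (0 : ℝ) < t := lt_trans one_pos ht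
  simp only [norm_mul, Complex.norm_cpow_eq_rpow_re_of_pos ht0]
  have : ‖((Int.fract t : ℝ) : ℂ)‖ ≤ 1 := by
    rw [Complex.norm_real, Real.norm_eq_abs, abs_of_nonneg (Int.fract_nonneg t)]
    exact (Int.fract_lt_one t).le
  have e : (-(s + 1)).re = -s.re - 1 := by simp; ring
  rw [e]
  exact mul_le_of_le_one_right (by positivity) this

/-- Abel summation of `∑ n^{-s}`, with `⌊t⌋ = t - {t}` under the integral. -/
lemma riemannZeta_eq_sub_mellin_of_one_lt {s : ℂ} (hs : 1 < s.re) :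
    riemannZeta s = s / (s - 1) - s * mellin fractTail (-s) := by
  have hO : (fun n ↦ ∑ k ∈ Finset.Icc 1 n, ‖(1 : ℕ → ℂ) k‖) =O[atTop] fun n ↦ (n : ℝ) ^ (1 : ℝ) := by
    refine IsBigO.of_bound 1 (Eventually.of_forall fun n => ?_)
    simp
  have h := LSeries_eq_mul_integral' (1 : ℕ → ℂ) zero_le_one hs hO
  rw [LSeries_one_eq_riemannZeta hs] at h
  rw [h, mellin_fractTail]
  have e : ∀ t ∈ Ioi (1 : ℝ), (∑ k ∈ Finset.Icc 1 ⌊t⌋₊, (1 : ℕ → ℂ) k) * (t : ℂ) ^ (-(s + 1)) =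
      (t : ℂ) ^ (-s) - (t : ℂ) ^ (-(s + 1)) * ((Int.fract t : ℝ) : ℂ) := by
    intro t ht
    have ht0 : (0 : ℝ) < t := lt_trans one_pos ht
    have h1 : (∑ k ∈ Finset.Icc 1 ⌊t⌋₊, (1 : ℕ → ℂ) k) = (t : ℂ) - ((Int.fract t : ℝ) : ℂ) := by
      have h2 : (∑ k ∈ Finset.Icc 1 ⌊t⌋₊, (1 : ℕ → ℂ) k) = ((⌊t⌋₊ : ℝ) : ℂ) := by simp
      rw [h2, ← Complex.ofReal_sub, Int.self_sub_fract, ← natCast_floor_eq_intCast_floor ht0.le]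
    rw [h1, sub_mul, mul_comm (((Int.fract t : ℝ) : ℂ))]
    congr 1
    rw [show -(s+1) = -s - 1 by ring, cpow_sub _ _ (by exact_mod_cast ht0.ne'), cpow_one]
    have htc : (t : ℂ) ≠ 0 := by exact_mod_cast ht0.ne'
    field_simp
  rw [setIntegral_congr_fun measurableSet_Ioi e, integral_sub]
  · rw [integral_Ioi_cpow_of_lt (by simpa) one_pos]
    have h3 : s - 1 ≠ 0 := sub_ne_zero.mpr (by rintro rfl; simp at hs)
    have h4 : -s + 1 ≠ 0 := by
      intro h; apply h3; linear_combination -h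
    simp only [ofReal_one, one_cpow, mul_sub]
    congr 1
    field_simp
    ring
  · exact integrableOn_Ioi_cpow_of_lt (by simpa) one_pos
  · have hi : IntegrableOn (fun t : ℝ => (t : ℂ) ^ (-(s + 1))) (Ioi 1) :=
      integrableOn_Ioi_cpow_of_lt (by simp; linarith) one_pos
    refine Integrable.mul_bdd (c := 1) hi ?_ ?_
    · exact (Complex.measurable_ofReal.comp measurable_fract).aestronglyMeasurable
    · refine Eventually.of_forall fun t => ?_
      rw [Complex.norm_real, Real.norm_eq_abs, abs_of_nonneg (Int.fract_nonneg t)]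
      exact (Int.fract_lt_one t).le

/-- Analytic continuation from `Re s > 1`: after multiplication by `s - 1` both sides are analytic
on the connected half-plane `Re s > 0`. -/
lemma riemannZeta_eq_sub_mellin {s : ℂ} (hs : 0 < s.re) (hs1 : s ≠ 1) :
    riemannZeta s = s / (s - 1) - s * mellin fractTail (-s) := by
  set U : Set ℂ := {s | 0 < s.re}
  have hU : IsOpen U := isOpen_lt continuous_const Complex.continuous_re
  have hUc : IsPreconnected U := (convex_halfSpace_re_gt 0).isPreconnected
  have hf : AnalyticOnNhd ℂ riemannZeta₁ U :=
    differentiable_riemannZeta₁.differentiableOn.analyticOnNhd hU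
  have hg : AnalyticOnNhd ℂ (fun s => s - s * (s - 1) * mellin fractTail (-s)) U := by
    refine DifferentiableOn.analyticOnNhd (fun s hs => ?_) hU
    refine (DifferentiableAt.sub differentiableAt_id (DifferentiableAt.mul (by fun_prop)
      (differentiableAt_mellin_fractTail hs))).differentiableWithinAt
  have h2 : (2 : ℂ) ∈ U := by simp [U]
  have key := hf.eqOn_of_preconnected_of_eventuallyEq hg hUc h2 (by
    have : ∀ᶠ z : ℂ in 𝓝 2, 1 < z.re :=
      (isOpen_lt continuous_const Complex.continuous_re).mem_nhds (by simp)
    filter_upwards [this] with z hz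
    have hz1 : z ≠ 1 := by rintro rfl; simp at hz
    have h3 := riemannZeta_eq_inv_sub_mul hz1
    rw [riemannZeta_eq_sub_mellin_of_one_lt hz] at h3
    have h4 : z - 1 ≠ 0 := sub_ne_zero.mpr hz1
    field_simp at h3
    linear_combination -h3)
  have h3 := key hs
  have h4 : s - 1 ≠ 0 := sub_ne_zero.mpr hs1
  rw [riemannZeta_eq_inv_sub_mul hs1]
  rw [h3]
  field_simp

lemma norm_riemannZeta_le {s : ℂ} (hs : 1 / 10 ≤ s.re) (hs1 : 1 ≤ |s.im|) :
    ‖riemannZeta s‖ ≤ 12 * ‖s‖ := by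
  have h0 : 0 < s.re := by linarith
  have hne : s ≠ 1 := by rintro rfl; norm_num at hs1
  have h1 : 1 ≤ ‖s - 1‖ := hs1.trans (by simpa using Complex.abs_im_le_norm (s - 1))
  have h2 : 1 ≤ ‖s‖ := hs1.trans (Complex.abs_im_le_norm s)
  rw [riemannZeta_eq_sub_mellin h0 hne]
  have h3 : ‖s / (s - 1)‖ ≤ ‖s‖ := by
    rw [norm_div]; exact div_le_self (norm_nonneg _) h1
  have h4 : ‖s * mellin fractTail (-s)‖ ≤ ‖s‖ * 10 := by
    rw [norm_mul]
    refine mul_le_mul_of_nonneg_left ((norm_mellin_fractTail_le h0).trans ?_) (norm_nonneg _)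
    rw [div_le_iff₀ h0]; linarith
  calc _ ≤ ‖s / (s - 1)‖ + ‖s * mellin fractTail (-s)‖ := norm_sub_le _ _
    _ ≤ _ := by linarith

end

/-! ### Dividing out zeros: Jensen and Borel–Carathéodory -/

section

open Complex MeasureTheory Filter Topology Set Metric

/-- Each zero is removed once, by passing to `dslope`. The cofactor may still vanish on `Z` if a
zero is multiple. The identity holds at every `s`, even outside `U`. -/
lemma exists_eq_prod_sub_mul {U : Set ℂ} (hU : IsOpen U) (Z : Finset ℂ) :
    ∀ {f : ℂ → ℂ}, DifferentiableOn ℂ f U → (∀ ρ ∈ Z, ρ ∈ U ∧ f ρ = 0) →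
    ∃ g : ℂ → ℂ, DifferentiableOn ℂ g U ∧ ∀ s, f s = (∏ ρ ∈ Z, (s - ρ)) * g s := by
  classical
  induction Z using Finset.induction_on with
  | empty => intro f hf _; exact ⟨f, hf, by simp⟩
  | insert a Z ha ih =>
    intro f hf hZ
    obtain ⟨haU, hfa⟩ := hZ a (Finset.mem_insert_self _ _)
    have hd : ∀ s, f s = (s - a) * dslope f a s := fun s => by
      have := sub_smul_dslope f a s
      rw [hfa, sub_zero, smul_eq_mul] at this
      exact this.symm
    obtain ⟨g, hg, hfg⟩ := ih (f := dslope f a)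
      ((Complex.differentiableOn_dslope (hU.mem_nhds haU)).mpr hf) (fun ρ hρ => by
        obtain ⟨h1, h2⟩ := hZ ρ (Finset.mem_insert_of_mem hρ)
        refine ⟨h1, ?_⟩
        have h3 := hd ρ
        rw [h2] at h3
        have h4 : ρ - a ≠ 0 := sub_ne_zero.mpr (fun h => ha (h ▸ hρ))
        exact (mul_eq_zero.mp h3.symm).resolve_left h4)
    refine ⟨g, hg, fun s => ?_⟩
    rw [Finset.prod_insert ha, hd s, hfg s, mul_assoc]

lemma deriv_eq_prod_erase_mul {U : Set ℂ} (hU : IsOpen U) [DecidableEq ℂ] {Z : Finset ℂ} {f g : ℂ → ℂ}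
    (hg : DifferentiableOn ℂ g U) (hfg : ∀ s, f s = (∏ ρ ∈ Z, (s - ρ)) * g s) {ρ : ℂ} (hρ : ρ ∈ Z)
    (hρU : ρ ∈ U) : deriv f ρ = (∏ ρ' ∈ Z.erase ρ, (ρ - ρ')) * g ρ := by
  have e : f = fun s => (s - ρ) * ((∏ ρ' ∈ Z.erase ρ, (s - ρ')) * g s) := by
    funext s
    rw [hfg s, ← Finset.mul_prod_erase Z _ hρ, mul_assoc]
  have h1 : DifferentiableAt ℂ (fun s => (∏ ρ' ∈ Z.erase ρ, (s - ρ')) * g s) ρ := by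
    have := hg.differentiableAt (hU.mem_nhds hρU)
    fun_prop
  have h2 := (((hasDerivAt_id ρ).sub_const ρ).mul h1.hasDerivAt).deriv
  rw [e]
  refine h2.trans ?_
  simp

/-- The cofactor of the zeros is bounded below at the centre (Jensen's inequality). -/
lemma card_mul_log_le_of_zeros {U : Set ℂ} (hU : IsOpen U) {f : ℂ → ℂ} (hf : DifferentiableOn ℂ f U)
    {c : ℂ} {r R M : ℝ} (hr : 0 < r) (hrR : r < R) (hcU : closedBall c R ⊆ U)
    (hM : ∀ s ∈ sphere c R, ‖f s‖ ≤ M) (hc : f c ≠ 0) {Z : Finset ℂ}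
    (hZ : ∀ ρ ∈ Z, ρ ∈ closedBall c r ∧ f ρ = 0) :
    Z.card * Real.log (R / r) ≤ Real.log (M / ‖f c‖) := by
  have hR : 0 < R := hr.trans hrR
  obtain ⟨g, hg, hfg⟩ := exists_eq_prod_sub_mul hU Z hf fun ρ hρ =>
    ⟨hcU (closedBall_subset_closedBall hrR.le (hZ ρ hρ).1), (hZ ρ hρ).2⟩
  -- Blaschke factors: on `|s - c| = R` each new factor has modulus `|s - ρ|`, so `|G| = |f|` there,
  -- while at the centre each equals `R`. The maximum principle for `G` then gives the count.
  set G : ℂ → ℂ := fun s => g s * ∏ ρ ∈ Z, (((R : ℂ) ^ 2 - (starRingEnd ℂ) (ρ - c) * (s - c)) / R)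
  have hGd : DifferentiableOn ℂ G U := by
    refine hg.mul ?_
    fun_prop
  have hGR : ∀ s ∈ sphere c R, ‖G s‖ ≤ M := by
    intro s hs
    refine le_trans (le_of_eq ?_) (hM s hs)
    rw [hfg s, norm_mul, norm_mul, mul_comm, norm_prod, norm_prod]
    congr 1
    refine Finset.prod_congr rfl fun ρ _ => ?_
    have hs' : (s - c) * (starRingEnd ℂ) (s - c) = (R : ℂ) ^ 2 := by
      rw [Complex.mul_conj, Complex.normSq_eq_norm_sq]
      rw [mem_sphere_iff_norm] at hs
      rw [hs]; push_cast; ring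
    have e : (R : ℂ) ^ 2 - (starRingEnd ℂ) (ρ - c) * (s - c) = (s - c) * (starRingEnd ℂ) (s - ρ) := by
      rw [← hs']
      simp only [map_sub]
      ring
    rw [e, norm_div, norm_mul, RCLike.norm_conj, mem_sphere_iff_norm.mp hs, Complex.norm_real,
      Real.norm_eq_abs, abs_of_pos hR]
    field_simp
  have hGc : ‖G c‖ ≤ M := by
    refine norm_le_of_forall_mem_frontier_norm_le (U := ball c R) isBounded_ball
      ((hGd.mono hcU).diffContOnCl_ball subset_rfl) ?_ (subset_closure (mem_ball_self hR))
    intro s hs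
    exact hGR s (frontier_ball_subset_sphere hs)
  have hGc' : ‖G c‖ = ‖g c‖ * R ^ Z.card := by
    simp only [G, norm_mul, sub_self, mul_zero, sub_zero, Finset.prod_const, norm_pow, norm_div,
      Complex.norm_real, Real.norm_eq_abs, abs_of_pos hR]
    congr 2
    field_simp
  have hfc : ‖f c‖ ≤ ‖g c‖ * r ^ Z.card := by
    rw [hfg c, norm_mul, mul_comm, norm_prod]
    refine mul_le_mul_of_nonneg_left ?_ (norm_nonneg _)
    rw [← Finset.prod_const]
    refine Finset.prod_le_prod (fun _ _ => norm_nonneg _) (fun ρ hρ => ?_)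
    have := (hZ ρ hρ).1
    rwa [mem_closedBall, dist_comm, dist_eq_norm] at this
  have hfpos : 0 < ‖f c‖ := norm_pos_iff.mpr hc
  rw [← Real.log_pow]
  refine Real.log_le_log (pow_pos (div_pos hR hr) _) ?_
  rw [le_div_iff₀ hfpos]
  calc (R / r) ^ Z.card * ‖f c‖ ≤ (R / r) ^ Z.card * (‖g c‖ * r ^ Z.card) := by gcongr
    _ = ‖g c‖ * R ^ Z.card := by rw [div_pow]; field_simp
    _ ≤ M := hGc' ▸ hGc

/-- The logarithm is a primitive of `g'/g` on the disc. -/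
lemma exists_exp_eq_of_ne_zero {g : ℂ → ℂ} {c : ℂ} {r : ℝ} (hr : 0 < r) (hg : DifferentiableOn ℂ g (ball c r))
    (h0 : ∀ s ∈ ball c r, g s ≠ 0) :
    ∃ h : ℂ → ℂ, DifferentiableOn ℂ h (ball c r) ∧ h c = 0 ∧ ∀ s ∈ ball c r, g s = g c * exp (h s) := by
  have hd : DifferentiableOn ℂ (fun s => deriv g s / g s) (ball c r) :=
    (hg.deriv isOpen_ball).div hg h0
  obtain ⟨h, hc, hh⟩ := hd.isExactOn_ball.with_val_at c 0
  have hhd : DifferentiableOn ℂ h (ball c r) := fun s hs => (hh s hs).differentiableAt.differentiableWithinAt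
  refine ⟨h, hhd, hc, fun s hs => ?_⟩
  have key := isOpen_ball.is_const_of_deriv_eq_zero (convex_ball c r).isPreconnected
    (f := fun s => g s * exp (-h s)) (hg.mul (hhd.neg.cexp)) (by
      intro z hz
      have h1 := ((hg.differentiableAt (isOpen_ball.mem_nhds hz)).hasDerivAt.mul
        ((hh z hz).neg.cexp)).deriv
      have h2 := h0 z hz
      simp only [Pi.zero_apply]
      refine h1.trans ?_
      field_simp
      ring) hs (mem_ball_self hr)
  simp only [hc, neg_zero, exp_zero, mul_one] at key
  rw [← key, mul_assoc, ← exp_add]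
  simp

/-- A lower bound for an analytic function in a disc, in terms of the distances to its zeros. -/
lemma norm_ge_prod_of_simple_zeros {U : Set ℂ} (hU : IsOpen U) {f : ℂ → ℂ} (hf : DifferentiableOn ℂ f U)
    {c : ℂ} {K : ℝ} (hK : 1 ≤ K) (hcU : closedBall c 7 ⊆ U)
    (hM : ∀ s ∈ sphere c 7, ‖f s‖ ≤ Real.exp K) (hc : Real.exp (-K) ≤ ‖f c‖) {Z : Finset ℂ}
    (hZ : ∀ ρ, ρ ∈ Z ↔ ρ ∈ closedBall c 6 ∧ f ρ = 0) (hsimple : ∀ ρ ∈ Z, deriv f ρ ≠ 0) :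
    (Z.card : ℝ) ≤ 14 * K ∧
      ∀ s ∈ closedBall c 5.1, Real.exp (-(400 * K)) * ∏ ρ ∈ Z, ‖s - ρ‖ ≤ ‖f s‖ := by
  classical
  have hfc : f c ≠ 0 := norm_pos_iff.mp ((Real.exp_pos _).trans_le hc)
  have hfpos : 0 < ‖f c‖ := norm_pos_iff.mpr hfc
  have hcard : (Z.card : ℝ) ≤ 14 * K := by
    have h1 := card_mul_log_le_of_zeros hU hf (c := c) (r := 6) (R := 7) (by norm_num) (by norm_num)
      hcU hM hfc (Z := Z) (fun ρ hρ => (hZ ρ).mp hρ)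
    have h2 : Real.log (Real.exp K / ‖f c‖) ≤ 2 * K := by
      rw [Real.log_div (Real.exp_pos _).ne' hfpos.ne', Real.log_exp]
      have := Real.log_le_log (Real.exp_pos _) hc
      rw [Real.log_exp] at this
      linarith
    have h3 : (1 : ℝ) / 7 ≤ Real.log (7 / 6) := by
      have := Real.one_sub_inv_le_log_of_pos (x := 7 / 6) (by norm_num)
      norm_num at this ⊢
      linarith
    nlinarith [(Nat.cast_nonneg Z.card : (0:ℝ) ≤ Z.card)]
  refine ⟨hcard, fun s hs => ?_⟩
  have hZU : ∀ ρ ∈ Z, ρ ∈ U := fun ρ hρ =>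
    hcU (closedBall_subset_closedBall (by norm_num) ((hZ ρ).mp hρ).1)
  obtain ⟨g, hg, hfg⟩ := exists_eq_prod_sub_mul hU Z hf fun ρ hρ => ⟨hZU ρ hρ, ((hZ ρ).mp hρ).2⟩
  -- This is where simplicity enters: a zero of the cofactor would be a zero of `f` lying in `Z` at
  -- which `f'` vanishes.
  have hgne : ∀ s ∈ closedBall c 6, g s ≠ 0 := by
    intro s hs h0
    have hfs : f s = 0 := by rw [hfg s, h0, mul_zero]
    have hsZ : s ∈ Z := (hZ s).mpr ⟨hs, hfs⟩
    apply hsimple s hsZ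
    rw [deriv_eq_prod_erase_mul hU hg hfg hsZ (hZU s hsZ), h0, mul_zero]
  -- The zeros lie in radius 6, so on the circle of radius 7 every factor `|z - ρ|` is at least 1
  -- and `|g| ≤ |f|` there.
  have hgM : ∀ s ∈ closedBall c 7, ‖g s‖ ≤ Real.exp K := by
    intro s hs
    refine norm_le_of_forall_mem_frontier_norm_le (U := ball c 7) isBounded_ball
      ((hg.mono hcU).diffContOnCl_ball subset_rfl) ?_ (by rwa [closure_ball c (by norm_num)])
    intro z hz
    have hz7 := frontier_ball_subset_sphere hz
    refine le_trans ?_ (hM z hz7)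
    rw [hfg z, norm_mul, norm_prod]
    refine le_mul_of_one_le_left (norm_nonneg _) ?_
    rw [← Finset.prod_const_one (s := Z)]
    refine Finset.prod_le_prod (fun _ _ => zero_le_one) fun ρ hρ => ?_
    have h6 := ((hZ ρ).mp hρ).1
    rw [mem_closedBall, dist_eq_norm] at h6
    rw [mem_sphere_iff_norm] at hz7
    have : ‖z - c‖ ≤ ‖z - ρ‖ + ‖ρ - c‖ := by simpa using norm_add_le (z - ρ) (ρ - c)
    linarith
  have hgc : Real.exp (-(29 * K)) ≤ ‖g c‖ := by
    have h1 : ‖f c‖ ≤ ‖g c‖ * 6 ^ Z.card := by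
      rw [hfg c, norm_mul, mul_comm, norm_prod]
      refine mul_le_mul_of_nonneg_left ?_ (norm_nonneg _)
      rw [← Finset.prod_const]
      refine Finset.prod_le_prod (fun _ _ => norm_nonneg _) (fun ρ hρ => ?_)
      have := ((hZ ρ).mp hρ).1
      rwa [mem_closedBall, dist_comm, dist_eq_norm] at this
    have h2 : (6 : ℝ) ^ Z.card ≤ Real.exp (28 * K) := by
      have h6 : (6 : ℝ) ≤ Real.exp 2 := by
        have := Real.exp_one_gt_d9
        rw [show (2:ℝ) = 1 + 1 by norm_num, Real.exp_add]
        nlinarith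
      calc (6 : ℝ) ^ Z.card ≤ (Real.exp 2) ^ Z.card := by gcongr
        _ = Real.exp (Z.card * 2) := by rw [← Real.exp_nat_mul]
        _ ≤ _ := Real.exp_le_exp.mpr (by linarith)
    have h3 : Real.exp (-K) ≤ ‖g c‖ * Real.exp (28 * K) :=
      hc.trans (h1.trans (mul_le_mul_of_nonneg_left h2 (norm_nonneg _)))
    rw [show -(29 * K) = -K + -(28 * K) by ring, Real.exp_add, Real.exp_neg (28 * K),
      ← div_eq_mul_inv, div_le_iff₀ (Real.exp_pos _)]
    exact h3
  obtain ⟨h, hhd, hhc, hgh⟩ := exists_exp_eq_of_ne_zero (c := c) (r := 6) (by norm_num)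
    (hg.mono ((ball_subset_closedBall.trans (closedBall_subset_closedBall (by norm_num))).trans hcU))
    (fun s hs => hgne s (ball_subset_closedBall hs))
  have hre : ∀ z ∈ ball c 6, (h z).re ≤ 30 * K := by
    intro z hz
    have h1 := hgM z (closedBall_subset_closedBall (by norm_num) (ball_subset_closedBall hz))
    rw [hgh z hz, norm_mul, Complex.norm_exp] at h1
    have h2 : Real.exp (-(29 * K)) * Real.exp (h z).re ≤ Real.exp K :=
      (mul_le_mul_of_nonneg_right hgc (Real.exp_pos _).le).trans h1
    rw [← Real.exp_add, Real.exp_le_exp] at h2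
    linarith
  have hsc : ‖s - c‖ ≤ 5.1 := by rwa [mem_closedBall, dist_eq_norm] at hs
  -- At distance at most 5.1 from the centre this gives `2 · 30K · 5.1 / 0.9 = 340K`, rounded up to
  -- `360K` below.
  have hBC := Complex.borelCaratheodory_zero (f := fun z => h (z + c)) (M := 30 * K) (R := 6)
    (z := s - c) (by linarith) (by
      refine hhd.comp (by fun_prop) fun z hz => ?_
      simpa [dist_eq_norm] using hz) (fun z hz => hre _ (by simpa [dist_eq_norm] using hz)) (by norm_num)
      (by rw [mem_ball_zero_iff]; norm_num at hsc; linarith) (by simpa using hhc)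
  simp only [sub_add_cancel] at hBC
  have hBC' : ‖h s‖ ≤ 360 * K := by
    refine hBC.trans ?_
    rw [div_le_iff₀ (by norm_num at hsc; linarith)]
    norm_num at hsc
    nlinarith
  have hs6 : s ∈ ball c 6 := by
    rw [mem_ball, dist_eq_norm]; norm_num at hsc; linarith
  have hgs : Real.exp (-(400 * K)) ≤ ‖g s‖ := by
    rw [hgh s hs6, norm_mul, Complex.norm_exp]
    have h1 : -(360 * K) ≤ (h s).re := by
      have := Complex.abs_re_le_norm (h s)
      have := neg_abs_le (h s).re
      linarith
    calc Real.exp (-(400 * K)) ≤ Real.exp (-(29 * K)) * Real.exp (-(360 * K)) := by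
          rw [← Real.exp_add]; exact Real.exp_le_exp.mpr (by linarith)
      _ ≤ _ := by gcongr
  rw [hfg s, norm_mul, norm_prod, mul_comm]
  gcongr

end

/-! ### Crude upper and lower bounds for zeta, zero counts, good heights -/

section

open Complex MeasureTheory Filter Topology Set Metric

lemma Complex.norm_Gamma_le {s : ℂ} (hs : 0 < s.re) : ‖Complex.Gamma s‖ ≤ Real.Gamma s.re := by
  rw [Complex.Gamma_eq_integral hs, Complex.GammaIntegral, Real.Gamma_eq_integral hs]
  refine (norm_integral_le_integral_norm _).trans (le_of_eq ?_)
  refine setIntegral_congr_fun measurableSet_Ioi fun t ht => ?_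
  have ht0 : (0 : ℝ) < t := ht
  simp only [norm_mul, Complex.norm_cpow_eq_rpow_re_of_pos ht0, Complex.norm_real, Real.norm_eq_abs,
    Real.abs_exp]
  simp

lemma Complex.norm_cos_le_exp (z : ℂ) : ‖Complex.cos z‖ ≤ Real.exp |z.im| := by
  rw [Complex.cos, norm_div]
  have h1 : ‖cexp (z * I)‖ ≤ Real.exp |z.im| := by
    rw [Complex.norm_exp, Real.exp_le_exp]; simpa using neg_le_abs z.im
  have h2 : ‖cexp (-z * I)‖ ≤ Real.exp |z.im| := by
    rw [Complex.norm_exp, Real.exp_le_exp]; simpa using le_abs_self z.im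
  rw [div_le_iff₀ (by simp)]
  refine (norm_add_le _ _).trans ?_
  simp only [Complex.norm_ofNat]
  linarith

/-- The strip is that of the discs of radius 7 about `3 + iτ`. To the left of `1/10` the functional
equation is used with `|Γ(w)| ≤ Γ(Re w)` only; exponential growth is affordable because the Gaussian
weight will absorb it. -/
lemma exists_norm_riemannZeta_le_exp : ∃ K : ℝ, 1 ≤ K ∧ ∀ s : ℂ, -4 ≤ s.re → s.re ≤ 10 → 1 ≤ |s.im| →
    ‖riemannZeta s‖ ≤ Real.exp (K * |s.im|) := by
  obtain ⟨G, hG⟩ := (isCompact_Icc (a := (9 / 10 : ℝ)) (b := 5)).exists_bound_of_continuousOn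
    (f := Real.Gamma) (fun x hx => (Real.differentiableAt_Gamma (fun m => by
      have := hx.1
      have hm : (0 : ℝ) ≤ m := Nat.cast_nonneg m
      linarith)).continuousAt.continuousWithinAt)
  set G' := max G 1
  have hG'1 : 1 ≤ G' := le_max_right _ _
  have hsmall : ∀ s : ℂ, 1 / 10 ≤ s.re → s.re ≤ 10 → 1 ≤ |s.im| →
      ‖riemannZeta s‖ ≤ 132 * Real.exp |s.im| := by
    intro s h1 h2 h3
    have h4 : ‖s‖ ≤ 11 * |s.im| := by
      have := Complex.norm_le_abs_re_add_abs_im s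
      rw [abs_of_nonneg (by linarith : 0 ≤ s.re)] at this
      linarith
    have h5 : |s.im| ≤ Real.exp |s.im| := by linarith [Real.add_one_le_exp |s.im|]
    linarith [norm_riemannZeta_le h1 h3]
  refine ⟨4 + Real.log (264 * G'), ?_, fun s h1 h2 h3 => ?_⟩
  · linarith [Real.log_nonneg (by linarith : 1 ≤ 264 * G')]
  have hlog : 264 * G' * Real.exp (4 * |s.im|) ≤ Real.exp ((4 + Real.log (264 * G')) * |s.im|) := by
    rw [add_mul, Real.exp_add, mul_comm]
    gcongr
    nth_rewrite 1 [← Real.exp_log (by linarith : 0 < 264 * G')]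
    rw [Real.exp_le_exp]
    exact le_mul_of_one_le_right (Real.log_nonneg (by linarith)) h3
  refine le_trans ?_ hlog
  rcases le_or_gt (1 / 10) s.re with h | h
  · refine (hsmall s h h2 h3).trans ?_
    have : Real.exp |s.im| ≤ Real.exp (4 * |s.im|) := Real.exp_le_exp.mpr (by linarith)
    nlinarith [Real.exp_pos |s.im|]
  · set w : ℂ := 1 - s with hw
    have hwre : w.re = 1 - s.re := by simp [hw]
    have hwim : |w.im| = |s.im| := by simp [hw]
    have hwpos : 0 < w.re := by rw [hwre]; linarith
    have hfe := riemannZeta_one_sub (s := w) (fun n hn => by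
      rw [hn] at hwpos; simp at hwpos; linarith [(Nat.cast_nonneg n : (0 : ℝ) ≤ n)]) (by
      rintro h; rw [h] at hwim; simp at hwim; rw [← hwim] at h3; norm_num at h3)
    have hsw : riemannZeta s = riemannZeta (1 - w) := by simp [hw]
    rw [hsw, hfe]
    simp only [norm_mul, Complex.norm_ofNat]
    have e1 : ‖(2 * (Real.pi : ℂ)) ^ (-w)‖ ≤ 1 := by
      rw [show (2 * (Real.pi : ℂ)) = ((2 * Real.pi : ℝ) : ℂ) by push_cast; ring,
        Complex.norm_cpow_eq_rpow_re_of_pos (by positivity)]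
      refine Real.rpow_le_one_of_one_le_of_nonpos ?_ (by simp; linarith)
      linarith [Real.pi_gt_three]
    have e2 : ‖Complex.Gamma w‖ ≤ G' := by
      refine (Complex.norm_Gamma_le hwpos).trans ?_
      refine le_trans (le_trans (le_abs_self _) (hG w.re ⟨by rw [hwre]; linarith, by rw [hwre]; linarith⟩)) (le_max_left _ _)
    have e3 : ‖Complex.cos (Real.pi * w / 2)‖ ≤ Real.exp (2 * |s.im|) := by
      refine (Complex.norm_cos_le_exp _).trans (Real.exp_le_exp.mpr ?_)
      have : (Real.pi * w / 2 : ℂ).im = Real.pi / 2 * w.im := by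
        rw [show (Real.pi * w / 2 : ℂ) = ((Real.pi / 2 : ℝ) : ℂ) * w by push_cast; ring, Complex.im_ofReal_mul]
      rw [this, abs_mul, hwim, abs_of_pos (by positivity)]
      have := Real.pi_lt_four
      have := abs_nonneg s.im
      nlinarith
    have e4 : ‖riemannZeta w‖ ≤ 132 * Real.exp |s.im| := by
      rw [← hwim]
      refine hsmall w ?_ ?_ (by rwa [hwim]) <;> rw [hwre] <;> linarith
    calc 2 * ‖(2 * (Real.pi : ℂ)) ^ (-w)‖ * ‖Complex.Gamma w‖ * ‖Complex.cos (Real.pi * w / 2)‖ * ‖riemannZeta w‖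
        ≤ 2 * 1 * G' * Real.exp (2 * |s.im|) * (132 * Real.exp |s.im|) := by gcongr
      _ = 264 * G' * Real.exp (3 * |s.im|) := by
          rw [show 3 * |s.im| = 2 * |s.im| + |s.im| by ring, Real.exp_add]; ring
      _ ≤ _ := by
          have := abs_nonneg s.im
          gcongr
          linarith

open ArithmeticFunction ArithmeticFunction.Moebius LSeries.notation in
-- `1/ζ(s) = ∑ μ(n) n^{-s}` is bounded by `π²/6 < 2`.
lemma half_le_norm_riemannZeta {s : ℂ} (hs : 2 ≤ s.re) : 1 / 2 ≤ ‖riemannZeta s‖ := by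
  have hs1 : 1 < s.re := by linarith
  have h := LSeries_zeta_mul_Lseries_moebius hs1
  rw [LSeries_zeta_eq_riemannZeta hs1] at h
  have hsum : Summable fun n : ℕ => 1 / (n : ℝ) ^ 2 := Real.summable_one_div_nat_pow.mpr one_lt_two
  have hb : ∀ n : ℕ, ‖LSeries.term ↗μ s n‖ ≤ 1 / (n : ℝ) ^ 2 := by
    intro n
    rcases eq_or_ne n 0 with rfl | hn
    · simp
    rw [LSeries.norm_term_eq, if_neg hn]
    have hn1 : (1 : ℝ) ≤ n := by exact_mod_cast Nat.one_le_iff_ne_zero.mpr hn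
    gcongr
    · have : |μ n| ≤ 1 := abs_moebius_le_one
      rw [Complex.norm_intCast]
      exact_mod_cast this
    · rw [← Real.rpow_natCast]
      exact Real.rpow_le_rpow_of_exponent_le hn1 (by exact_mod_cast hs)
  have hL : ‖LSeries ↗μ s‖ ≤ 2 := by
    refine (tsum_of_norm_bounded hsum.hasSum hb).trans ?_
    rw [hasSum_zeta_two.tsum_eq]
    have := Real.pi_lt_d2
    have := Real.pi_pos
    nlinarith
  have h2 : ‖riemannZeta s‖ * ‖LSeries ↗μ s‖ = 1 := by rw [← norm_mul, h, norm_one]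
  nlinarith [norm_nonneg (riemannZeta s)]

lemma differentiableOn_riemannZeta_compl : DifferentiableOn ℂ riemannZeta {1}ᶜ :=
  fun _ hs => (differentiableAt_riemannZeta hs).differentiableWithinAt

lemma closedBall_subset_compl_one {c : ℂ} {R : ℝ} (h : R < c.im) : closedBall c R ⊆ {1}ᶜ := by
  intro s hs h1
  rw [mem_singleton_iff.mp h1, mem_closedBall, dist_eq_norm] at hs
  have := Complex.abs_im_le_norm (1 - c)
  simp only [sub_im, one_im, zero_sub, abs_neg] at this
  linarith [le_abs_self c.im]

/-- The number of zeros on the critical line with ordinate in a unit interval is `O(log t)`. -/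
lemma exists_card_zeros_le : ∃ C : ℝ, 1 ≤ C ∧ ∀ t : ℝ, 3 ≤ t → ∀ Z : Finset ℂ,
    (∀ ρ ∈ Z, riemannZeta ρ = 0 ∧ ρ.re = 1 / 2 ∧ |ρ.im - t| ≤ 1 / 2) →
    (Z.card : ℝ) ≤ C * Real.log t := by
  have hl : 0 < Real.log (1.9 / 1.6) := Real.log_pos (by norm_num)
  refine ⟨6 / Real.log (1.9 / 1.6) + 1, by linarith [div_pos (by norm_num : (0:ℝ) < 6) hl], ?_⟩
  intro t ht Z hZ
  set c : ℂ := 2 + t * I with hc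
  have hcre : c.re = 2 := by simp [hc]
  have hcim : c.im = t := by simp [hc]
  have hc2 := half_le_norm_riemannZeta (s := c) hcre.ge
  have hcpos : 0 < ‖riemannZeta c‖ := by linarith
  have hlt : 1 < Real.log t := by
    rw [← Real.log_exp 1]
    refine Real.log_lt_log (Real.exp_pos _) ?_
    linarith [Real.exp_one_lt_d9]
  -- About `2 + it` the zeros are at distance at most `√(9/4 + 1/4) < 1.6`, and radius 1.9 stays in
  -- `Re s ≥ 1/10`, where zeta grows linearly.
  have h1 := card_mul_log_le_of_zeros (isOpen_compl_singleton (x := (1 : ℂ))) differentiableOn_riemannZeta_compl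
    (c := c) (r := 1.6) (R := 1.9) (M := 12 * (t + 4)) (by norm_num) (by norm_num)
    (closedBall_subset_compl_one (by rw [hcim]; norm_num; linarith)) (by
      intro s hs
      rw [mem_sphere_iff_norm] at hs
      have hre := Complex.abs_re_le_norm (s - c)
      have him := Complex.abs_im_le_norm (s - c)
      rw [hs, sub_re, hcre, abs_le] at hre
      rw [hs, sub_im, hcim, abs_le] at him
      norm_num at hre him
      have hspos : 0 ≤ s.im := by linarith [him.1]
      refine (norm_riemannZeta_le (by linarith [hre.1]) (by rw [abs_of_nonneg hspos]; linarith [him.1])).trans ?_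
      have hcn : ‖c‖ ≤ 2 + t := by
        have := Complex.norm_le_abs_re_add_abs_im c
        rwa [hcre, hcim, abs_of_pos (by norm_num), abs_of_nonneg (by linarith)] at this
      have : ‖s‖ ≤ ‖s - c‖ + ‖c‖ := by simpa using norm_add_le (s - c) c
      rw [hs] at this
      norm_num at this
      linarith) (norm_pos_iff.mp hcpos) (Z := Z) (by
      intro ρ hρ
      obtain ⟨h0, hre, him⟩ := hZ ρ hρ
      refine ⟨?_, h0⟩
      rw [mem_closedBall, dist_eq_norm, Complex.norm_eq_sqrt_sq_add_sq, Real.sqrt_le_left (by norm_num),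
        sub_re, sub_im, hcre, hcim, hre]
      rw [abs_le] at him
      norm_num
      nlinarith [him.1, him.2])
  have h2 : Real.log (12 * (t + 4) / ‖riemannZeta c‖) ≤ 6 * Real.log t := by
    have e : 6 * Real.log t = Real.log (t ^ 6) := by rw [Real.log_pow]; norm_num
    rw [e]
    refine Real.log_le_log (by positivity) ?_
    rw [div_le_iff₀ hcpos]
    have h3 : 24 * (t + 4) ≤ t ^ 6 := by
      have : 3 ^ 5 * t ≤ t ^ 5 * t := by gcongr
      nlinarith
    nlinarith [pow_pos (by linarith : 0 < t) 6]
  have h3 := h1.trans h2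
  rw [← le_div_iff₀ hl] at h3
  rw [add_mul, one_mul, div_mul_eq_mul_div]
  linarith

/-- The forbidden intervals have total length `card / (2 (card + 1))`, less than `1/2`. -/
lemma exists_forall_le_abs_sub (Z : Finset ℝ) (τ : ℝ) :
    ∃ t ∈ Icc τ (τ + 1 / 2), ∀ γ ∈ Z, 1 / (4 * (Z.card + 1) : ℝ) ≤ |t - γ| := by
  by_contra! h
  set d : ℝ := 1 / (4 * (Z.card + 1) : ℝ) with hd
  have hdpos : 0 < d := by positivity
  have hsub : Icc τ (τ + 1 / 2) ⊆ ⋃ γ ∈ Z, ball γ d := by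
    intro t ht
    obtain ⟨γ, hγ, hlt⟩ := h t ht
    exact mem_biUnion hγ (by rwa [mem_ball, Real.dist_eq])
  have h1 := (measure_mono (μ := volume) hsub).trans (measure_biUnion_finset_le Z _)
  simp only [Real.volume_Icc, Real.volume_ball, Finset.sum_const, nsmul_eq_mul] at h1
  rw [show (Z.card : ENNReal) = ENNReal.ofReal Z.card by simp, ← ENNReal.ofReal_mul (by positivity),
    ENNReal.ofReal_le_ofReal_iff (by positivity)] at h1
  have : (Z.card : ℝ) * (2 * d) = Z.card / (2 * (Z.card + 1)) := by rw [hd]; field_simp; norm_num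
  rw [this, le_div_iff₀ (by positivity)] at h1
  linarith

/-- Under simplicity of the high zeros, there are heights at which `ζ` is not too small. -/
lemma exists_height_riemannZeta_ge (T₀ : ℝ) (hsimple : ∀ ρ : ℂ, riemannZeta ρ = 0 → T₀ ≤ ρ.im →
    deriv riemannZeta ρ ≠ 0) : ∃ K : ℝ, 1 ≤ K ∧ ∀ τ : ℝ, 10 ≤ τ → T₀ + 7 ≤ τ →
    ∃ t ∈ Icc τ (τ + 1 / 2), ∀ σ ∈ Icc (-2 : ℝ) 3,
      Real.exp (-(K * τ * Real.log τ)) ≤ ‖riemannZeta (σ + t * I)‖ := by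
  classical
  obtain ⟨K₀, hK₀, hbound⟩ := exists_norm_riemannZeta_le_exp
  -- On the disc of radius 7 the ordinate is at most `τ + 7 ≤ 2τ`.
  set K₁ : ℝ := 2 * K₀ with hK₁
  set L : ℝ := Real.log (60 * K₁) with hL
  have hLpos : 0 ≤ L := Real.log_nonneg (by linarith)
  refine ⟨400 * K₁ + 14 * K₁ * (L + 1), by nlinarith, fun τ hτ hτ₀ => ?_⟩
  set c : ℂ := 3 + τ * I with hc
  have hcre : c.re = 3 := by simp [hc]
  have hcim : c.im = τ := by simp [hc]
  have hcU : closedBall c 7 ⊆ {1}ᶜ := closedBall_subset_compl_one (by rw [hcim]; linarith)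
  have hfin : (closedBall c 6 ∩ riemannZetaZeros).Finite :=
    (isCompact_closedBall c 6).inter_riemannZetaZeros_finite
  set Z : Finset ℂ := hfin.toFinset with hZdef
  have hZ : ∀ ρ, ρ ∈ Z ↔ ρ ∈ closedBall c 6 ∧ riemannZeta ρ = 0 := by
    intro ρ; simp [hZdef, mem_riemannZetaZeros]
  have hlog1 : 1 ≤ Real.log τ := by
    rw [← Real.log_exp 1]
    refine Real.log_le_log (Real.exp_pos _) ?_
    linarith [Real.exp_one_lt_d9]
  obtain ⟨hcard, hlow⟩ := norm_ge_prod_of_simple_zeros (isOpen_compl_singleton (x := (1 : ℂ)))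
    differentiableOn_riemannZeta_compl (c := c) (K := K₁ * τ) (by nlinarith) hcU (by
      intro s hs
      rw [mem_sphere_iff_norm] at hs
      have hre := Complex.abs_re_le_norm (s - c)
      have him := Complex.abs_im_le_norm (s - c)
      rw [hs, sub_re, hcre, abs_le] at hre
      rw [hs, sub_im, hcim, abs_le] at him
      have hspos : |s.im| = s.im := abs_of_nonneg (by linarith [him.1])
      refine (hbound s (by linarith [hre.1]) (by linarith [hre.2]) (by rw [hspos]; linarith [him.1])).trans ?_
      rw [Real.exp_le_exp, hspos, hK₁]
      nlinarith [him.2]) (by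
      refine le_trans ?_ (half_le_norm_riemannZeta (s := c) (by rw [hcre]; norm_num))
      have h1 : Real.exp (-(K₁ * τ)) ≤ Real.exp (-1) := Real.exp_le_exp.mpr (by nlinarith)
      have h2 : Real.exp (-1) ≤ 1 / 2 := by
        rw [Real.exp_neg, one_div]
        exact inv_anti₀ (by norm_num) (by linarith [Real.exp_one_gt_d9])
      exact h1.trans h2) hZ (by
      intro ρ hρ
      obtain ⟨h1, h2⟩ := (hZ ρ).mp hρ
      refine hsimple ρ h2 ?_
      rw [mem_closedBall, dist_eq_norm] at h1
      have him := (Complex.abs_im_le_norm (ρ - c)).trans h1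
      rw [sub_im, hcim, abs_le] at him
      linarith [him.1])
  obtain ⟨t, ht, hdist⟩ := exists_forall_le_abs_sub (Z.image Complex.im) τ
  refine ⟨t, ht, fun σ hσ => ?_⟩
  -- The radius 5.1 is needed for `σ = -2`: the distance to `3 + iτ` is at most `√(25 + 1/4)`.
  have hs := hlow (σ + t * I) (by
    rw [mem_closedBall, dist_eq_norm, Complex.norm_eq_sqrt_sq_add_sq, Real.sqrt_le_left (by norm_num),
      sub_re, sub_im, hcre, hcim]
    simp only [add_re, add_im, ofReal_re, ofReal_im, mul_re, mul_im, I_re, I_im]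
    norm_num
    nlinarith [hσ.1, hσ.2, ht.1, ht.2])
  refine le_trans ?_ hs
  set n := Z.card with hn
  have hd : ∀ ρ ∈ Z, 1 / (4 * (n + 1) : ℝ) ≤ ‖(σ + t * I : ℂ) - ρ‖ := by
    intro ρ hρ
    have h1 := hdist ρ.im (Finset.mem_image_of_mem _ hρ)
    have h2 : ((Z.image Complex.im).card : ℝ) ≤ n := by exact_mod_cast Finset.card_image_le
    have h3 : 1 / (4 * (n + 1) : ℝ) ≤ 1 / (4 * ((Z.image Complex.im).card + 1) : ℝ) := by gcongr
    have h4 := Complex.abs_im_le_norm ((σ + t * I : ℂ) - ρ)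
    simp only [sub_im, add_im, ofReal_im, mul_im, ofReal_re, I_im, I_re] at h4
    norm_num at h4
    exact (h3.trans h1).trans h4
  -- With `n ≤ 14 K₁ τ` zeros, each at vertical distance at least `1/(4(n+1))`, the product costs
  -- `exp(-O(τ log τ))`, which is the size of the final bound.
  have hprod : Real.exp (-(n * Real.log (4 * (n + 1)))) ≤ ∏ ρ ∈ Z, ‖(σ + t * I : ℂ) - ρ‖ := by
    have h1 : Real.exp (-(n * Real.log (4 * (n + 1)))) = ∏ _ρ ∈ Z, 1 / (4 * (n + 1) : ℝ) := by
      rw [Finset.prod_const, ← hn, Real.exp_neg, Real.exp_nat_mul, Real.exp_log (by positivity), one_div,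
        inv_pow]
    rw [h1]
    exact Finset.prod_le_prod (fun _ _ => by positivity) hd
  have hlogn : Real.log (4 * (n + 1)) ≤ (L + 1) * Real.log τ := by
    have h1 : (4 * (n + 1) : ℝ) ≤ 60 * K₁ * τ := by nlinarith
    have h2 := Real.log_le_log (by positivity) h1
    rw [Real.log_mul (x := 60 * K₁) (by positivity) (by positivity)] at h2
    nlinarith
  calc Real.exp (-((400 * K₁ + 14 * K₁ * (L + 1)) * τ * Real.log τ))
      ≤ Real.exp (-(400 * (K₁ * τ)) + -(n * Real.log (4 * (n + 1)))) := by
        rw [Real.exp_le_exp]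
        have h1 : n * Real.log (4 * (n + 1)) ≤ (14 * (K₁ * τ)) * ((L + 1) * Real.log τ) := by
          gcongr
          exact Real.log_nonneg (by linarith [(Nat.cast_nonneg n : (0:ℝ) ≤ n)])
        have h2 : 400 * (K₁ * τ) ≤ 400 * (K₁ * τ) * Real.log τ := by
          refine le_mul_of_one_le_right (by positivity) hlog1
        linarith
    _ ≤ _ := by rw [Real.exp_add]; gcongr

end

/-! ### Residue theorem on a rectangle with simple poles -/

section

open Complex MeasureTheory Filter Topology Set Metric

/-- The integral of `f` along the boundary of the rectangle `[a, b] × [c, d]`. -/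
noncomputable def rectIntegral (f : ℂ → ℂ) (a b c d : ℝ) : ℂ :=
  (∫ x : ℝ in a..b, f (x + c * I)) - (∫ x : ℝ in a..b, f (x + d * I)) +
    I * (∫ y : ℝ in c..d, f (b + y * I)) - I * (∫ y : ℝ in c..d, f (a + y * I))

/-- The boundary of the rectangle `[a, b] × [c, d]`. -/
def rectBoundary (a b c d : ℝ) : Set ℂ :=
  {s | s.re ∈ Icc a b ∧ s.im ∈ Icc c d ∧ (s.re = a ∨ s.re = b ∨ s.im = c ∨ s.im = d)}

section rect
variable {a b c d : ℝ} {f g : ℂ → ℂ}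

lemma horizontal_mem_rectBoundary_bot (hab : a ≤ b) (hcd : c ≤ d) {x : ℝ} (hx : x ∈ uIcc a b) :
    (x + c * I : ℂ) ∈ rectBoundary a b c d := by
  rw [uIcc_of_le hab] at hx
  simp [rectBoundary, hx.1, hx.2, hcd]

lemma horizontal_mem_rectBoundary_top (hab : a ≤ b) (hcd : c ≤ d) {x : ℝ} (hx : x ∈ uIcc a b) :
    (x + d * I : ℂ) ∈ rectBoundary a b c d := by
  rw [uIcc_of_le hab] at hx
  simp [rectBoundary, hx.1, hx.2, hcd]

lemma vertical_mem_rectBoundary_left (hab : a ≤ b) (hcd : c ≤ d) {y : ℝ} (hy : y ∈ uIcc c d) :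
    (a + y * I : ℂ) ∈ rectBoundary a b c d := by
  rw [uIcc_of_le hcd] at hy
  simp [rectBoundary, hy.1, hy.2, hab]

lemma vertical_mem_rectBoundary_right (hab : a ≤ b) (hcd : c ≤ d) {y : ℝ} (hy : y ∈ uIcc c d) :
    (b + y * I : ℂ) ∈ rectBoundary a b c d := by
  rw [uIcc_of_le hcd] at hy
  simp [rectBoundary, hy.1, hy.2, hab]

lemma rectIntegral_congr (hab : a ≤ b) (hcd : c ≤ d) (h : ∀ s ∈ rectBoundary a b c d, f s = g s) :
    rectIntegral f a b c d = rectIntegral g a b c d := by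
  unfold rectIntegral
  congr 1
  · congr 1
    · congr 1
      · exact intervalIntegral.integral_congr fun x hx => h _ (horizontal_mem_rectBoundary_bot hab hcd hx)
      · exact intervalIntegral.integral_congr fun x hx => h _ (horizontal_mem_rectBoundary_top hab hcd hx)
    · congr 1
      exact intervalIntegral.integral_congr fun x hx => h _ (vertical_mem_rectBoundary_right hab hcd hx)
  · congr 1
    exact intervalIntegral.integral_congr fun x hx => h _ (vertical_mem_rectBoundary_left hab hcd hx)

lemma rectIntegral_add (hab : a ≤ b) (hcd : c ≤ d) (hf : ContinuousOn f (rectBoundary a b c d))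
    (hg : ContinuousOn g (rectBoundary a b c d)) :
    rectIntegral (fun s => f s + g s) a b c d = rectIntegral f a b c d + rectIntegral g a b c d := by
  unfold rectIntegral
  rw [intervalIntegral.integral_add, intervalIntegral.integral_add, intervalIntegral.integral_add,
    intervalIntegral.integral_add]
  · ring
  all_goals apply ContinuousOn.intervalIntegrable
  · exact hf.comp (by fun_prop) fun y hy => vertical_mem_rectBoundary_left hab hcd hy
  · exact hg.comp (by fun_prop) fun y hy => vertical_mem_rectBoundary_left hab hcd hy
  · exact hf.comp (by fun_prop) fun y hy => vertical_mem_rectBoundary_right hab hcd hy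
  · exact hg.comp (by fun_prop) fun y hy => vertical_mem_rectBoundary_right hab hcd hy
  · exact hf.comp (by fun_prop) fun y hy => horizontal_mem_rectBoundary_top hab hcd hy
  · exact hg.comp (by fun_prop) fun y hy => horizontal_mem_rectBoundary_top hab hcd hy
  · exact hf.comp (by fun_prop) fun y hy => horizontal_mem_rectBoundary_bot hab hcd hy
  · exact hg.comp (by fun_prop) fun y hy => horizontal_mem_rectBoundary_bot hab hcd hy

lemma rectIntegral_const_mul (k : ℂ) :
    rectIntegral (fun s => k * f s) a b c d = k * rectIntegral f a b c d := by
  unfold rectIntegral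
  simp only [intervalIntegral.integral_const_mul]
  ring

lemma rectIntegral_sum {ι : Type*} (Z : Finset ι) {F : ι → ℂ → ℂ} (hab : a ≤ b) (hcd : c ≤ d)
    (hF : ∀ i ∈ Z, ContinuousOn (F i) (rectBoundary a b c d)) :
    rectIntegral (fun s => ∑ i ∈ Z, F i s) a b c d = ∑ i ∈ Z, rectIntegral (F i) a b c d := by
  classical
  induction Z using Finset.induction_on with
  | empty => simp [rectIntegral]
  | insert i Z hi ih =>
    simp only [Finset.sum_insert hi]
    rw [rectIntegral_add hab hcd (hF i (Finset.mem_insert_self _ _))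
      (continuousOn_finsetSum _ fun j hj => hF j (Finset.mem_insert_of_mem hj)),
      ih fun j hj => hF j (Finset.mem_insert_of_mem hj)]

lemma rectIntegral_eq_zero (hab : a ≤ b) (hcd : c ≤ d) (hf : DifferentiableOn ℂ f (Icc a b ×ℂ Icc c d)) :
    rectIntegral f a b c d = 0 := by
  have h := integral_boundary_rect_eq_zero_of_differentiableOn f ⟨a, c⟩ ⟨b, d⟩
    (by simpa [uIcc_of_le hab, uIcc_of_le hcd] using hf)
  simpa [rectIntegral] using h

lemma log_neg_of_im_pos {z : ℂ} (hz : 0 < z.im) : Complex.log (-z) = Complex.log z - Real.pi * I := by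
  rw [Complex.log, Complex.log, norm_neg, Complex.arg_neg_eq_arg_sub_pi_of_im_pos hz]
  push_cast; ring

lemma integral_inv_horizontal (y : ℝ) (hy : y ≠ 0) (a b : ℝ) :
    ∫ x : ℝ in a..b, ((x + y * I : ℂ))⁻¹ = Complex.log (b + y * I) - Complex.log (a + y * I) := by
  have hmem : ∀ x : ℝ, (x + y * I : ℂ) ∈ slitPlane := fun x => by simp [slitPlane, hy]
  refine intervalIntegral.integral_eq_sub_of_hasDerivAt (f := fun x : ℝ => Complex.log (x + y * I))
    (fun x _ => ?_) ?_
  · have h1 : HasDerivAt (fun x : ℝ => (x + y * I : ℂ)) 1 x := by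
      simpa using (Complex.ofRealCLM.hasDerivAt (x := x)).add_const (y * I : ℂ)
    simpa using h1.clog_real (hmem x)
  · refine Continuous.intervalIntegrable (Continuous.inv₀ (by fun_prop) fun x h => ?_) _ _
    exact slitPlane_ne_zero (hmem x) h

lemma integral_inv_vertical (x : ℝ) (hx : 0 < x) (c d : ℝ) :
    I * ∫ y : ℝ in c..d, ((x + y * I : ℂ))⁻¹ = Complex.log (x + d * I) - Complex.log (x + c * I) := by
  have hmem : ∀ y : ℝ, (x + y * I : ℂ) ∈ slitPlane := fun y => by simp [slitPlane, hx]
  rw [← intervalIntegral.integral_const_mul]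
  refine intervalIntegral.integral_eq_sub_of_hasDerivAt (f := fun y : ℝ => Complex.log (x + y * I))
    (fun y _ => ?_) ?_
  · have h1 : HasDerivAt (fun y : ℝ => (x + y * I : ℂ)) I y := by
      simpa using ((Complex.ofRealCLM.hasDerivAt (x := y)).mul_const I).const_add (x : ℂ)
    simpa [div_eq_mul_inv] using h1.clog_real (hmem y)
  · refine Continuous.intervalIntegrable (Continuous.mul continuous_const (Continuous.inv₀ (by fun_prop) fun y h => ?_)) _ _
    exact slitPlane_ne_zero (hmem y) h

/-- Three edges lie in the slit plane, where the principal logarithm is a primitive. The left edge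
crosses the cut, so `log(-z)` serves there; its two endpoints differ from `log z` by `∓πi`, and
together these make `2πi`. -/
lemma rectIntegral_inv (ha : a < 0) (hb : 0 < b) (hc : c < 0) (hd : 0 < d) :
    rectIntegral (fun s => s⁻¹) a b c d = 2 * Real.pi * I := by
  unfold rectIntegral
  rw [integral_inv_horizontal c hc.ne, integral_inv_horizontal d hd.ne', integral_inv_vertical b hb]
  have h1 : I * ∫ y : ℝ in c..d, ((a + y * I : ℂ))⁻¹ =
      Complex.log (-(a + d * I)) - Complex.log (-(a + c * I)) := by
    have h2 := integral_inv_vertical (-a) (by linarith) (-d) (-c)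
    have h3 := intervalIntegral.integral_comp_neg (a := c) (b := d)
      (fun y : ℝ => (((-a : ℝ) + y * I : ℂ))⁻¹)
    rw [← h3] at h2
    have h4 : ∀ y : ℝ, (((-a : ℝ) + ((-y : ℝ) : ℂ) * I : ℂ))⁻¹ = -((a + y * I : ℂ))⁻¹ := by
      intro y
      rw [← inv_neg]; congr 1; push_cast; ring
    simp only [h4, intervalIntegral.integral_neg] at h2
    have e1 : ((-a : ℝ) : ℂ) + ((-c : ℝ) : ℂ) * I = -(a + c * I) := by push_cast; ring
    have e2 : ((-a : ℝ) : ℂ) + ((-d : ℝ) : ℂ) * I = -(a + d * I) := by push_cast; ring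
    rw [e1, e2] at h2
    linear_combination -h2
  rw [h1, log_neg_of_im_pos (z := a + d * I) (by simpa)]
  have h5 := log_neg_of_im_pos (z := -(a + c * I)) (by simpa)
  rw [neg_neg] at h5
  rw [h5]
  ring

lemma rectIntegral_inv_sub {ρ : ℂ} (ha : a < ρ.re) (hb : ρ.re < b) (hc : c < ρ.im) (hd : ρ.im < d) :
    rectIntegral (fun s => (s - ρ)⁻¹) a b c d = 2 * Real.pi * I := by
  rw [← rectIntegral_inv (sub_neg.mpr ha) (sub_pos.mpr hb) (sub_neg.mpr hc) (sub_pos.mpr hd)]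
  have hρ : ρ = ρ.re + ρ.im * I := (re_add_im ρ).symm
  unfold rectIntegral
  congr 1
  · congr 1
    · congr 1
      · rw [← intervalIntegral.integral_comp_sub_right (fun x : ℝ => ((x : ℂ) + ((c - ρ.im : ℝ) : ℂ) * I)⁻¹) ρ.re]
        refine intervalIntegral.integral_congr fun x _ => ?_
        simp only
        congr 1
        nth_rewrite 1 [hρ]; push_cast; ring
      · rw [← intervalIntegral.integral_comp_sub_right (fun x : ℝ => ((x : ℂ) + ((d - ρ.im : ℝ) : ℂ) * I)⁻¹) ρ.re]
        refine intervalIntegral.integral_congr fun x _ => ?_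
        simp only
        congr 1
        nth_rewrite 1 [hρ]; push_cast; ring
    · congr 1
      rw [← intervalIntegral.integral_comp_sub_right (fun y : ℝ => (((b - ρ.re : ℝ) : ℂ) + (y : ℂ) * I)⁻¹) ρ.im]
      refine intervalIntegral.integral_congr fun x _ => ?_
      simp only
      congr 1
      nth_rewrite 1 [hρ]; push_cast; ring
  · congr 1
    rw [← intervalIntegral.integral_comp_sub_right (fun y : ℝ => (((a - ρ.re : ℝ) : ℂ) + (y : ℂ) * I)⁻¹) ρ.im]
    refine intervalIntegral.integral_congr fun x _ => ?_
    simp only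
    congr 1
    nth_rewrite 1 [hρ]; push_cast; ring

/-- The residue theorem for a quotient with simple poles in a rectangle. -/
lemma rectIntegral_div_eq_sum {U : Set ℂ} (hU : IsOpen U) (hab : a ≤ b) (hcd : c ≤ d)
    (hRU : Icc a b ×ℂ Icc c d ⊆ U) (hf : DifferentiableOn ℂ f U) (hg : DifferentiableOn ℂ g U)
    {Z : Finset ℂ} (hZ : ∀ ρ ∈ Z, f ρ = 0 ∧ deriv f ρ ≠ 0 ∧ a < ρ.re ∧ ρ.re < b ∧ c < ρ.im ∧ ρ.im < d)
    (hZ' : ∀ s ∈ Icc a b ×ℂ Icc c d, f s = 0 → s ∈ Z) :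
    rectIntegral (fun s => g s / f s) a b c d = 2 * Real.pi * I * ∑ ρ ∈ Z, g ρ / deriv f ρ := by
  classical
  have hZR : ∀ ρ ∈ Z, ρ ∈ Icc a b ×ℂ Icc c d := fun ρ hρ => by
    obtain ⟨_, _, h1, h2, h3, h4⟩ := hZ ρ hρ
    exact ⟨⟨h1.le, h2.le⟩, ⟨h3.le, h4.le⟩⟩
  have hZU : ∀ ρ ∈ Z, ρ ∈ U := fun ρ hρ => hRU (hZR ρ hρ)
  obtain ⟨q, hq, hfq⟩ := exists_eq_prod_sub_mul hU Z hf fun ρ hρ => ⟨hZU ρ hρ, (hZ ρ hρ).1⟩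
  have hderiv : ∀ ρ ∈ Z, deriv f ρ = (∏ ρ' ∈ Z.erase ρ, (ρ - ρ')) * q ρ := fun ρ hρ =>
    deriv_eq_prod_erase_mul hU hq hfq hρ (hZU ρ hρ)
  have hq0 : ∀ s ∈ Icc a b ×ℂ Icc c d, q s ≠ 0 := by
    intro s hs h0
    have hfs : f s = 0 := by rw [hfq s, h0, mul_zero]
    have hsZ := hZ' s hs hfs
    apply (hZ s hsZ).2.1
    rw [hderiv s hsZ, h0, mul_zero]
  set V : Set ℂ := U ∩ q ⁻¹' {0}ᶜ
  have hV : IsOpen V := hq.continuousOn.isOpen_inter_preimage hU isOpen_compl_singleton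
  have hRV : Icc a b ×ℂ Icc c d ⊆ V := fun s hs => ⟨hRU hs, hq0 s hs⟩
  set k : ℂ → ℂ := fun ρ => g ρ / deriv f ρ
  -- Partial fractions by Lagrange interpolation: the polynomial agrees with `g/q` at every `ρ`, so
  -- `N` is divisible by the product of the `s - ρ`, and the quotient `Q` is the holomorphic part of
  -- `g/f`.
  set N : ℂ → ℂ := fun s => g s / q s - ∑ ρ ∈ Z, k ρ * ∏ ρ' ∈ Z.erase ρ, (s - ρ')
  have hN : DifferentiableOn ℂ N V := by
    refine ((hg.mono inter_subset_left).div (hq.mono inter_subset_left) fun s hs => hs.2).sub ?_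
    fun_prop
  have hN0 : ∀ ρ ∈ Z, N ρ = 0 := by
    intro ρ hρ
    have h1 : ∑ ρ₁ ∈ Z, k ρ₁ * ∏ ρ' ∈ Z.erase ρ₁, (ρ - ρ') = k ρ * ∏ ρ' ∈ Z.erase ρ, (ρ - ρ') := by
      refine Finset.sum_eq_single_of_mem ρ hρ fun ρ₁ _ hne => ?_
      rw [Finset.prod_eq_zero (Finset.mem_erase.mpr ⟨hne.symm, hρ⟩) (sub_self ρ), mul_zero]
    simp only [N, h1, k, hderiv ρ hρ]
    have h2 : ∏ ρ' ∈ Z.erase ρ, (ρ - ρ') ≠ 0 := Finset.prod_ne_zero_iff.mpr fun ρ' hρ' =>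
      sub_ne_zero.mpr (Finset.mem_erase.mp hρ').1.symm
    have h3 := hq0 ρ (hZR ρ hρ)
    field_simp
    ring
  obtain ⟨Q, hQ, hNQ⟩ := exists_eq_prod_sub_mul hV Z hN fun ρ hρ => ⟨hRV (hZR ρ hρ), hN0 ρ hρ⟩
  have hbd : ∀ s ∈ rectBoundary a b c d, s ∈ Icc a b ×ℂ Icc c d ∧ ∀ ρ ∈ Z, s - ρ ≠ 0 := by
    intro s hs
    refine ⟨⟨hs.1, hs.2.1⟩, fun ρ hρ h0 => ?_⟩
    obtain ⟨_, _, h1, h2, h3, h4⟩ := hZ ρ hρ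
    rw [sub_eq_zero.mp h0] at hs
    rcases hs.2.2 with h | h | h | h <;> linarith
  have hkey : ∀ s ∈ rectBoundary a b c d, g s / f s = Q s + ∑ ρ ∈ Z, k ρ * (s - ρ)⁻¹ := by
    intro s hs
    obtain ⟨hsR, hsZ⟩ := hbd s hs
    have hP : ∏ ρ ∈ Z, (s - ρ) ≠ 0 := Finset.prod_ne_zero_iff.mpr hsZ
    have h1 : N s / ∏ ρ ∈ Z, (s - ρ) = Q s := by rw [hNQ s]; field_simp
    rw [← h1, hfq s]
    simp only [N]
    rw [sub_div, Finset.sum_div]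
    have h2 : ∀ ρ ∈ Z, (k ρ * ∏ ρ' ∈ Z.erase ρ, (s - ρ')) / ∏ ρ ∈ Z, (s - ρ) = k ρ * (s - ρ)⁻¹ := by
      intro ρ hρ
      rw [← Finset.mul_prod_erase Z _ hρ] at hP ⊢
      have := left_ne_zero_of_mul hP
      have := right_ne_zero_of_mul hP
      field_simp
    rw [Finset.sum_congr rfl h2, sub_add_cancel, div_div, mul_comm]
  have hcont : ∀ ρ ∈ Z, ContinuousOn (fun s => k ρ * (s - ρ)⁻¹) (rectBoundary a b c d) := by
    intro ρ hρ
    exact continuousOn_const.mul (ContinuousOn.inv₀ (by fun_prop) fun s hs => (hbd s hs).2 ρ hρ)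
  rw [rectIntegral_congr hab hcd hkey, rectIntegral_add hab hcd
    (hQ.continuousOn.mono fun s hs => hRV (hbd s hs).1) (continuousOn_finsetSum _ hcont),
    rectIntegral_eq_zero hab hcd (hQ.mono hRV), rectIntegral_sum Z hab hcd hcont, zero_add,
    Finset.mul_sum]
  refine Finset.sum_congr rfl fun ρ hρ => ?_
  obtain ⟨_, _, h1, h2, h3, h4⟩ := hZ ρ hρ
  rw [rectIntegral_const_mul, rectIntegral_inv_sub h1 h2 h3 h4]
  ring

end rect

end

/-! ### Lower bound for zeta on the line `Re s = -2` -/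

section

open Complex MeasureTheory Filter Topology Set Metric

/-- The reflection formula at `it`, since `it Γ(it) = Γ(1 + it)` is the conjugate of `Γ(1 - it)`. An
exact value makes Stirling's formula for complex argument unnecessary. -/
lemma norm_Gamma_one_sub_mul_I_sq {t : ℝ} (ht : 0 < t) :
    ‖Complex.Gamma (1 - t * I)‖ ^ 2 = Real.pi * t / Real.sinh (Real.pi * t) := by
  have hs : 0 < Real.sinh (Real.pi * t) := Real.sinh_pos_iff.mpr (by positivity)
  have hti : (t * I : ℂ) ≠ 0 := by simp [ht.ne']
  have h1 := Complex.Gamma_mul_Gamma_one_sub (t * I)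
  have h2 := Complex.Gamma_add_one (t * I) hti
  have h3 : Complex.sin (Real.pi * (t * I)) = (Real.sinh (Real.pi * t) : ℂ) * I := by
    rw [show (Real.pi * (t * I) : ℂ) = (Real.pi * t : ℂ) * I by ring, Complex.sin_mul_I]
    push_cast; ring
  have h4 : Complex.Gamma (t * I + 1) = (starRingEnd ℂ) (Complex.Gamma (1 - t * I)) := by
    rw [← Complex.Gamma_conj]; congr 1; simp; ring
  have h5 : ((‖Complex.Gamma (1 - t * I)‖ ^ 2 : ℝ) : ℂ) = ((Real.pi * t / Real.sinh (Real.pi * t) : ℝ) : ℂ) := by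
    have h6 := Complex.mul_conj (Complex.Gamma (1 - t * I))
    rw [Complex.normSq_eq_norm_sq] at h6
    rw [← h6, ← h4, h2]
    have h7 : Complex.Gamma (1 - t * I) * (t * I * Complex.Gamma (t * I)) =
        t * I * (Complex.Gamma (t * I) * Complex.Gamma (1 - t * I)) := by ring
    rw [h7, h1, h3]
    have : (Real.sinh (Real.pi * t) : ℂ) ≠ 0 := by exact_mod_cast hs.ne'
    rw [Complex.ofReal_div, Complex.ofReal_mul]
    have := I_ne_zero
    field_simp
  exact_mod_cast h5

lemma norm_cos_three_sub_sq (t : ℝ) :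
    ‖Complex.cos (Real.pi * (3 - t * I) / 2)‖ ^ 2 = Real.sinh (Real.pi * t / 2) ^ 2 := by
  have e : Complex.cos (Real.pi * (3 - t * I) / 2) = -((Real.sinh (Real.pi * t / 2) : ℂ) * I) := by
    have h1 : (Real.pi * (3 - t * I) / 2 : ℂ) = Real.pi / 2 - ((Real.pi * t / 2 : ℝ) : ℂ) * I + Real.pi := by
      push_cast; ring
    rw [h1, Complex.cos_add_pi, Complex.cos_pi_div_two_sub, Complex.sin_mul_I]
    push_cast; ring
  rw [e, norm_neg, norm_mul, Complex.norm_I, mul_one, Complex.norm_real, Real.norm_eq_abs, sq_abs]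

/-- Functional equation at `3 - it`: the two linear factors of `Γ(3 - it) = (2 - it)(1 - it) Γ(1 -
it)` contribute `t^4` to the square, and the cosine with `Γ(1 - it)` contributes a further `t`. -/
lemma exists_norm_riemannZeta_neg_two_sq_ge : ∃ k : ℝ, 0 < k ∧ ∀ t : ℝ, 1 ≤ t →
    k * t ^ 5 ≤ ‖riemannZeta (-2 + t * I)‖ ^ 2 := by
  refine ⟨4 * ((2 * Real.pi) ^ (-3 : ℝ)) ^ 2 * (1 / 2) * (1 / 2) ^ 2, by positivity, fun t ht => ?_⟩
  have ht0 : 0 < t := by linarith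
  set s : ℂ := 3 - t * I with hs
  have hsre : s.re = 3 := by simp [hs]
  have hsim : s.im = -t := by simp [hs]
  have hfe := riemannZeta_one_sub (s := s) (fun n hn => by
      have := congrArg Complex.im hn; rw [hsim] at this; simp at this; linarith) (by
      intro h; have := congrArg Complex.im h; rw [hsim] at this; simp at this; linarith)
  have e1 : 1 - s = -2 + t * I := by rw [hs]; ring
  rw [e1] at hfe
  have hG : Complex.Gamma s = (2 - t * I) * ((1 - t * I) * Complex.Gamma (1 - t * I)) := by
    have hne : ∀ x : ℝ, x ≠ 0 → (x - t * I : ℂ) ≠ 0 := by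
      intro x hx h; apply hx; have := congrArg Complex.re h; simpa using this
    have h1 := Complex.Gamma_add_one (1 - t * I) (by simpa using hne 1 one_ne_zero)
    have h2 := Complex.Gamma_add_one (2 - t * I) (by simpa using hne 2 two_ne_zero)
    rw [show (1 - t * I + 1 : ℂ) = 2 - t * I by ring] at h1
    rw [show (2 - t * I + 1 : ℂ) = s by rw [hs]; ring] at h2
    rw [h2, h1]
  have hn : ∀ x : ℝ, t ^ 2 ≤ ‖(x - t * I : ℂ)‖ ^ 2 := by
    intro x
    rw [← Complex.normSq_eq_norm_sq, Complex.normSq_apply]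
    simp
    nlinarith [sq_nonneg x]
  have hp : ‖(2 * (Real.pi : ℂ)) ^ (-s)‖ = (2 * Real.pi) ^ (-3 : ℝ) := by
    rw [show (2 * (Real.pi : ℂ)) = ((2 * Real.pi : ℝ) : ℂ) by push_cast; ring,
        Complex.norm_cpow_eq_rpow_re_of_pos (by positivity)]
    simp [hsre]
  have hz := half_le_norm_riemannZeta (s := s) (by rw [hsre]; norm_num)
  -- With `x = πt/2` the right side equals `sinh² x · 2x / sinh 2x = x tanh x`.
  have hcosΓ : t * (1 / 2) ≤ ‖Complex.cos (Real.pi * s / 2)‖ ^ 2 * ‖Complex.Gamma (1 - t * I)‖ ^ 2 := by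
    rw [hs, norm_cos_three_sub_sq, norm_Gamma_one_sub_mul_I_sq ht0]
    set x := Real.pi * t / 2 with hx
    have hx2 : Real.pi * t = 2 * x := by rw [hx]; ring
    have hx1 : 3 / 2 * t ≤ x := by rw [hx]; nlinarith [Real.pi_gt_three]
    have hxpos : 0 < x := by linarith
    rw [hx2, Real.sinh_two_mul]
    have hsp : 0 < Real.sinh x := Real.sinh_pos_iff.mpr hxpos
    have hcp : 0 < Real.cosh x := Real.cosh_pos x
    have h1 : Real.cosh x ≤ 2 * Real.sinh x := by
      rw [Real.cosh_eq, Real.sinh_eq]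
      have h2 : Real.exp x ≥ 1 + x := by linarith [Real.add_one_le_exp x]
      have h3 : Real.exp (-x) ≤ 1 / (1 + x) := by
        rw [Real.exp_neg, ← one_div]; exact one_div_le_one_div_of_le (by linarith) h2
      have h4 : 1 / (1 + x) ≤ 2 / 5 := by rw [div_le_iff₀ (by linarith)]; linarith
      linarith
    have h5 : Real.sinh x ^ 2 * (2 * x / (2 * Real.sinh x * Real.cosh x)) = x * (Real.sinh x / Real.cosh x) := by
      field_simp
    rw [h5]
    have h6 : 1 / 2 ≤ Real.sinh x / Real.cosh x := by rw [le_div_iff₀ hcp]; linarith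
    nlinarith
  rw [hfe, hG]
  simp only [norm_mul, mul_pow, Complex.norm_ofNat]
  rw [hp]
  calc _ = 4 * ((2 * Real.pi) ^ (-3 : ℝ)) ^ 2 * (t ^ 2 * t ^ 2) * (t * (1 / 2)) * (1 / 2) ^ 2 := by ring
    _ ≤ 4 * ((2 * Real.pi) ^ (-3 : ℝ)) ^ 2 * (‖(2 - t * I : ℂ)‖ ^ 2 * ‖(1 - t * I : ℂ)‖ ^ 2) *
        (‖Complex.cos (Real.pi * s / 2)‖ ^ 2 * ‖Complex.Gamma (1 - t * I)‖ ^ 2) * ‖riemannZeta s‖ ^ 2 := by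
      have h2 := hn 2
      have h1 := hn 1
      push_cast at h1 h2
      gcongr
    _ = _ := by ring

end

/-! ### Gaussian mean values of trigonometric polynomials -/

section

open Complex MeasureTheory Filter Topology Set Metric

lemma integrable_cexp_gaussian {β : ℝ} (hβ : 0 < β) (T μ : ℝ) :
    Integrable (fun u : ℝ => cexp (-β * (u - T) ^ 2 + μ * u * I)) := by
  have h := integrable_cexp_quadratic (b := (β : ℂ)) (by simpa) (2 * β * T + μ * I) (-β * T ^ 2)
  refine h.congr (Eventually.of_forall fun u => ?_)
  simp only
  congr 1; ring

lemma integral_cexp_gaussian {β : ℝ} (hβ : 0 < β) (T μ : ℝ) :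
    ∫ u : ℝ, cexp (-β * (u - T) ^ 2 + μ * u * I) =
      (Real.sqrt (Real.pi / β) : ℂ) * cexp (μ * T * I - μ ^ 2 / (4 * β)) := by
  have h := integral_cexp_quadratic (b := (-β : ℂ)) (by simpa) (2 * β * T + μ * I) (-β * T ^ 2)
  have hβ' : (β : ℂ) ≠ 0 := by exact_mod_cast hβ.ne'
  have e : ∀ u : ℝ, (-β * u ^ 2 + (2 * β * T + μ * I) * u + -β * T ^ 2 : ℂ) =
      -β * (u - T) ^ 2 + μ * u * I := fun u => by ring
  simp only [e] at h
  rw [h]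
  congr 1
  · rw [neg_neg, Real.sqrt_eq_rpow, Complex.ofReal_cpow (by positivity)]
    push_cast; rfl
  · congr 1
    field_simp
    ring_nf
    rw [I_sq]
    ring

lemma integral_gaussian_real (β T : ℝ) :
    ∫ u : ℝ, Real.exp (-β * (u - T) ^ 2) = Real.sqrt (Real.pi / β) := by
  rw [← integral_gaussian]
  exact integral_sub_right_eq_self (fun u : ℝ => Real.exp (-β * u ^ 2)) T

lemma integrable_gaussian_real {β : ℝ} (hβ : 0 < β) (T : ℝ) :
    Integrable (fun u : ℝ => Real.exp (-β * (u - T) ^ 2)) :=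
  (integrable_exp_neg_mul_sq hβ).comp_sub_right T

section meanValue
variable {ι : Type*}

/-- A trigonometric polynomial with real coefficients. -/
noncomputable def trigPoly (S : Finset ι) (a l : ι → ℝ) (u : ℝ) : ℂ :=
  ∑ i ∈ S, (a i : ℂ) * cexp (-(l i * u * I))

@[fun_prop]
lemma continuous_trigPoly (S : Finset ι) (a l : ι → ℝ) : Continuous (trigPoly S a l) := by
  unfold trigPoly; fun_prop

lemma norm_trigPoly_sq_mul (S : Finset ι) (a l : ι → ℝ) (β T u : ℝ) :
    ((‖trigPoly S a l u‖ ^ 2 * Real.exp (-β * (u - T) ^ 2) : ℝ) : ℂ) =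
      ∑ i ∈ S, ∑ j ∈ S, (a i * a j : ℂ) * cexp (-β * (u - T) ^ 2 + (l j - l i : ℝ) * u * I) := by
  have h := Complex.mul_conj (trigPoly S a l u)
  rw [Complex.normSq_eq_norm_sq] at h
  push_cast at h ⊢
  rw [← h]
  simp only [trigPoly, map_sum, map_mul, Complex.conj_ofReal, ← Complex.exp_conj, map_neg, Complex.conj_I]
  rw [Finset.sum_mul_sum, Finset.sum_mul]
  refine Finset.sum_congr rfl fun i _ => ?_
  rw [Finset.sum_mul]
  refine Finset.sum_congr rfl fun j _ => ?_
  have : cexp (-β * (u - T) ^ 2 + (l j - l i) * u * I) =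
      cexp (-(l i * u * I)) * cexp (-(l j * u * -I)) * cexp (-β * (u - T) ^ 2) := by
    rw [← Complex.exp_add, ← Complex.exp_add]; congr 1; ring
  rw [this]
  ring

lemma integrable_norm_trigPoly_sq_mul (S : Finset ι) (a l : ι → ℝ) {β : ℝ} (hβ : 0 < β) (T : ℝ) :
    Integrable (fun u : ℝ => ‖trigPoly S a l u‖ ^ 2 * Real.exp (-β * (u - T) ^ 2)) := by
  have h : Integrable (fun u : ℝ => ∑ i ∈ S, ∑ j ∈ S, (a i * a j : ℂ) *
      cexp (-β * (u - T) ^ 2 + (l j - l i : ℝ) * u * I)) :=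
    integrable_finsetSum _ fun i _ => integrable_finsetSum _ fun j _ =>
      (integrable_cexp_gaussian hβ T _).const_mul _
  simp only [← norm_trigPoly_sq_mul] at h
  simpa only [RCLike.re_to_complex, Complex.ofReal_re] using h.re

/-- A mean value theorem with Gaussian weight for well-spaced frequencies. -/
lemma integral_norm_trigPoly_sq_mul_le (S : Finset ι) (a l : ι → ℝ) {β δ : ℝ} (hβ : 0 < β) (hδ : 0 ≤ δ)
    (T : ℝ) (hl : ∀ i ∈ S, ∀ j ∈ S, i ≠ j → δ ≤ |l i - l j|) :
    ∫ u : ℝ, ‖trigPoly S a l u‖ ^ 2 * Real.exp (-β * (u - T) ^ 2) ≤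
      Real.sqrt (Real.pi / β) * (1 + S.card * Real.exp (-(δ ^ 2 / (4 * β)))) * ∑ i ∈ S, a i ^ 2 := by
  classical
  set E := Real.exp (-(δ ^ 2 / (4 * β))) with hE
  have hEpos : 0 < E := Real.exp_pos _
  set Q := Real.sqrt (Real.pi / β) with hQ
  have hQ0 : 0 ≤ Q := Real.sqrt_nonneg _
  have h1 : ((∫ u : ℝ, ‖trigPoly S a l u‖ ^ 2 * Real.exp (-β * (u - T) ^ 2) : ℝ) : ℂ) =
      ∑ i ∈ S, ∑ j ∈ S, (a i * a j : ℂ) * (Q * cexp ((l j - l i : ℝ) * T * I - (l j - l i : ℝ) ^ 2 / (4 * β))) := by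
    rw [← integral_complex_ofReal]
    simp only [norm_trigPoly_sq_mul]
    rw [integral_finsetSum _ fun i _ => integrable_finsetSum _ fun j _ =>
      (integrable_cexp_gaussian hβ T _).const_mul _]
    refine Finset.sum_congr rfl fun i _ => ?_
    rw [integral_finsetSum _ fun j _ => (integrable_cexp_gaussian hβ T _).const_mul _]
    refine Finset.sum_congr rfl fun j _ => ?_
    rw [integral_const_mul, integral_cexp_gaussian hβ]
  -- The Gaussian transform makes off-diagonal terms at most `Q E |a i a j|`; replacing `|a i a j|`
  -- by the mean of the squares lets the double sum collapse to `card · ∑ a²`.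
  have h2 : ∀ i ∈ S, ∀ j ∈ S, ‖(a i * a j : ℂ) * (Q * cexp ((l j - l i : ℝ) * T * I - (l j - l i : ℝ) ^ 2 / (4 * β)))‖ ≤
      (if i = j then Q * a i ^ 2 else 0) + Q * E * ((a i ^ 2 + a j ^ 2) / 2) := by
    intro i hi j hj
    have hn : ‖(a i * a j : ℂ) * (Q * cexp ((l j - l i : ℝ) * T * I - (l j - l i : ℝ) ^ 2 / (4 * β)))‖ =
        |a i * a j| * (Q * Real.exp (-((l j - l i) ^ 2 / (4 * β)))) := by
      rw [← Complex.ofReal_mul, norm_mul, norm_mul, Complex.norm_exp, Complex.norm_real, Complex.norm_real,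
        Real.norm_eq_abs, Real.norm_eq_abs, abs_of_nonneg hQ0]
      congr 3
      rw [show ((l j - l i : ℝ) * T * I - (l j - l i : ℝ) ^ 2 / (4 * β) : ℂ) =
        ((-((l j - l i) ^ 2 / (4 * β)) : ℝ) : ℂ) + (((l j - l i) * T : ℝ) : ℂ) * I by push_cast; ring,
        Complex.add_re, Complex.ofReal_re, Complex.re_ofReal_mul, Complex.I_re, mul_zero, add_zero]
    rw [hn]
    have hab : |a i * a j| ≤ (a i ^ 2 + a j ^ 2) / 2 := by
      rw [abs_le]; constructor <;> nlinarith [sq_nonneg (a i + a j), sq_nonneg (a i - a j)]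
    split_ifs with h
    · subst h
      simp only [sub_self, ne_eq, OfNat.ofNat_ne_zero, not_false_eq_true, zero_pow, zero_div, neg_zero,
        Real.exp_zero, mul_one, ← sq, abs_sq]
      have : 0 ≤ Q * E * ((a i ^ 2 + a i ^ 2) / 2) := by positivity
      linarith
    · rw [zero_add]
      have h3 : Real.exp (-((l j - l i) ^ 2 / (4 * β))) ≤ E := by
        rw [hE, Real.exp_le_exp, neg_le_neg_iff]
        gcongr 1
        rw [← sq_abs (l j - l i), abs_sub_comm]
        gcongr
        exact hl i hi j hj h
      calc |a i * a j| * (Q * Real.exp (-((l j - l i) ^ 2 / (4 * β)))) ≤ (a i ^ 2 + a j ^ 2) / 2 * (Q * E) := by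
            gcongr
        _ = _ := by ring
  have h3 : ‖((∫ u : ℝ, ‖trigPoly S a l u‖ ^ 2 * Real.exp (-β * (u - T) ^ 2) : ℝ) : ℂ)‖ ≤
      ∑ i ∈ S, ∑ j ∈ S, ((if i = j then Q * a i ^ 2 else 0) + Q * E * ((a i ^ 2 + a j ^ 2) / 2)) := by
    rw [h1]
    refine (norm_sum_le _ _).trans (Finset.sum_le_sum fun i hi => ?_)
    exact (norm_sum_le _ _).trans (Finset.sum_le_sum fun j hj => h2 i hi j hj)
  rw [Complex.norm_real, Real.norm_eq_abs] at h3
  refine (le_abs_self _).trans (h3.trans (le_of_eq ?_))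
  simp only [Finset.sum_add_distrib, ← Finset.mul_sum, Finset.sum_ite_eq, ← Finset.sum_div,
    Finset.sum_const, nsmul_eq_mul]
  rw [Finset.sum_ite_mem, Finset.inter_self, ← Finset.mul_sum]
  ring

end meanValue

/-- The Sobolev–Gallagher inequality, which passes from point values at zeros to integrals: `φ γ`
exceeds `φ u` by at most the total variation on the unit interval, and one averages over `u`. -/
lemma le_integral_of_hasDerivAt {φ φ' : ℝ → ℝ} (hφ : ∀ u, HasDerivAt φ (φ' u) u) (hφ' : Continuous φ') (γ : ℝ) :
    φ γ ≤ ∫ u in (γ - 1 / 2)..(γ + 1 / 2), (φ u + |φ' u|) := by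
  have hφc : Continuous φ := continuous_iff_continuousAt.mpr fun u => (hφ u).continuousAt
  set A := ∫ v in (γ - 1 / 2)..(γ + 1 / 2), |φ' v| with hA
  have h1 : ∀ u ∈ Icc (γ - 1 / 2) (γ + 1 / 2), φ γ ≤ φ u + A := by
    intro u hu
    have h2 : ∫ v in u..γ, φ' v = φ γ - φ u :=
      intervalIntegral.integral_eq_sub_of_hasDerivAt (fun v _ => hφ v) (hφ'.intervalIntegrable _ _)
    have h3 : |∫ v in u..γ, φ' v| ≤ A := by
      refine (intervalIntegral.norm_integral_le_abs_integral_norm (f := φ')).trans ?_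
      simp only [Real.norm_eq_abs]
      have hA0 : 0 ≤ A := intervalIntegral.integral_nonneg (by linarith) fun v _ => abs_nonneg (φ' v)
      rw [← abs_of_nonneg hA0, hA]
      refine intervalIntegral.abs_integral_mono_interval ?_ (Eventually.of_forall fun v => abs_nonneg _)
        (hφ'.abs.intervalIntegrable _ _)
      refine uIoc_subset_uIoc_of_uIcc_subset_uIcc ?_
      rw [uIcc_of_le (by linarith : γ - 1 / 2 ≤ γ + 1 / 2)]
      refine uIcc_subset_Icc hu ⟨by linarith, by linarith⟩
    have := le_abs_self (∫ v in u..γ, φ' v)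
    linarith
  have h4 : ∫ _u in (γ - 1 / 2)..(γ + 1 / 2), φ γ ≤ ∫ u in (γ - 1 / 2)..(γ + 1 / 2), (φ u + A) :=
    intervalIntegral.integral_mono_on (by linarith) (by simp)
      ((hφc.add continuous_const).intervalIntegrable _ _) h1
  rw [intervalIntegral.integral_add (hφc.intervalIntegrable _ _) (by simp)] at h4
  rw [intervalIntegral.integral_add (hφc.intervalIntegrable _ _) (hφ'.abs.intervalIntegrable _ _)]
  simp only [intervalIntegral.integral_const, smul_eq_mul] at h4
  norm_num at h4
  norm_num
  linarith

end

/-! ### Large sieve over zeros for the resonator -/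

section

open Complex MeasureTheory Filter Topology Set Metric

section largeSieve
variable {ι : Type*}

lemma hasDerivAt_trigPoly (S : Finset ι) (a l : ι → ℝ) (u : ℝ) :
    HasDerivAt (trigPoly S a l) (-I * trigPoly S (fun i => a i * l i) l u) u := by
  unfold trigPoly
  rw [Finset.mul_sum]
  refine HasDerivAt.fun_sum fun i _ => ?_
  have h1 : HasDerivAt (fun u : ℝ => (-(l i * u * I) : ℂ)) (-(l i * I)) u := by
    have := (((Complex.ofRealCLM.hasDerivAt (x := u)).const_mul (l i : ℂ)).mul_const I).fun_neg
    simpa using this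
  refine (h1.cexp.const_mul (a i : ℂ)).congr_deriv ?_
  push_cast; ring

/-- Gallagher's inequality for `|F|²`, whose derivative is at most `2|F||F'| ≤ |F|² + |F'|²`;
differentiation multiplies the coefficients by the frequencies. -/
lemma norm_trigPoly_sq_le_integral (S : Finset ι) (a l : ι → ℝ) (γ : ℝ) :
    ‖trigPoly S a l γ‖ ^ 2 ≤ ∫ u in (γ - 1 / 2)..(γ + 1 / 2),
      (2 * ‖trigPoly S a l u‖ ^ 2 + ‖trigPoly S (fun i => a i * l i) l u‖ ^ 2) := by
  set F := trigPoly S a l with hF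
  set G := trigPoly S (fun i => a i * l i) l with hG
  have hFc : Continuous F := continuous_trigPoly S a l
  have hGc : Continuous G := continuous_trigPoly S _ l
  have hd : ∀ u, HasDerivAt (fun u => ‖F u‖ ^ 2) (2 * inner ℝ (F u) (-I * G u)) u := fun u =>
    (hasDerivAt_trigPoly S a l u).norm_sq
  refine (le_integral_of_hasDerivAt hd (by fun_prop) γ).trans ?_
  refine intervalIntegral.integral_mono_on (by linarith)
    (Continuous.intervalIntegrable (by fun_prop) _ _) (Continuous.intervalIntegrable (by fun_prop) _ _)
    fun u _ => ?_
  have h1 := abs_real_inner_le_norm (F u) (-I * G u)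
  rw [norm_mul, norm_neg, Complex.norm_I, one_mul] at h1
  rw [abs_mul, abs_two]
  nlinarith [sq_nonneg (‖F u‖ - ‖G u‖)]

/-- No point is covered by more than `M` of the unit intervals. -/
lemma sum_integral_le_of_card_le (Z : Finset ℝ) {M : ℝ}
    (hZ : ∀ u : ℝ, (({γ ∈ Z | |γ - u| ≤ 1 / 2} : Finset ℝ).card : ℝ) ≤ M) {Ψ : ℝ → ℝ} (hΨ : Integrable Ψ)
    (hΨ0 : ∀ u, 0 ≤ Ψ u) :
    ∑ γ ∈ Z, ∫ u in (γ - 1 / 2)..(γ + 1 / 2), Ψ u ≤ M * ∫ u, Ψ u := by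
  have h1 : ∀ γ ∈ Z, ∫ u in (γ - 1 / 2)..(γ + 1 / 2), Ψ u =
      ∫ u, (Ioc (γ - 1 / 2) (γ + 1 / 2)).indicator Ψ u := fun γ _ => by
    rw [intervalIntegral.integral_of_le (by linarith), integral_indicator measurableSet_Ioc]
  rw [Finset.sum_congr rfl h1, ← integral_finsetSum _ fun γ _ => hΨ.indicator measurableSet_Ioc,
    ← integral_const_mul]
  refine integral_mono (integrable_finsetSum _ fun γ _ => hΨ.indicator measurableSet_Ioc)
    (hΨ.const_mul M) fun u => ?_
  simp only [indicator_apply]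
  rw [← Finset.sum_filter, Finset.sum_const, nsmul_eq_mul]
  refine mul_le_mul_of_nonneg_right (le_trans ?_ (hZ u)) (hΨ0 u)
  refine Nat.cast_le.mpr (Finset.card_le_card fun γ hγ => ?_)
  rw [Finset.mem_filter] at hγ ⊢
  refine ⟨hγ.1, ?_⟩
  rw [abs_le]
  constructor <;> linarith [hγ.2.1, hγ.2.2]

/-- A large sieve inequality with Gaussian weight. -/
lemma sum_gaussian_mul_norm_trigPoly_sq_le (S : Finset ι) (a l : ι → ℝ) {β T M : ℝ} (hβ : 0 < β) (hβ1 : β ≤ 1)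
    (Z : Finset ℝ) (hZ : ∀ u : ℝ, (({γ ∈ Z | |γ - u| ≤ 1 / 2} : Finset ℝ).card : ℝ) ≤ M) :
    ∑ γ ∈ Z, Real.exp (-(2 * β) * (γ - T) ^ 2) * ‖trigPoly S a l γ‖ ^ 2 ≤
      2 * M * (2 * ∫ u, ‖trigPoly S a l u‖ ^ 2 * Real.exp (-β * (u - T) ^ 2)) +
      2 * M * ∫ u, ‖trigPoly S (fun i => a i * l i) l u‖ ^ 2 * Real.exp (-β * (u - T) ^ 2) := by
  set F := trigPoly S a l with hF
  set G := trigPoly S (fun i => a i * l i) l with hG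
  have hFc : Continuous F := continuous_trigPoly S a l
  have hGc : Continuous G := continuous_trigPoly S _ l
  have hFi : Integrable (fun u => ‖F u‖ ^ 2 * Real.exp (-β * (u - T) ^ 2)) :=
    integrable_norm_trigPoly_sq_mul S a l hβ T
  have hGi : Integrable (fun u => ‖G u‖ ^ 2 * Real.exp (-β * (u - T) ^ 2)) :=
    integrable_norm_trigPoly_sq_mul S _ l hβ T
  set Ψ : ℝ → ℝ := fun u => 2 * (2 * (‖F u‖ ^ 2 * Real.exp (-β * (u - T) ^ 2)) +
    ‖G u‖ ^ 2 * Real.exp (-β * (u - T) ^ 2)) with hΨ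
  have hΨi : Integrable Ψ := ((hFi.const_mul 2).add hGi).const_mul 2
  have hΨ0 : ∀ u, 0 ≤ Ψ u := fun u => by positivity
  have hterm : ∀ γ ∈ Z, Real.exp (-(2 * β) * (γ - T) ^ 2) * ‖F γ‖ ^ 2 ≤
      ∫ u in (γ - 1 / 2)..(γ + 1 / 2), Ψ u := by
    intro γ _
    refine (mul_le_mul_of_nonneg_left (norm_trigPoly_sq_le_integral S a l γ) (Real.exp_pos _).le).trans ?_
    rw [← intervalIntegral.integral_const_mul]
    refine intervalIntegral.integral_mono_on (by linarith)
      (Continuous.intervalIntegrable (by fun_prop) _ _) (Continuous.intervalIntegrable (by fun_prop) _ _)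
      fun u hu => ?_
    -- Moving from `γ` to `u` inside the unit interval costs half of the exponent, since `(u-T)² ≤
    -- 2(γ-T)² + 1/2`, and a factor `e^{1/2} < 2` as `β ≤ 1`.
    have h1 : Real.exp (-(2 * β) * (γ - T) ^ 2) ≤ 2 * Real.exp (-β * (u - T) ^ 2) := by
      have h2 : Real.exp (1 / 2) ≤ 2 := by
        have h3 : Real.exp (1 / 2) * Real.exp (1 / 2) = Real.exp 1 := by rw [← Real.exp_add]; norm_num
        nlinarith [Real.exp_one_lt_d9, Real.exp_pos (1 / 2)]
      calc Real.exp (-(2 * β) * (γ - T) ^ 2) ≤ Real.exp (1 / 2 + -β * (u - T) ^ 2) := by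
            rw [Real.exp_le_exp]
            have h3 : (u - γ) ^ 2 ≤ 1 / 4 := by nlinarith [hu.1, hu.2]
            have h4 : (u - T) ^ 2 ≤ 2 * (γ - T) ^ 2 + 1 / 2 := by nlinarith [sq_nonneg (u - γ - (γ - T))]
            nlinarith
        _ ≤ _ := by rw [Real.exp_add]; gcongr
    have h2 : 0 ≤ 2 * ‖F u‖ ^ 2 + ‖G u‖ ^ 2 := by positivity
    calc Real.exp (-(2 * β) * (γ - T) ^ 2) * (2 * ‖F u‖ ^ 2 + ‖G u‖ ^ 2)
        ≤ 2 * Real.exp (-β * (u - T) ^ 2) * (2 * ‖F u‖ ^ 2 + ‖G u‖ ^ 2) := by gcongr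
      _ = Ψ u := by simp only [hΨ]; ring
  refine (Finset.sum_le_sum hterm).trans ((sum_integral_le_of_card_le Z hZ hΨi hΨ0).trans (le_of_eq ?_))
  simp only [hΨ]
  rw [integral_const_mul, integral_add (hFi.const_mul 2) hGi, integral_const_mul]
  ring

end largeSieve

/-- Only one of the two integers is bounded by `N`: later the other is a product `h * n` with `n`
arbitrary. -/
lemma one_div_le_abs_log_sub_log {N m n : ℕ} (hm : 0 < m) (hn : 0 < n) (hmN : m ≤ N) (hmn : m ≠ n) :
    1 / (2 * N : ℝ) ≤ |Real.log m - Real.log n| := by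
  have hm' : (0 : ℝ) < m := by exact_mod_cast hm
  have hn' : (0 : ℝ) < n := by exact_mod_cast hn
  have hmN' : (m : ℝ) ≤ N := by exact_mod_cast hmN
  rcases lt_or_gt_of_ne hmn with h | h
  · rw [abs_sub_comm, ← Real.log_div hn'.ne' hm'.ne']
    refine le_trans ?_ (le_abs_self _)
    have h1 := Real.one_sub_inv_le_log_of_pos (div_pos hn' hm')
    refine le_trans ?_ h1
    rw [inv_div]
    have h2 : (m : ℝ) + 1 ≤ n := by exact_mod_cast h
    have h3 : (m : ℝ) / n ≤ m / (m + 1) := by gcongr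
    have h4 : 1 - (m : ℝ) / (m + 1) = 1 / (m + 1) := by field_simp; ring
    have h5 : 1 / (2 * N : ℝ) ≤ 1 / (m + 1) := by
      have : (1 : ℝ) ≤ m := by exact_mod_cast hm
      gcongr
      linarith
    linarith
  · rw [← Real.log_div hm'.ne' hn'.ne']
    refine le_trans ?_ (le_abs_self _)
    refine le_trans ?_ (Real.one_sub_inv_le_log_of_pos (div_pos hm' hn'))
    rw [inv_div]
    have h2 : (n : ℝ) + 1 ≤ m := by exact_mod_cast h
    have h4 : 1 - (n : ℝ) / m = (m - n) / m := by field_simp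
    rw [h4]
    have h5 : 1 / (2 * N : ℝ) ≤ 1 / m := by
      gcongr
      linarith
    refine h5.trans ?_
    gcongr
    linarith

/-- The resonator `∑ r n n ^ {-iu}` on the critical line. -/
noncomputable def resonator (r : ℕ → ℝ) (N : ℕ) : ℝ → ℂ := trigPoly (Finset.Icc 1 N) r (fun n => Real.log n)

lemma integral_norm_resonator_sq_le (r : ℕ → ℝ) {N : ℕ} {H : ℝ} (T : ℝ) (hH : 0 < H)
    (hN : N * Real.exp (-(H / N) ^ 2 / 4) ≤ 1) :
    ∫ u : ℝ, ‖resonator r N u‖ ^ 2 * Real.exp (-(1 / (4 * H ^ 2)) * (u - T) ^ 2) ≤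
      8 * H * ∑ n ∈ Finset.Icc 1 N, r n ^ 2 := by
  have h := integral_norm_trigPoly_sq_mul_le (Finset.Icc 1 N) r (fun n => Real.log n)
    -- With these values `δ²/(4β) = (H/N)²/4`, the exponent in `hN`. The sieve doubles `β`, which
    -- produces the weight of variance `H²` over zeros.
    (β := 1 / (4 * H ^ 2)) (δ := 1 / (2 * N)) (by positivity) (by positivity) T (by
      intro i hi j hj hij
      rw [Finset.mem_Icc] at hi hj
      exact one_div_le_abs_log_sub_log (by omega) (by omega) hi.2 hij)
  refine h.trans ?_
  have h0 : 0 ≤ ∑ n ∈ Finset.Icc 1 N, r n ^ 2 := Finset.sum_nonneg fun _ _ => sq_nonneg _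
  refine mul_le_mul_of_nonneg_right ?_ h0
  have h1 : Real.sqrt (Real.pi / (1 / (4 * H ^ 2))) ≤ 4 * H := by
    rw [Real.sqrt_le_left (by positivity)]
    rw [div_div_eq_mul_div, div_one]
    nlinarith [Real.pi_lt_four, sq_nonneg H]
  have h2 : 1 + ((Finset.Icc 1 N).card : ℝ) * Real.exp (-((1 / (2 * N : ℝ)) ^ 2 / (4 * (1 / (4 * H ^ 2))))) ≤ 2 := by
    rw [Nat.card_Icc, Nat.add_sub_cancel]
    have e : -((1 / (2 * N : ℝ)) ^ 2 / (4 * (1 / (4 * H ^ 2)))) = -(H / N) ^ 2 / 4 := by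
      field_simp
      norm_num
    rw [e]
    linarith
  calc _ ≤ 4 * H * 2 := by gcongr
    _ = 8 * H := by ring

/-- The mean square of the resonator over zeros with Gaussian weight. -/
lemma exists_sum_gaussian_resonator_le : ∃ C : ℝ, 1 ≤ C ∧ ∀ (r : ℕ → ℝ) (N : ℕ) (H T Y : ℝ) (Z : Finset ℂ),
    1 ≤ N → 1 ≤ H → N * Real.exp (-(H / N) ^ 2 / 4) ≤ 1 → 4 ≤ Y →
    (∀ ρ ∈ Z, riemannZeta ρ = 0 ∧ ρ.re = 1 / 2 ∧ 4 ≤ ρ.im ∧ ρ.im ≤ Y) →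
    ∑ ρ ∈ Z, Real.exp (-(ρ.im - T) ^ 2 / (2 * H ^ 2)) * ‖resonator r N ρ.im‖ ^ 2 ≤
      C * Real.log (Y + 1) * H * (2 + Real.log N ^ 2) * ∑ n ∈ Finset.Icc 1 N, r n ^ 2 := by
  classical
  obtain ⟨C, hC1, hC⟩ := exists_card_zeros_le
  refine ⟨16 * C, by linarith, fun r N H T Y Z hN1 hH hN hY hZ => ?_⟩
  have hH0 : 0 < H := by linarith
  have hinj : Set.InjOn Complex.im (Z : Set ℂ) := by
    intro x hx y hy hxy
    exact Complex.ext ((hZ x hx).2.1.trans (hZ y hy).2.1.symm) hxy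
  set W : Finset ℝ := Z.image Complex.im with hW
  have hlogY : 0 ≤ Real.log (Y + 1) := Real.log_nonneg (by linarith)
  have hcount : ∀ u : ℝ, (({γ ∈ W | |γ - u| ≤ 1 / 2} : Finset ℝ).card : ℝ) ≤ C * Real.log (Y + 1) := by
    intro u
    have h1 : ({γ ∈ W | |γ - u| ≤ 1 / 2} : Finset ℝ) = ({ρ ∈ Z | |ρ.im - u| ≤ 1 / 2} : Finset ℂ).image Complex.im := by
      rw [hW, Finset.filter_image]
    rw [h1]
    rcases ({ρ ∈ Z | |ρ.im - u| ≤ 1 / 2} : Finset ℂ).eq_empty_or_nonempty with h | ⟨ρ₀, hρ₀⟩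
    · rw [h]; simp; positivity
    rw [Finset.mem_filter, abs_le] at hρ₀
    obtain ⟨_, _, h4, h5⟩ := hZ ρ₀ hρ₀.1
    -- The window centre is arbitrary, but a nonempty window places it within `1/2` of a zero; hence
    -- the margin in `4 ≤ ρ.im` and the `Y + 1`.
    have hu3 : 3 ≤ u := by linarith [hρ₀.2.2]
    have huY : u ≤ Y + 1 := by linarith [hρ₀.2.1]
    have h2 := hC u hu3 ({ρ ∈ Z | |ρ.im - u| ≤ 1 / 2} : Finset ℂ) (fun ρ hρ => by
      rw [Finset.mem_filter] at hρ
      exact ⟨(hZ ρ hρ.1).1, (hZ ρ hρ.1).2.1, hρ.2⟩)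
    refine (Nat.cast_le.mpr Finset.card_image_le).trans (h2.trans ?_)
    gcongr
  have hbeta : 1 / (4 * H ^ 2) ≤ 1 := by
    rw [div_le_one (by positivity)]; nlinarith
  have h := sum_gaussian_mul_norm_trigPoly_sq_le (Finset.Icc 1 N) r (fun n => Real.log n) (T := T)
    (β := 1 / (4 * H ^ 2)) (by positivity) hbeta W hcount
  rw [hW, Finset.sum_image hinj] at h
  have e : ∀ ρ : ℂ, -(2 * (1 / (4 * H ^ 2))) * (ρ.im - T) ^ 2 = -(ρ.im - T) ^ 2 / (2 * H ^ 2) := by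
    intro ρ; field_simp; norm_num
  simp only [e] at h
  refine h.trans ?_
  have i1 := integral_norm_resonator_sq_le r T hH0 hN
  have i2 := integral_norm_resonator_sq_le (fun n => r n * Real.log n) T hH0 hN
  have i3 : ∑ n ∈ Finset.Icc 1 N, (r n * Real.log n) ^ 2 ≤ Real.log N ^ 2 * ∑ n ∈ Finset.Icc 1 N, r n ^ 2 := by
    rw [Finset.mul_sum]
    refine Finset.sum_le_sum fun n hn => ?_
    rw [Finset.mem_Icc] at hn
    have h1 : (1 : ℝ) ≤ n := by exact_mod_cast hn.1
    have h2 : Real.log n ≤ Real.log N := Real.log_le_log (by linarith) (by exact_mod_cast hn.2)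
    have h3 : 0 ≤ Real.log n := Real.log_nonneg h1
    rw [mul_pow, mul_comm]
    gcongr
  set S := ∑ n ∈ Finset.Icc 1 N, r n ^ 2
  set M := C * Real.log (Y + 1)
  have hM : 0 ≤ M := by positivity
  unfold resonator at i1 i2
  calc _ ≤ 2 * M * (2 * (8 * H * S)) + 2 * M * (8 * H * (Real.log N ^ 2 * S)) := by
        gcongr
        exact i2.trans (by gcongr)
    _ = _ := by ring

end

/-! ### The resonator kernel and its off-diagonal terms -/

section

open Complex MeasureTheory Filter Topology Set Metric

/-- The Dirichlet polynomial `∑ r n n ^ (-z)`. -/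
noncomputable def dirichletPoly (r : ℕ → ℝ) (N : ℕ) (z : ℂ) : ℂ :=
  ∑ n ∈ Finset.Icc 1 N, (r n : ℂ) * cexp (-(z * Real.log n))

lemma resonator_eq_dirichletPoly (r : ℕ → ℝ) (N : ℕ) (u : ℝ) :
    resonator r N u = dirichletPoly r N (u * I) := by
  unfold resonator trigPoly dirichletPoly
  refine Finset.sum_congr rfl fun n _ => ?_
  congr 3; ring

lemma conj_dirichletPoly (r : ℕ → ℝ) (N : ℕ) (z : ℂ) :
    (starRingEnd ℂ) (dirichletPoly r N z) = dirichletPoly r N ((starRingEnd ℂ) z) := by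
  simp only [dirichletPoly, map_sum, map_mul, Complex.conj_ofReal, ← Complex.exp_conj, map_neg]

lemma differentiable_dirichletPoly (r : ℕ → ℝ) (N : ℕ) : Differentiable ℂ (dirichletPoly r N) := by
  unfold dirichletPoly; fun_prop

lemma norm_dirichletPoly_le_sum {r : ℕ → ℝ} (hr : ∀ n, |r n| ≤ 1) (N : ℕ) (z : ℂ) :
    ‖dirichletPoly r N z‖ ≤ ∑ n ∈ Finset.Icc 1 N, Real.exp (-z.re * Real.log n) := by
  refine (norm_sum_le _ _).trans (Finset.sum_le_sum fun n _ => ?_)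
  rw [norm_mul, Complex.norm_real, Real.norm_eq_abs, Complex.norm_exp]
  have e : (-(z * Real.log n : ℂ)).re = -z.re * Real.log n := by
    rw [Complex.neg_re, Complex.re_mul_ofReal]; ring
  rw [e]
  exact mul_le_of_le_one_left (Real.exp_pos _).le (hr n)

lemma norm_dirichletPoly_le {r : ℕ → ℝ} (hr : ∀ n, |r n| ≤ 1) {N : ℕ} {z : ℂ} {a : ℝ} (ha : 0 ≤ a)
    (hz : -a ≤ z.re) : ‖dirichletPoly r N z‖ ≤ N * Real.exp (a * Real.log N) := by
  refine (norm_dirichletPoly_le_sum hr N z).trans ?_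
  have h : ∀ n ∈ Finset.Icc 1 N, Real.exp (-z.re * Real.log n) ≤ Real.exp (a * Real.log N) := by
    intro n hn
    rw [Finset.mem_Icc] at hn
    have h1 : (1 : ℝ) ≤ n := by exact_mod_cast hn.1
    have h2 : Real.log n ≤ Real.log N := Real.log_le_log (by linarith) (by exact_mod_cast hn.2)
    have h3 : 0 ≤ Real.log n := Real.log_nonneg h1
    rw [Real.exp_le_exp]
    nlinarith
  refine (Finset.sum_le_sum h).trans (le_of_eq ?_)
  simp

/-- The Gaussian weight centred at `1 / 2 + i T` times the resonator and its reflection. -/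
noncomputable def resonatorKernel (r : ℕ → ℝ) (N : ℕ) (H T : ℝ) (s : ℂ) : ℂ :=
  cexp ((s - 1 / 2 - T * I) ^ 2 / H ^ 2) * (dirichletPoly r N (s - 1 / 2) * dirichletPoly r N (1 / 2 - s))

lemma differentiable_resonatorKernel (r : ℕ → ℝ) (N : ℕ) (H T : ℝ) :
    Differentiable ℂ (resonatorKernel r N H T) := by
  unfold resonatorKernel
  have h := differentiable_dirichletPoly r N
  have h1 : Differentiable ℂ fun s : ℂ => dirichletPoly r N (s - 1 / 2) := h.comp (by fun_prop)
  have h2 : Differentiable ℂ fun s : ℂ => dirichletPoly r N (1 / 2 - s) := h.comp (by fun_prop)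
  have h3 : Differentiable ℂ fun s : ℂ => cexp ((s - 1 / 2 - T * I) ^ 2 / H ^ 2) := by fun_prop
  exact h3.mul (h1.mul h2)

/-- The coefficients are real and `1/2 - ρ` is the conjugate of `ρ - 1/2` on the critical line, so
the entire product is `|R|²` there. This is where the Riemann hypothesis gives positivity. -/
lemma resonatorKernel_critical (r : ℕ → ℝ) (N : ℕ) (H T : ℝ) {ρ : ℂ} (hρ : ρ.re = 1 / 2) :
    resonatorKernel r N H T ρ =
      ((Real.exp (-(ρ.im - T) ^ 2 / H ^ 2) * ‖resonator r N ρ.im‖ ^ 2 : ℝ) : ℂ) := by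
  have h1 : ρ - 1 / 2 = ρ.im * I := by
    apply Complex.ext <;> simp [hρ]
  have h2 : (1 / 2 : ℂ) - ρ = (starRingEnd ℂ) (ρ.im * I : ℂ) := by
    rw [← h1]; apply Complex.ext <;> simp [hρ]
  unfold resonatorKernel
  rw [h1, h2, ← conj_dirichletPoly, ← resonator_eq_dirichletPoly, Complex.mul_conj, Complex.normSq_eq_norm_sq]
  rw [show (ρ.im * I - T * I : ℂ) ^ 2 / H ^ 2 = ((-(ρ.im - T) ^ 2 / H ^ 2 : ℝ) : ℂ) by
    push_cast; rw [← sub_mul, mul_pow, I_sq]; ring]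
  push_cast; ring

lemma norm_gaussian_weight_le {H T : ℝ} (hH : 5 / 2 ≤ H) {s : ℂ} (h1 : -2 ≤ s.re) (h2 : s.re ≤ 3) :
    ‖cexp ((s - 1 / 2 - T * I) ^ 2 / H ^ 2)‖ ≤ 3 * Real.exp (-(s.im - T) ^ 2 / H ^ 2) := by
  rw [Complex.norm_exp]
  have e : ((s - 1 / 2 - T * I) ^ 2 / H ^ 2 : ℂ).re = (s.re - 1 / 2) ^ 2 / H ^ 2 + -(s.im - T) ^ 2 / H ^ 2 := by
    rw [show (H : ℂ) ^ 2 = ((H ^ 2 : ℝ) : ℂ) by push_cast; rfl, Complex.div_ofReal_re, ← add_div]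
    congr 1
    rw [sq, Complex.mul_re]
    simp
    ring
  rw [e, Real.exp_add]
  refine mul_le_mul_of_nonneg_right ?_ (Real.exp_pos _).le
  have h3 : (s.re - 1 / 2) ^ 2 / H ^ 2 ≤ 1 := by
    rw [div_le_one (by positivity)]
    nlinarith
  exact (Real.exp_le_exp.mpr h3).trans (by linarith [Real.exp_one_lt_d9])

lemma norm_resonatorKernel_le {r : ℕ → ℝ} (hr : ∀ n, |r n| ≤ 1) {N : ℕ} (hN : 1 ≤ N) {H T : ℝ} (hH : 5 / 2 ≤ H)
    {s : ℂ} (h1 : -2 ≤ s.re) (h2 : s.re ≤ 3) :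
    ‖resonatorKernel r N H T s‖ ≤ 3 * N ^ 8 * Real.exp (-(s.im - T) ^ 2 / H ^ 2) := by
  have hN1 : (1 : ℝ) ≤ N := by exact_mod_cast hN
  have hb : ∀ z : ℂ, -3 ≤ z.re → ‖dirichletPoly r N z‖ ≤ N ^ 4 := by
    intro z hz
    refine (norm_dirichletPoly_le hr (by norm_num : (0 : ℝ) ≤ 3) hz).trans (le_of_eq ?_)
    rw [show (3 : ℝ) = ((3 : ℕ) : ℝ) by norm_num, Real.exp_nat_mul, Real.exp_log (by linarith)]
    ring
  unfold resonatorKernel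
  rw [norm_mul, norm_mul]
  calc _ ≤ 3 * Real.exp (-(s.im - T) ^ 2 / H ^ 2) * (N ^ 4 * N ^ 4) := by
        gcongr
        · exact norm_gaussian_weight_le hH h1 h2
        · exact hb _ (by simp; linarith)
        · exact hb _ (by simp; linarith)
    _ = _ := by ring

open ArithmeticFunction ArithmeticFunction.Moebius LSeries.notation

/-- The quadratic form giving the main term of the mollified sum over zeros. -/
noncomputable def resonatorForm (r : ℕ → ℝ) (N : ℕ) : ℝ :=
  ∑ n ∈ Finset.Icc 1 N, ∑ h ∈ Finset.Icc 1 N, ∑ k ∈ Finset.Icc 1 N,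
    if k = h * n then (μ n : ℝ) / Real.sqrt n * (r h * r k) else 0

/-- The abscissa `5/2` drops out of the value, as moving the line of integration would show; `l = 0`
gives the main term `√π H`. -/
lemma integral_gaussian_shift {H : ℝ} (hH : 0 < H) (T l : ℝ) :
    Integrable (fun t : ℝ => cexp ((5 / 2 + t * I - T * I) ^ 2 / H ^ 2 + (5 / 2 + t * I) * l)) ∧
    ∫ t : ℝ, cexp ((5 / 2 + t * I - T * I) ^ 2 / H ^ 2 + (5 / 2 + t * I) * l) =
      (Real.sqrt Real.pi * H : ℝ) * cexp (T * l * I - H ^ 2 * l ^ 2 / 4) := by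
  have hH' : (H : ℂ) ≠ 0 := by exact_mod_cast hH.ne'
  set k : ℂ := 25 / (4 * H ^ 2) - 5 * T / H ^ 2 * I + 5 * l / 2 with hk
  have hβ : 0 < 1 / H ^ 2 := by positivity
  have e : ∀ t : ℝ, cexp ((5 / 2 + t * I - T * I) ^ 2 / H ^ 2 + (5 / 2 + t * I) * l) =
      cexp (-((1 / H ^ 2 : ℝ) : ℂ) * (t - T) ^ 2 + ((5 / H ^ 2 + l : ℝ) : ℂ) * t * I) * cexp k := by
    intro t
    rw [← Complex.exp_add]
    congr 1
    rw [hk]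
    push_cast
    field_simp
    ring_nf
    rw [I_sq]
    ring
  simp only [e]
  refine ⟨(integrable_cexp_gaussian hβ T _).mul_const _, ?_⟩
  rw [integral_mul_const, integral_cexp_gaussian hβ, mul_assoc, ← Complex.exp_add]
  congr 1
  · congr 1
    rw [div_div_eq_mul_div, div_one, Real.sqrt_mul Real.pi_pos.le, Real.sqrt_sq hH.le]
  · congr 1
    rw [hk]
    push_cast
    field_simp
    ring

/-- Half of the exponent gives the uniform saving through the gap `1/(2N)`. The other half gives
decay `(N/n)²`, so that the sum over all `n` converges: for `n > N` one has `|l| ≥ log(n/N)` and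
`H²|l| ≥ 16`. -/
lemma exp_neg_sq_log_le {N h k n : ℕ} {H : ℝ} (hh : 0 < h) (hk : 0 < k) (hn : 0 < n)
    (hkN : k ≤ N) (hne : k ≠ h * n) (hH : 32 * N ≤ H ^ 2) :
    Real.exp (-(H ^ 2 * (Real.log k - Real.log h - Real.log n) ^ 2 / 4)) ≤
      Real.exp (-(H / N) ^ 2 / 32) * (N ^ 2 * (1 / (n : ℝ) ^ 2)) := by
  have hh' : (1 : ℝ) ≤ h := by exact_mod_cast hh
  have hk' : (1 : ℝ) ≤ k := by exact_mod_cast hk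
  have hn' : (1 : ℝ) ≤ n := by exact_mod_cast hn
  have hkN' : (k : ℝ) ≤ N := by exact_mod_cast hkN
  have hN0 : (0 : ℝ) < N := by linarith
  set l := Real.log k - Real.log h - Real.log n with hl
  have h1 : 1 / (2 * N : ℝ) ≤ |l| := by
    have := one_div_le_abs_log_sub_log (N := N) (m := k) (n := h * n) hk (by positivity) hkN hne
    rwa [Nat.cast_mul, Real.log_mul (by positivity) (by positivity), ← sub_sub] at this
  have hA : (H / N) ^ 2 / 32 ≤ H ^ 2 * l ^ 2 / 8 := by
    have h2 : (1 / (2 * N : ℝ)) ^ 2 ≤ l ^ 2 := by rw [← sq_abs l]; gcongr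
    have h3 : (H / N) ^ 2 / 32 = H ^ 2 * (1 / (2 * N : ℝ)) ^ 2 / 8 := by field_simp; ring
    rw [h3]; gcongr
  have hB : Real.exp (-(H ^ 2 * l ^ 2 / 8)) ≤ N ^ 2 * (1 / (n : ℝ) ^ 2) := by
    have e : (N : ℝ) ^ 2 * (1 / (n : ℝ) ^ 2) = (N / n : ℝ) ^ 2 := by rw [div_pow]; ring
    rw [e]
    rcases le_or_gt n N with hnN | hnN
    · have h2 : (1 : ℝ) ≤ N / n := by
        rw [le_div_iff₀ (by linarith), one_mul]; exact_mod_cast hnN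
      have h3 : Real.exp (-(H ^ 2 * l ^ 2 / 8)) ≤ 1 := by
        rw [Real.exp_le_one_iff]; have : 0 ≤ H ^ 2 * l ^ 2 / 8 := by positivity
        linarith
      nlinarith
    · have hnN' : (N : ℝ) < n := by exact_mod_cast hnN
      have h2 : Real.log n - Real.log N ≤ -l := by
        have := Real.log_le_log (by linarith) hkN'
        have := Real.log_nonneg hh'
        rw [hl]; linarith
      have h3 : 0 < Real.log n - Real.log N := by
        have := Real.log_lt_log hN0 hnN'
        linarith
      have h4 : |l| = -l := abs_of_neg (by linarith)
      have h5 : 2 * (Real.log n - Real.log N) ≤ H ^ 2 * l ^ 2 / 8 := by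
        have h6 : H ^ 2 * l ^ 2 = (H ^ 2 * |l|) * |l| := by rw [← sq_abs l]; ring
        have h7 : 16 ≤ H ^ 2 * |l| := by
          calc (16 : ℝ) = 32 * N * (1 / (2 * N)) := by field_simp; norm_num
            _ ≤ _ := by gcongr
        have h8 : 16 * |l| ≤ H ^ 2 * |l| * |l| := by gcongr
        rw [h6]
        linarith
      have h9 : Real.exp (Real.log N - Real.log n) = N / n := by
        rw [Real.exp_sub, Real.exp_log hN0, Real.exp_log (by linarith)]
      rw [← h9, ← Real.exp_nat_mul, Real.exp_le_exp]
      push_cast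
      linarith
  calc Real.exp (-(H ^ 2 * l ^ 2 / 4)) = Real.exp (-(H ^ 2 * l ^ 2 / 8)) * Real.exp (-(H ^ 2 * l ^ 2 / 8)) := by
        rw [← Real.exp_add]; congr 1; ring
    _ ≤ Real.exp (-(H / N) ^ 2 / 32) * (N ^ 2 * (1 / (n : ℝ) ^ 2)) := by
        gcongr
        rw [neg_div]; linarith

lemma resonatorKernel_three (r : ℕ → ℝ) (N : ℕ) (H T t : ℝ) {n : ℕ} (hn : 0 < n) :
    resonatorKernel r N H T (3 + t * I) * LSeries.term ↗μ (3 + t * I) n =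
      ∑ h ∈ Finset.Icc 1 N, ∑ k ∈ Finset.Icc 1 N, ((μ n : ℝ) / Real.sqrt n * (r h * r k) : ℝ) *
        cexp ((5 / 2 + t * I - T * I) ^ 2 / H ^ 2 +
          (5 / 2 + t * I) * (Real.log k - Real.log h - Real.log n : ℝ)) := by
  have hn0 : (0 : ℝ) < n := by exact_mod_cast hn
  have h1 : LSeries.term ↗μ (3 + t * I) n = ((μ n : ℝ) / Real.sqrt n : ℝ) * cexp (-((5 / 2 + t * I) * Real.log n)) := by
    rw [LSeries.term_of_ne_zero hn.ne']
    rw [Complex.cpow_def_of_ne_zero (by exact_mod_cast hn.ne'), div_eq_mul_inv, ← Complex.exp_neg]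
    rw [Complex.ofReal_div, div_mul_eq_mul_div, mul_div_assoc]
    congr 1
    have h2 : (Real.sqrt n : ℂ) = cexp (1 / 2 * Real.log n) := by
      rw [Real.sqrt_eq_rpow, Real.rpow_def_of_pos hn0]
      push_cast; congr 1; ring
    rw [h2, ← Complex.exp_sub]
    congr 1
    rw [← Complex.natCast_log]
    ring
  rw [h1]
  unfold resonatorKernel dirichletPoly
  rw [Finset.sum_mul_sum, Finset.mul_sum, Finset.sum_mul]
  refine Finset.sum_congr rfl fun h _ => ?_
  rw [Finset.mul_sum, Finset.sum_mul]
  refine Finset.sum_congr rfl fun k _ => ?_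
  have e1 : (3 + t * I - 1 / 2 : ℂ) = 5 / 2 + t * I := by ring
  have e2 : (1 / 2 - (3 + t * I) : ℂ) = -(5 / 2 + t * I) := by ring
  rw [e1, e2]
  have e3 : cexp ((5 / 2 + t * I - T * I) ^ 2 / H ^ 2 +
          (5 / 2 + t * I) * (Real.log k - Real.log h - Real.log n : ℝ)) =
      cexp ((5 / 2 + t * I - T * I) ^ 2 / H ^ 2) * cexp (-((5 / 2 + t * I) * Real.log h)) *
        cexp (-(-(5 / 2 + t * I) * Real.log k)) * cexp (-((5 / 2 + t * I) * Real.log n)) := by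
    rw [← Complex.exp_add, ← Complex.exp_add, ← Complex.exp_add]
    congr 1
    push_cast
    ring
  rw [e3]
  push_cast
  ring

end

/-! ### The main term: integration along `Re s = 3` -/

section

open Complex MeasureTheory Filter Topology Set Metric
open ArithmeticFunction ArithmeticFunction.Moebius LSeries.notation

lemma norm_term_moebius_le {s : ℂ} (hs : 2 ≤ s.re) (n : ℕ) : ‖LSeries.term ↗μ s n‖ ≤ 1 / (n : ℝ) ^ 2 := by
  rcases eq_or_ne n 0 with rfl | hn
  · simp
  rw [LSeries.norm_term_eq, if_neg hn]
  have hn1 : (1 : ℝ) ≤ n := by exact_mod_cast Nat.one_le_iff_ne_zero.mpr hn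
  gcongr
  · have : |μ n| ≤ 1 := abs_moebius_le_one
    rw [Complex.norm_intCast]
    exact_mod_cast this
  · rw [← Real.rpow_natCast]
    exact Real.rpow_le_rpow_of_exponent_le hn1 (by exact_mod_cast hs)

lemma integrable_resonatorKernel_vertical {r : ℕ → ℝ} (hr : ∀ n, |r n| ≤ 1) {N : ℕ} (hN : 1 ≤ N) {H : ℝ} (T : ℝ)
    (hH : 5 / 2 ≤ H) {σ : ℝ} (h1 : -2 ≤ σ) (h2 : σ ≤ 3) :
    Integrable (fun t : ℝ => resonatorKernel r N H T (σ + t * I)) := by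
  have hβ : 0 < 1 / H ^ 2 := by positivity
  refine Integrable.mono' ((integrable_gaussian_real hβ T).const_mul (3 * N ^ 8)) ?_ ?_
  · exact ((differentiable_resonatorKernel r N H T).continuous.comp (by fun_prop)).aestronglyMeasurable
  · refine Eventually.of_forall fun t => ?_
    have h := norm_resonatorKernel_le hr hN (T := T) hH (s := σ + t * I) (by simpa) (by simpa)
    refine h.trans (le_of_eq ?_)
    simp only [add_im, ofReal_im, mul_im, ofReal_re, I_im, I_re]
    congr 2
    ring

/-- The Dirichlet series of `1/ζ` is integrated term by term. The triples with `k = hn` give the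
form exactly, and `exp_neg_sq_log_le` bounds all others. -/
lemma norm_integral_resonatorKernel_three_sub_le {r : ℕ → ℝ} (hr : ∀ n, |r n| ≤ 1) {N : ℕ} (hN : 1 ≤ N)
    {H : ℝ} (T : ℝ) (hH : 5 / 2 ≤ H) (hNH : 32 * N ≤ H ^ 2) :
    Integrable (fun t : ℝ => resonatorKernel r N H T (3 + t * I) / riemannZeta (3 + t * I)) ∧
    ‖(∫ t : ℝ, resonatorKernel r N H T (3 + t * I) / riemannZeta (3 + t * I)) -
      (Real.sqrt Real.pi * H * resonatorForm r N : ℝ)‖ ≤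
      4 * H * N ^ 4 * Real.exp (-(H / N) ^ 2 / 32) := by
  have hH0 : 0 < H := by linarith
  set K : ℝ → ℂ := fun t => resonatorKernel r N H T (3 + t * I) with hK
  have hKi : Integrable K := by
    have := integrable_resonatorKernel_vertical hr hN T hH (σ := 3) (by norm_num) le_rfl
    simpa using this
  have hre : ∀ t : ℝ, (3 + t * I : ℂ).re = 3 := fun t => by simp
  have hinv : ∀ t : ℝ, K t / riemannZeta (3 + t * I) = ∑' n, K t * LSeries.term ↗μ (3 + t * I) n := by
    intro t
    have h1 : 1 < (3 + t * I : ℂ).re := by rw [hre]; norm_num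
    have h := LSeries_zeta_mul_Lseries_moebius h1
    rw [LSeries_zeta_eq_riemannZeta h1] at h
    rw [tsum_mul_left]
    have h0 : riemannZeta (3 + t * I) ≠ 0 := left_ne_zero_of_mul_eq_one h
    rw [div_eq_iff h0, mul_assoc]
    change K t = K t * (LSeries ↗μ (3 + t * I) * riemannZeta (3 + t * I))
    rw [mul_comm (LSeries _ _), h, mul_one]
  set F : ℕ → ℝ → ℂ := fun n t => K t * LSeries.term ↗μ (3 + t * I) n with hF
  set c : ℕ → ℕ → ℕ → ℝ := fun n h k => (μ n : ℝ) / Real.sqrt n * (r h * r k) with hc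
  set l : ℕ → ℕ → ℕ → ℝ := fun n h k => Real.log k - Real.log h - Real.log n with hl
  have hFeq : ∀ n, 0 < n → F n = fun t : ℝ => ∑ h ∈ Finset.Icc 1 N, ∑ k ∈ Finset.Icc 1 N, (c n h k : ℂ) *
        cexp ((5 / 2 + t * I - T * I) ^ 2 / H ^ 2 + (5 / 2 + t * I) * (l n h k : ℝ)) := by
    intro n hn
    funext t
    exact resonatorKernel_three r N H T t hn
  have hF0 : F 0 = fun _ => 0 := by funext t; simp [hF]
  have hFi : ∀ n, Integrable (F n) := by
    intro n
    rcases Nat.eq_zero_or_pos n with rfl | hn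
    · rw [hF0]; exact integrable_zero _ _ _
    · rw [hFeq n hn]
      exact integrable_finsetSum _ fun h _ => integrable_finsetSum _ fun k _ =>
        (integral_gaussian_shift hH0 T _).1.const_mul _
  have hFint : ∀ n, 0 < n → ∫ t, F n t = ∑ h ∈ Finset.Icc 1 N, ∑ k ∈ Finset.Icc 1 N, (c n h k : ℂ) *
      ((Real.sqrt Real.pi * H : ℝ) * cexp (T * (l n h k : ℝ) * I - H ^ 2 * (l n h k : ℝ) ^ 2 / 4)) := by
    intro n hn
    rw [hFeq n hn, integral_finsetSum _ fun h _ => integrable_finsetSum _ fun k _ =>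
        (integral_gaussian_shift hH0 T _).1.const_mul _]
    refine Finset.sum_congr rfl fun h _ => ?_
    rw [integral_finsetSum _ fun k _ => (integral_gaussian_shift hH0 T _).1.const_mul _]
    refine Finset.sum_congr rfl fun k _ => ?_
    rw [integral_const_mul, (integral_gaussian_shift hH0 T _).2]
  have hsq : Summable fun n : ℕ => 1 / (n : ℝ) ^ 2 := Real.summable_one_div_nat_pow.mpr one_lt_two
  have hFn : ∀ n t, ‖F n t‖ ≤ 1 / (n : ℝ) ^ 2 * ‖K t‖ := by
    intro n t
    rw [hF, norm_mul, mul_comm]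
    gcongr
    exact norm_term_moebius_le (by rw [hre]; norm_num) n
  have hsum : Summable fun n => ∫ t, ‖F n t‖ := by
    refine Summable.of_nonneg_of_le (fun n => integral_nonneg fun t => norm_nonneg _) (fun n => ?_)
      (hsq.mul_right (∫ t, ‖K t‖))
    rw [← integral_const_mul]
    exact integral_mono (hFi n).norm (hKi.norm.const_mul _) (hFn n)
  have hHS := hasSum_integral_of_summable_integral_norm hFi hsum
  have hint : Integrable (fun t : ℝ => K t / riemannZeta (3 + t * I)) := by
    simp only [hinv]
    refine Integrable.mono' (hKi.norm.const_mul (∑' n : ℕ, 1 / (n : ℝ) ^ 2)) ?_ ?_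
    · have hm : Continuous fun t : ℝ => K t / riemannZeta (3 + t * I) := by
        have hz : ∀ t : ℝ, riemannZeta (3 + t * I) ≠ 0 := fun t =>
          riemannZeta_ne_zero_of_one_lt_re (by rw [hre]; norm_num)
        have hz1 : ∀ t : ℝ, (3 + t * I : ℂ) ≠ 1 := fun t h => by
          have := congrArg Complex.re h; rw [hre] at this; norm_num at this
        refine Continuous.div ((differentiable_resonatorKernel r N H T).continuous.comp (by fun_prop)) ?_ hz
        refine continuous_iff_continuousAt.mpr fun t => ?_
        exact ContinuousAt.comp (f := fun t : ℝ => (3 + t * I : ℂ))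
          (differentiableAt_riemannZeta (hz1 t)).continuousAt (by fun_prop)
      simp only [hinv] at hm
      exact hm.aestronglyMeasurable
    · refine Eventually.of_forall fun t => ?_
      rw [← tsum_mul_right]
      exact tsum_of_norm_bounded (hsq.mul_right ‖K t‖).hasSum (fun n => hFn n t)
  refine ⟨hint, ?_⟩
  -- The diagonal part of each term. It vanishes for `n > N`, because `hn = k ≤ N` forces `n ≤ N`,
  -- so the series sums to the finite form.
  set d : ℕ → ℂ := fun n => if n = 0 then 0 else ((Real.sqrt Real.pi * H : ℝ) : ℂ) *
    ∑ h ∈ Finset.Icc 1 N, ∑ k ∈ Finset.Icc 1 N, if k = h * n then (c n h k : ℂ) else 0 with hd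
  have hdS : HasSum d ((Real.sqrt Real.pi * H * resonatorForm r N : ℝ) : ℂ) := by
    have e : ((Real.sqrt Real.pi * H * resonatorForm r N : ℝ) : ℂ) = ∑ n ∈ Finset.Icc 1 N, d n := by
      rw [resonatorForm, Complex.ofReal_mul, Complex.ofReal_sum, Finset.mul_sum]
      refine Finset.sum_congr rfl fun n hn => ?_
      rw [Finset.mem_Icc] at hn
      simp only [hd, if_neg (show n ≠ 0 by omega), hc]
      congr 1
      push_cast
      refine Finset.sum_congr rfl fun h _ => Finset.sum_congr rfl fun k _ => ?_
      split_ifs <;> simp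
    rw [e]
    refine hasSum_sum_of_ne_finset_zero fun n hn => ?_
    simp only [hd]
    split_ifs with h0
    · rfl
    · rw [Finset.sum_eq_zero, mul_zero]
      intro h hh
      refine Finset.sum_eq_zero fun k hk => ?_
      rw [if_neg]
      rintro rfl
      rw [Finset.mem_Icc] at hh hk hn
      have : n ≤ h * n := Nat.le_mul_of_pos_left n (by omega)
      omega
  have hdiff := hHS.sub hdS
  have hg : (fun t : ℝ => resonatorKernel r N H T (3 + t * I) / riemannZeta (3 + t * I)) =
      fun t => ∑' n, F n t := funext hinv
  rw [hg]
  set E := Real.exp (-(H / N) ^ 2 / 32) with hE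
  have hE0 : 0 < E := Real.exp_pos _
  have hQ0 : 0 ≤ Real.sqrt Real.pi * H := by positivity
  have hbd : ∀ n, ‖(∫ t, F n t) - d n‖ ≤ (Real.sqrt Real.pi * H * E * N ^ 4) * (1 / (n : ℝ) ^ 2) := by
    intro n
    rcases Nat.eq_zero_or_pos n with rfl | hn
    · rw [hF0]; simp [hd]
    have hn1 : (1 : ℝ) ≤ n := by exact_mod_cast hn
    rw [hFint n hn]
    simp only [hd, if_neg hn.ne']
    rw [Finset.mul_sum, ← Finset.sum_sub_distrib]
    have hterm : ∀ h ∈ Finset.Icc 1 N, ∀ k ∈ Finset.Icc 1 N,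
        ‖(c n h k : ℂ) * ((Real.sqrt Real.pi * H : ℝ) * cexp (T * (l n h k : ℝ) * I - H ^ 2 * (l n h k : ℝ) ^ 2 / 4)) -
          ((Real.sqrt Real.pi * H : ℝ) : ℂ) * (if k = h * n then (c n h k : ℂ) else 0)‖ ≤
        Real.sqrt Real.pi * H * E * (N ^ 2 * (1 / (n : ℝ) ^ 2)) := by
      intro h hh k hk
      rw [Finset.mem_Icc] at hh hk
      have hh' : (0 : ℝ) < h := by exact_mod_cast hh.1
      split_ifs with hkn
      · have hl0 : l n h k = 0 := by
          simp only [hl, hkn]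
          rw [Nat.cast_mul, Real.log_mul (by positivity) (by positivity)]
          ring
        rw [hl0]
        have : (c n h k : ℂ) * ((Real.sqrt Real.pi * H : ℝ) * cexp (T * (0 : ℝ) * I - H ^ 2 * (0 : ℝ) ^ 2 / 4)) -
          ((Real.sqrt Real.pi * H : ℝ) : ℂ) * (c n h k : ℂ) = 0 := by simp; ring
        rw [this, norm_zero]
        positivity
      · rw [mul_zero, sub_zero, norm_mul, norm_mul, Complex.norm_real, Complex.norm_real, Complex.norm_exp,
          Real.norm_eq_abs, Real.norm_eq_abs, abs_of_nonneg hQ0]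
        have hcle : |c n h k| ≤ 1 := by
          simp only [hc]
          rw [abs_mul, abs_mul, abs_div]
          have h1 : |(μ n : ℝ)| ≤ 1 := by
            have : |μ n| ≤ 1 := abs_moebius_le_one
            exact_mod_cast this
          have h2 : (1 : ℝ) ≤ |Real.sqrt n| := by
            rw [abs_of_nonneg (Real.sqrt_nonneg _)]
            exact Real.one_le_sqrt.mpr hn1
          have h3 : |(μ n : ℝ)| / |Real.sqrt n| ≤ 1 := by
            rw [div_le_one (by linarith)]; linarith
          have h4 : |r h| * |r k| ≤ 1 := mul_le_one₀ (hr h) (abs_nonneg _) (hr k)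
          exact mul_le_one₀ h3 (by positivity) h4
        have hex : (T * (l n h k : ℝ) * I - H ^ 2 * (l n h k : ℝ) ^ 2 / 4 : ℂ).re = -(H ^ 2 * (l n h k) ^ 2 / 4) := by
          rw [show (T * (l n h k : ℝ) * I - H ^ 2 * (l n h k : ℝ) ^ 2 / 4 : ℂ) =
            ((-(H ^ 2 * (l n h k) ^ 2 / 4) : ℝ) : ℂ) + ((T * l n h k : ℝ) : ℂ) * I by push_cast; ring,
            Complex.add_re, Complex.ofReal_re, Complex.re_ofReal_mul, Complex.I_re, mul_zero, add_zero]
        rw [hex]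
        have hexp := exp_neg_sq_log_le (H := H) (h := h) (k := k) (n := n) (N := N) (by omega) (by omega) hn hk.2 hkn hNH
        calc |c n h k| * (Real.sqrt Real.pi * H * Real.exp (-(H ^ 2 * (l n h k) ^ 2 / 4)))
            ≤ 1 * (Real.sqrt Real.pi * H * (E * (N ^ 2 * (1 / (n : ℝ) ^ 2)))) := by
              gcongr
          _ = _ := by ring
    refine (norm_sum_le _ _).trans ?_
    have h1 : ∀ h ∈ Finset.Icc 1 N, ‖∑ k ∈ Finset.Icc 1 N, (c n h k : ℂ) *
        ((Real.sqrt Real.pi * H : ℝ) * cexp (T * (l n h k : ℝ) * I - H ^ 2 * (l n h k : ℝ) ^ 2 / 4)) -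
          ((Real.sqrt Real.pi * H : ℝ) : ℂ) * ∑ k ∈ Finset.Icc 1 N, (if k = h * n then (c n h k : ℂ) else 0)‖ ≤
        ∑ _k ∈ Finset.Icc 1 N, Real.sqrt Real.pi * H * E * (N ^ 2 * (1 / (n : ℝ) ^ 2)) := by
      intro h hh
      rw [Finset.mul_sum, ← Finset.sum_sub_distrib]
      exact (norm_sum_le _ _).trans (Finset.sum_le_sum fun k hk => hterm h hh k hk)
    refine (Finset.sum_le_sum h1).trans (le_of_eq ?_)
    simp only [Finset.sum_const, Nat.card_Icc, nsmul_eq_mul, Nat.add_sub_cancel]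
    ring
  have hfin : ‖(∫ t, ∑' n, F n t) - ((Real.sqrt Real.pi * H * resonatorForm r N : ℝ) : ℂ)‖ ≤
      (Real.sqrt Real.pi * H * E * N ^ 4) * (Real.pi ^ 2 / 6) := by
    rw [← hdiff.tsum_eq]
    exact tsum_of_norm_bounded (hasSum_zeta_two.mul_left _) hbd
  refine hfin.trans ?_
  have hs2 : Real.sqrt Real.pi ≤ 2 := by
    rw [Real.sqrt_le_left (by norm_num)]; linarith [Real.pi_lt_four]
  have hp2 : Real.pi ^ 2 / 6 ≤ 2 := by
    have := Real.pi_lt_d2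
    have := Real.pi_pos
    nlinarith
  calc Real.sqrt Real.pi * H * E * N ^ 4 * (Real.pi ^ 2 / 6) ≤ 2 * H * E * N ^ 4 * 2 := by gcongr
    _ = _ := by ring

end

/-! ### The vertical edges of the contour -/

section

open Complex MeasureTheory Filter Topology Set Metric

lemma integral_exp_half_gaussian_le {H : ℝ} (hH : 0 < H) (T : ℝ) :
    ∫ t : ℝ, Real.exp (-(1 / (2 * H ^ 2)) * (t - T) ^ 2) ≤ 3 * H := by
  rw [integral_gaussian_real, Real.sqrt_le_left (by positivity), div_div_eq_mul_div, div_one]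
  have := Real.pi_lt_four
  nlinarith [sq_nonneg H]

/-- Half of the exponent becomes a uniform saving and half is kept for integrability. -/
lemma exp_gaussian_le_of_far {H T t : ℝ} (hH : 0 < H) (h : (T / 2) ^ 2 ≤ (t - T) ^ 2) :
    Real.exp (-(t - T) ^ 2 / H ^ 2) ≤
      Real.exp (-(T / H) ^ 2 / 8) * Real.exp (-(1 / (2 * H ^ 2)) * (t - T) ^ 2) := by
  rw [← Real.exp_add, Real.exp_le_exp]
  have h1 : -(T / H) ^ 2 / 8 + -(1 / (2 * H ^ 2)) * (t - T) ^ 2 = -(T ^ 2 / 8 + (t - T) ^ 2 / 2) / H ^ 2 := by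
    field_simp; ring
  rw [h1]
  gcongr
  nlinarith

lemma exp_gaussian_le_half {H T t : ℝ} (hH : 0 < H) :
    Real.exp (-(t - T) ^ 2 / H ^ 2) ≤ Real.exp (-(1 / (2 * H ^ 2)) * (t - T) ^ 2) := by
  rw [Real.exp_le_exp]
  have h1 : -(1 / (2 * H ^ 2)) * (t - T) ^ 2 = -((t - T) ^ 2 / 2) / H ^ 2 := by field_simp
  rw [h1]
  gcongr
  nlinarith [sq_nonneg (t - T)]

lemma norm_div_riemannZeta_le {K s : ℂ} (hs : 2 ≤ s.re) : ‖K / riemannZeta s‖ ≤ 2 * ‖K‖ := by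
  have h := half_le_norm_riemannZeta hs
  rw [norm_div, div_le_iff₀ (by linarith)]
  nlinarith [norm_nonneg K]

lemma norm_integral_right_sub_le {r : ℕ → ℝ} (hr : ∀ n, |r n| ≤ 1) {N : ℕ} (hN : 1 ≤ N) {H T t₀ t₁ : ℝ}
    (hH : 5 / 2 ≤ H) (hNH : 32 * N ≤ H ^ 2) (hT : 0 ≤ T) (h0 : t₀ ≤ T / 2) (h1 : 2 * T ≤ t₁) :
    ‖(∫ t in t₀..t₁, resonatorKernel r N H T (3 + t * I) / riemannZeta (3 + t * I)) -
      (Real.sqrt Real.pi * H * resonatorForm r N : ℝ)‖ ≤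
      4 * H * N ^ 4 * Real.exp (-(H / N) ^ 2 / 32) + 18 * N ^ 8 * H * Real.exp (-(T / H) ^ 2 / 8) := by
  have hH0 : 0 < H := by linarith
  obtain ⟨hi, hJ⟩ := norm_integral_resonatorKernel_three_sub_le hr hN T hH hNH
  set f : ℝ → ℂ := fun t => resonatorKernel r N H T (3 + t * I) / riemannZeta (3 + t * I) with hf
  have hfb : ∀ t : ℝ, ‖f t‖ ≤ 6 * N ^ 8 * Real.exp (-(t - T) ^ 2 / H ^ 2) := by
    intro t
    have e := norm_resonatorKernel_le hr hN (T := T) hH (s := 3 + t * I) (by simp; norm_num) (by simp)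
    have e2 := norm_div_riemannZeta_le (K := resonatorKernel r N H T (3 + t * I)) (s := 3 + t * I) (by simp; norm_num)
    simp only [add_im, mul_im, ofReal_re, I_im, I_re, ofReal_im] at e
    norm_num at e
    refine e2.trans ?_
    linarith
  have hsplit : (∫ t, f t) - (∫ t in t₀..t₁, f t) = ∫ t in (Ioc t₀ t₁)ᶜ, f t := by
    rw [intervalIntegral.integral_of_le (by linarith), sub_eq_iff_eq_add, add_comm]
    exact (integral_add_compl measurableSet_Ioc hi).symm
  have hE : Integrable fun t : ℝ => 6 * N ^ 8 * Real.exp (-(T / H) ^ 2 / 8) *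
      Real.exp (-(1 / (2 * H ^ 2)) * (t - T) ^ 2) :=
    (integrable_gaussian_real (by positivity) T).const_mul _
  have htail : ‖∫ t in (Ioc t₀ t₁)ᶜ, f t‖ ≤ 18 * N ^ 8 * H * Real.exp (-(T / H) ^ 2 / 8) := by
    refine (norm_integral_le_of_norm_le (hE.integrableOn (s := (Ioc t₀ t₁)ᶜ)) ?_).trans ?_
    · filter_upwards [ae_restrict_mem measurableSet_Ioc.compl] with t ht
      refine (hfb t).trans ?_
      rw [mul_assoc (6 * (N : ℝ) ^ 8)]
      refine mul_le_mul_of_nonneg_left (exp_gaussian_le_of_far hH0 ?_) (by positivity)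
      rw [mem_compl_iff, mem_Ioc, not_and_or, not_lt, not_le] at ht
      rcases ht with h | h <;> nlinarith
    · refine (setIntegral_le_integral hE (Eventually.of_forall fun t => by positivity)).trans ?_
      rw [integral_const_mul]
      have := integral_exp_half_gaussian_le hH0 T
      calc _ ≤ 6 * (N : ℝ) ^ 8 * Real.exp (-(T / H) ^ 2 / 8) * (3 * H) := by gcongr
        _ = _ := by ring
  have e : (∫ t in t₀..t₁, f t) - ((Real.sqrt Real.pi * H * resonatorForm r N : ℝ) : ℂ) =
      ((∫ t, f t) - ((Real.sqrt Real.pi * H * resonatorForm r N : ℝ) : ℂ)) - ∫ t in (Ioc t₀ t₁)ᶜ, f t := by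
    rw [← hsplit]; ring
  rw [e]
  exact (norm_sub_le _ _).trans (add_le_add hJ htail)

/-- On the line `Re s = -2` the reflected resonator is bounded. -/
lemma norm_resonatorKernel_neg_two_le {r : ℕ → ℝ} (hr : ∀ n, |r n| ≤ 1) {N : ℕ} {H T : ℝ}
    (hH : 5 / 2 ≤ H) (t : ℝ) :
    ‖resonatorKernel r N H T (-2 + t * I)‖ ≤
      6 * (N * Real.exp (5 / 2 * Real.log N)) * Real.exp (-(t - T) ^ 2 / H ^ 2) := by
  unfold resonatorKernel
  rw [norm_mul, norm_mul]
  have h1 := norm_gaussian_weight_le (T := T) hH (s := -2 + t * I) (by simp) (by simp; norm_num)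
  have e1 : (-2 + t * I : ℂ).im = t := by simp
  rw [e1] at h1
  have h2 : ‖dirichletPoly r N (-2 + t * I - 1 / 2)‖ ≤ N * Real.exp (5 / 2 * Real.log N) :=
    norm_dirichletPoly_le hr (by norm_num) (by simp; norm_num)
  have h3 : ‖dirichletPoly r N (1 / 2 - (-2 + t * I))‖ ≤ 2 := by
    refine (norm_dirichletPoly_le_sum hr N _).trans ?_
    have h4 : ∀ n ∈ Finset.Icc 1 N, Real.exp (-(1 / 2 - (-2 + t * I) : ℂ).re * Real.log n) ≤ 1 / (n : ℝ) ^ 2 := by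
      intro n hn
      rw [Finset.mem_Icc] at hn
      have hn1 : (1 : ℝ) ≤ n := by exact_mod_cast hn.1
      have h5 : 1 / (n : ℝ) ^ 2 = Real.exp (-2 * Real.log n) := by
        rw [neg_mul, Real.exp_neg, one_div, show (2 : ℝ) = ((2 : ℕ) : ℝ) by norm_num, Real.exp_nat_mul,
          Real.exp_log (by linarith)]
      rw [h5, Real.exp_le_exp]
      have := Real.log_nonneg hn1
      simp
      linarith
    refine (Finset.sum_le_sum h4).trans ?_
    refine (hasSum_zeta_two.summable.sum_le_tsum _ fun n _ => by positivity).trans ?_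
    rw [hasSum_zeta_two.tsum_eq]
    have := Real.pi_lt_d2
    have := Real.pi_pos
    nlinarith
  calc _ ≤ (3 * Real.exp (-(t - T) ^ 2 / H ^ 2)) * ((N * Real.exp (5 / 2 * Real.log N)) * 2) := by gcongr
    _ = _ := by ring

lemma exists_inv_norm_riemannZeta_neg_two_le : ∃ κ : ℝ, 0 < κ ∧ ∀ (t x : ℝ), 1 ≤ t → 0 ≤ x → x ^ 2 ≤ t ^ 5 →
    x ≤ κ * ‖riemannZeta (-2 + t * I)‖ := by
  obtain ⟨k, hk, h⟩ := exists_norm_riemannZeta_neg_two_sq_ge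
  refine ⟨1 / Real.sqrt k, by positivity, fun t x ht hx hxt => ?_⟩
  have h1 := h t ht
  have h2 : (Real.sqrt k * x) ^ 2 ≤ ‖riemannZeta (-2 + t * I)‖ ^ 2 := by
    rw [mul_pow, Real.sq_sqrt hk.le]
    exact (mul_le_mul_of_nonneg_left hxt hk.le).trans h1
  have h3 := (pow_le_pow_iff_left₀ (by positivity) (norm_nonneg _) two_ne_zero).mp h2
  have : 0 < Real.sqrt k := Real.sqrt_pos.mpr hk
  rw [div_mul_eq_mul_div, one_mul, le_div_iff₀ this]
  linarith

/-- For `t ≥ T/2` the kernel is `O(N^{7/2}) = O(X^28)` while `|ζ(-2+it)|` is at least of order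
`T^{5/2} = X^30`, a saving of `X²`. For `t < T/2` the Gaussian is negligible and any positive lower
bound for zeta suffices. -/
lemma norm_integral_left_le {r : ℕ → ℝ} (hr : ∀ n, |r n| ≤ 1) {X : ℕ} (hX : 4 ≤ X) {κ t₀ t₁ : ℝ}
    (hκ : 0 < κ) (hκ' : ∀ (t x : ℝ), 1 ≤ t → 0 ≤ x → x ^ 2 ≤ t ^ 5 → x ≤ κ * ‖riemannZeta (-2 + t * I)‖)
    (h0 : 1 ≤ t₀) (h01 : t₀ ≤ t₁) :
    ‖∫ t in t₀..t₁, resonatorKernel r (X ^ 8) (X ^ 9) (X ^ 12) (-2 + t * I) / riemannZeta (-2 + t * I)‖ ≤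
      (9 * X ^ 64 * Real.exp (-(X : ℝ) ^ 6 / 8) + 108 / X ^ 2) * κ * X ^ 9 := by
  have hX1 : (4 : ℝ) ≤ X := by exact_mod_cast hX
  have hX0 : (0 : ℝ) < X := by linarith
  set H : ℝ := (X : ℝ) ^ 9 with hHdef
  set T : ℝ := (X : ℝ) ^ 12 with hTdef
  have hH : 5 / 2 ≤ H := by
    have : (X : ℝ) ^ 1 ≤ X ^ 9 := pow_le_pow_right₀ (by linarith) (by norm_num)
    linarith
  have hH0 : 0 < H := by positivity
  have hTH : (T / H) ^ 2 = (X : ℝ) ^ 6 := by rw [hTdef, hHdef]; field_simp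
  set A : ℝ := 3 * X ^ 64 * Real.exp (-(X : ℝ) ^ 6 / 8) + 36 / X ^ 2 with hA
  have hbound : ∀ t : ℝ, t₀ ≤ t → ‖resonatorKernel r (X ^ 8) H T (-2 + t * I) / riemannZeta (-2 + t * I)‖ ≤
      A * κ * Real.exp (-(1 / (2 * H ^ 2)) * (t - T) ^ 2) := by
    intro t ht
    have hz1 := hκ' t 1 (by linarith) zero_le_one (by rw [one_pow]; exact one_le_pow₀ (by linarith))
    have hzpos : 0 < ‖riemannZeta (-2 + t * I)‖ := by
      by_contra hcon
      have : ‖riemannZeta (-2 + t * I)‖ = 0 := le_antisymm (not_lt.mp hcon) (norm_nonneg _)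
      rw [this] at hz1; norm_num at hz1
    set g := Real.exp (-(1 / (2 * H ^ 2)) * (t - T) ^ 2) with hg
    have hg0 : 0 < g := Real.exp_pos _
    rw [norm_div, div_le_iff₀ hzpos]
    rcases lt_or_ge t (T / 2) with hlt | hge
    · have h1 := norm_resonatorKernel_le hr (N := X ^ 8) (Nat.one_le_pow _ _ (by omega)) (T := T) hH
        (s := -2 + t * I) (by simp) (by simp; norm_num)
      have e1 : (-2 + t * I : ℂ).im = t := by simp
      rw [e1] at h1
      have h2 := exp_gaussian_le_of_far (t := t) (T := T) hH0 (by nlinarith)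
      rw [hTH] at h2
      calc _ ≤ 3 * ((X ^ 8 : ℕ) : ℝ) ^ 8 * (Real.exp (-(X : ℝ) ^ 6 / 8) * g) := by
            refine h1.trans ?_; gcongr
        _ = (3 * X ^ 64 * Real.exp (-(X : ℝ) ^ 6 / 8)) * 1 * g := by push_cast; ring
        _ ≤ A * (κ * ‖riemannZeta (-2 + t * I)‖) * g := by
            gcongr
            rw [hA]
            have : 0 ≤ 36 / (X : ℝ) ^ 2 := by positivity
            linarith
        _ = _ := by ring
    · have h1 := norm_resonatorKernel_neg_two_le hr (N := X ^ 8) (T := T) hH t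
      have h2 := exp_gaussian_le_half (t := t) (T := T) hH0
      have hlog : Real.exp (5 / 2 * Real.log ((X ^ 8 : ℕ) : ℝ)) = X ^ 20 := by
        push_cast
        rw [Real.log_pow, show 5 / 2 * ((8 : ℕ) * Real.log X) = (20 : ℕ) * Real.log X by push_cast; ring,
          Real.exp_nat_mul, Real.exp_log hX0]
      rw [hlog] at h1
      -- The divisor 6 works because `(X^30/6)² = X^60/36 ≤ X^60/32 = (T/2)^5`.
      have h3 := hκ' t ((X : ℝ) ^ 30 / 6) (by linarith) (by positivity) (by
        have h4 : (T / 2) ^ 5 ≤ t ^ 5 := by gcongr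
        refine le_trans ?_ h4
        rw [div_pow, div_pow, hTdef, ← pow_mul, ← pow_mul]
        norm_num
        gcongr
        norm_num)
      calc _ ≤ 6 * (((X ^ 8 : ℕ) : ℝ) * X ^ 20) * g := by refine h1.trans ?_; gcongr
        _ = (36 / X ^ 2) * (X ^ 30 / 6) * g := by push_cast; field_simp; norm_num
        _ ≤ A * (κ * ‖riemannZeta (-2 + t * I)‖) * g := by
            gcongr
            rw [hA]
            have : 0 ≤ 3 * (X : ℝ) ^ 64 * Real.exp (-(X : ℝ) ^ 6 / 8) := by positivity
            linarith
        _ = _ := by ring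
  have hI : Integrable fun t : ℝ => A * κ * Real.exp (-(1 / (2 * H ^ 2)) * (t - T) ^ 2) :=
    (integrable_gaussian_real (by positivity) T).const_mul _
  rw [intervalIntegral.integral_of_le h01]
  refine (norm_integral_le_of_norm_le (hI.integrableOn (s := Ioc t₀ t₁)) ?_).trans ?_
  · filter_upwards [ae_restrict_mem measurableSet_Ioc] with t ht
    exact hbound t ht.1.le
  · refine (setIntegral_le_integral hI (Eventually.of_forall fun t => by positivity)).trans ?_
    rw [integral_const_mul]
    have := integral_exp_half_gaussian_le hH0 T
    calc _ ≤ A * κ * (3 * H) := by gcongr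
      _ = _ := by rw [hA]; ring

end

/-! ### Horizontal edges and assembly of the contour integral -/

section

open Complex MeasureTheory Filter Topology Set Metric

lemma norm_integral_horizontal_le {r : ℕ → ℝ} (hr : ∀ n, |r n| ≤ 1) {N : ℕ} (hN : 1 ≤ N) {H T t m : ℝ}
    (hH : 5 / 2 ≤ H) (hm : 0 < m) (h : ∀ σ ∈ Icc (-2 : ℝ) 3, m ≤ ‖riemannZeta (σ + t * I)‖) :
    ‖∫ σ in (-2 : ℝ)..3, resonatorKernel r N H T (σ + t * I) / riemannZeta (σ + t * I)‖ ≤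
      15 * N ^ 8 * Real.exp (-(t - T) ^ 2 / H ^ 2) / m := by
  have h1 := intervalIntegral.norm_integral_le_of_norm_le_const (a := (-2 : ℝ)) (b := 3)
    (f := fun σ : ℝ => resonatorKernel r N H T (σ + t * I) / riemannZeta (σ + t * I))
    (C := 3 * N ^ 8 * Real.exp (-(t - T) ^ 2 / H ^ 2) / m) (fun σ hσ => by
      rw [uIoc_of_le (by norm_num)] at hσ
      rw [norm_div]
      have h2 := norm_resonatorKernel_le hr hN (T := T) hH (s := σ + t * I) (by simpa using hσ.1.le)
        (by simpa using hσ.2)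
      have h3 : ((σ : ℂ) + t * I).im = t := by simp
      rw [h3] at h2
      have h4 := h σ ⟨hσ.1.le, hσ.2⟩
      gcongr)
  refine h1.trans (le_of_eq ?_)
  rw [show |(3 : ℝ) - -2| = 5 by norm_num]
  ring

lemma eventually_mul_pow_mul_exp_le {A B : ℝ} (hA : 0 ≤ A) (k : ℕ) :
    ∀ᶠ X : ℕ in atTop, A * (X : ℝ) ^ k * Real.exp (-(X : ℝ) ^ 2 / 32) + B / (X : ℝ) ^ 2 ≤ 1 := by
  have h1 : Tendsto (fun x : ℝ => A * Real.exp 8 * (x ^ k * Real.exp (-x)) + B / x ^ 2) atTop (𝓝 0) := by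
    have := ((Real.tendsto_pow_mul_exp_neg_atTop_nhds_zero k).const_mul (A * Real.exp 8)).add
      ((tendsto_const_nhds (x := B)).div_atTop (tendsto_pow_atTop (two_ne_zero)))
    simpa using this
  filter_upwards [(h1.comp tendsto_natCast_atTop_atTop).eventually_le_const (zero_lt_one)] with X hX
  refine le_trans ?_ hX
  simp only [Function.comp]
  -- From `(X - 16)² ≥ 0`, that is `X²/32 ≥ X - 8`.
  have : Real.exp (-(X : ℝ) ^ 2 / 32) ≤ Real.exp 8 * Real.exp (-(X : ℝ)) := by
    rw [← Real.exp_add, Real.exp_le_exp]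
    nlinarith [sq_nonneg ((X : ℝ) - 16)]
  have := mul_le_mul_of_nonneg_left this (show 0 ≤ A * (X : ℝ) ^ k by positivity)
  linarith

set_option maxHeartbeats 1000000 in
-- The residue theorem on `[-2, 3] × [t₀, t₁]`, with `t₀` fixed and `t₁` near `T² = X^24`;
-- everything except the main term on the right edge amounts to at most `H = X^9`. The threshold for
-- `X` does not depend on `r`.
lemma exists_zeros_resonatorForm_le {T₀ : ℝ} (hT₀ : 4 ≤ T₀)
    (hline : ∀ ρ : ℂ, riemannZeta ρ = 0 → 0 < ρ.im → ρ.re = 1 / 2)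
    (hsimple : ∀ ρ : ℂ, riemannZeta ρ = 0 → T₀ ≤ ρ.im → deriv riemannZeta ρ ≠ 0) :
    ∀ᶠ X : ℕ in atTop, ∀ r : ℕ → ℝ, (∀ n, |r n| ≤ 1) → ∃ Z : Finset ℂ,
      (∀ ρ ∈ Z, riemannZeta ρ = 0 ∧ ρ.re = 1 / 2 ∧ T₀ ≤ ρ.im ∧ ρ.im ≤ (X : ℝ) ^ 24 + 1) ∧
      Real.sqrt Real.pi * (X : ℝ) ^ 9 * resonatorForm r (X ^ 8) - (X : ℝ) ^ 9 ≤
        2 * Real.pi * ∑ ρ ∈ Z, Real.exp (-(ρ.im - (X : ℝ) ^ 12) ^ 2 / ((X : ℝ) ^ 9) ^ 2) *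
          ‖resonator r (X ^ 8) ρ.im‖ ^ 2 / ‖deriv riemannZeta ρ‖ := by
  obtain ⟨K, hK1, hK⟩ := exists_height_riemannZeta_ge T₀ hsimple
  obtain ⟨κ, hκ, hκ'⟩ := exists_inv_norm_riemannZeta_neg_two_le
  obtain ⟨t₀, ht₀, hbot⟩ := hK (max 10 (T₀ + 7)) (le_max_left _ _) (le_max_right _ _)
  set m := Real.exp (-(K * max 10 (T₀ + 7) * Real.log (max 10 (T₀ + 7)))) with hm
  have hm0 : 0 < m := Real.exp_pos _
  have ht10 : 10 ≤ t₀ := (le_max_left _ _).trans ht₀.1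
  have htT : T₀ + 7 ≤ t₀ := (le_max_right _ _).trans ht₀.1
  -- The summands of `A` come from the right edge, the left edge, the bottom and the top; `B` is the
  -- part of the left edge that is only polynomially small.
  filter_upwards [eventually_mul_pow_mul_exp_le (A := 4 + 18 + 9 * κ + 15 / m + 15) (B := 108 * κ) (by positivity) 64,
    eventually_ge_atTop 4, tendsto_natCast_atTop_atTop.eventually_ge_atTop (192 * K),
    tendsto_natCast_atTop_atTop.eventually_ge_atTop (2 * t₀)] with X hX hX4 hXK hXt r hr
  have hx4 : (4 : ℝ) ≤ X := by exact_mod_cast hX4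
  have hx0 : (0 : ℝ) < X := by linarith
  have hx1 : (1 : ℝ) ≤ X := by linarith
  have hpw : ∀ k : ℕ, 1 ≤ k → (X : ℝ) ≤ X ^ k := fun k hk => le_self_pow₀ hx1 (by omega)
  -- The top must be as high as `T²`: there the Gaussian exponent is about `X^48/H² = X^30`, which
  -- beats the `X^24 log X` lost in the lower bound for zeta. At height `2T` it would be only `X^6`,
  -- against a loss of order `X^12 log X`.
  obtain ⟨t₁, ht₁, htop⟩ := hK ((X : ℝ) ^ 24) (by
      have : (X : ℝ) ^ 2 ≤ X ^ 24 := pow_le_pow_right₀ hx1 (by norm_num)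
      nlinarith) (by have := hpw 24 (by norm_num); linarith)
  have h01 : t₀ ≤ t₁ := by have := hpw 24 (by norm_num); linarith [ht₁.1]
  set R : Set ℂ := Icc (-2 : ℝ) 3 ×ℂ Icc t₀ t₁ with hR
  have hfin : (R ∩ riemannZetaZeros).Finite :=
    IsCompact.inter_riemannZetaZeros_finite (isCompact_Icc.reProdIm isCompact_Icc)
  have hmem : ∀ ρ, ρ ∈ hfin.toFinset ↔ ρ ∈ R ∧ riemannZeta ρ = 0 := by
    intro ρ; simp [riemannZetaZeros]
  -- The lower bounds at `t₀` and `t₁` also exclude zeros on the horizontal edges.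
  have hedge : ∀ ρ ∈ hfin.toFinset, ρ.re = 1 / 2 ∧ t₀ < ρ.im ∧ ρ.im < t₁ := by
    intro ρ hρ
    obtain ⟨⟨h1, h2⟩, h3⟩ := (hmem ρ).mp hρ
    rw [Set.mem_preimage] at h1 h2
    refine ⟨hline ρ h3 (by linarith [h2.1]), lt_of_le_of_ne h2.1 fun h => ?_, lt_of_le_of_ne h2.2 fun h => ?_⟩
    · have := hbot ρ.re h1
      rw [h, re_add_im, h3, norm_zero] at this
      linarith
    · have := htop ρ.re h1
      rw [← h, re_add_im, h3, norm_zero] at this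
      linarith [Real.exp_pos (-(K * (X : ℝ) ^ 24 * Real.log ((X : ℝ) ^ 24)))]
  set N := X ^ 8 with hN
  have hN1 : 1 ≤ N := Nat.one_le_pow _ _ (by omega)
  set H : ℝ := (X : ℝ) ^ 9 with hH
  set T : ℝ := (X : ℝ) ^ 12 with hT
  have hNX : (N : ℝ) = X ^ 8 := by rw [hN]; push_cast; rfl
  have hH52 : 5 / 2 ≤ H := by have := hpw 9 (by norm_num); linarith
  have hH0 : 0 < H := by linarith
  have hres := rectIntegral_div_eq_sum (f := riemannZeta) (g := resonatorKernel r N H T) (a := -2) (b := 3)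
    (c := t₀) (d := t₁) (U := {1}ᶜ) isOpen_compl_singleton (by norm_num) h01 (by
      intro s hs hs1
      rw [mem_singleton_iff] at hs1
      have := hs.2.1
      rw [hs1] at this
      simp at this
      linarith) differentiableOn_riemannZeta_compl
    (differentiable_resonatorKernel r N H T).differentiableOn (Z := hfin.toFinset)
    (fun ρ hρ => by
      obtain ⟨h1, h2, h3⟩ := hedge ρ hρ
      have h4 := ((hmem ρ).mp hρ).2
      exact ⟨h4, hsimple ρ h4 (by linarith), by rw [h1]; norm_num, by rw [h1]; norm_num, h2, h3⟩)
    (fun s hs h => (hmem s).mpr ⟨hs, h⟩)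
  refine ⟨hfin.toFinset, fun ρ hρ => ?_, ?_⟩
  · obtain ⟨h1, h2, h3⟩ := hedge ρ hρ
    exact ⟨((hmem ρ).mp hρ).2, h1, by linarith, by linarith [ht₁.2]⟩
  have hright := norm_integral_right_sub_le hr hN1 (H := H) (T := T) (t₀ := t₀) (t₁ := t₁) hH52 (by
      rw [hNX, hH]
      have : (4 : ℝ) ^ 10 ≤ X ^ 10 := by gcongr
      calc 32 * (X : ℝ) ^ 8 ≤ X ^ 10 * X ^ 8 := by gcongr; linarith
        _ = _ := by ring) (by positivity) (by have := hpw 12 (by norm_num); linarith) (by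
      refine le_trans ?_ ht₁.1
      have : (X : ℝ) ≤ X ^ 12 := hpw 12 (by norm_num)
      calc 2 * T ≤ X ^ 12 * T := by gcongr; linarith
        _ = _ := by rw [hT]; ring)
  have hleft := norm_integral_left_le hr hX4 hκ hκ' (t₀ := t₀) (t₁ := t₁) (by linarith) h01
  have hb := norm_integral_horizontal_le hr hN1 (H := H) (T := T) hH52 hm0 hbot
  have ht := norm_integral_horizontal_le hr hN1 (H := H) (T := T) hH52 (Real.exp_pos _) htop
  have hsum : ‖∑ ρ ∈ hfin.toFinset, resonatorKernel r N H T ρ / deriv riemannZeta ρ‖ ≤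
      ∑ ρ ∈ hfin.toFinset, Real.exp (-(ρ.im - T) ^ 2 / H ^ 2) * ‖resonator r N ρ.im‖ ^ 2 / ‖deriv riemannZeta ρ‖ := by
    refine (norm_sum_le _ _).trans (Finset.sum_le_sum fun ρ hρ => ?_)
    rw [norm_div, resonatorKernel_critical _ _ _ _ (hedge ρ hρ).1, Complex.norm_real, Real.norm_of_nonneg (by positivity)]
  set E := Real.exp (-(X : ℝ) ^ 2 / 32) with hE
  have hEle : ∀ {y : ℝ}, y ≤ -(X : ℝ) ^ 2 / 32 → Real.exp y ≤ E := fun h => Real.exp_le_exp.mpr h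
  have hp26 : (X : ℝ) ^ 2 ≤ X ^ 6 := pow_le_pow_right₀ hx1 (by norm_num)
  have hHN : H / N = X := by rw [hH, hNX]; field_simp
  have hTH : T / H = X ^ 3 := by rw [hT, hH]; field_simp
  rw [hHN, hTH] at hright
  have e6 : Real.exp (-(X : ℝ) ^ 6 / 8) ≤ E := hEle (by nlinarith [sq_nonneg (X : ℝ)])
  have e6' : Real.exp (-((X : ℝ) ^ 3) ^ 2 / 8) ≤ E := by rw [← pow_mul]; exact e6
  have ebot : Real.exp (-(t₀ - T) ^ 2 / H ^ 2) ≤ E := by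
    have h1 : t₀ ≤ T / 2 := by have := hpw 12 (by norm_num); linarith
    refine hEle ?_
    rw [div_le_iff₀ (by positivity), hH]
    have h2 : (T / 2) ^ 2 ≤ (t₀ - T) ^ 2 := by nlinarith
    have h3 : (X : ℝ) ^ 20 ≤ X ^ 24 := pow_le_pow_right₀ hx1 (by norm_num)
    have h4 : (T / 2) ^ 2 = X ^ 24 / 4 := by rw [hT]; ring
    have h5 : -(X : ℝ) ^ 2 / 32 * ((X : ℝ) ^ 9) ^ 2 = - X ^ 20 / 32 := by ring
    rw [h5]
    have : 0 ≤ (X : ℝ) ^ 24 := by positivity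
    linarith
  have etop : Real.exp (-(t₁ - T) ^ 2 / H ^ 2) / Real.exp (-(K * (X : ℝ) ^ 24 * Real.log ((X : ℝ) ^ 24))) ≤ E := by
    rw [← Real.exp_sub]
    refine hEle ?_
    have h1 : (X : ℝ) ^ 24 / 2 ≤ t₁ - T := by
      have : 2 * T ≤ (X : ℝ) ^ 24 := by
        have : (X : ℝ) ≤ X ^ 12 := hpw 12 (by norm_num)
        calc 2 * T ≤ X ^ 12 * T := by gcongr; linarith
          _ = _ := by rw [hT]; ring
      linarith [ht₁.1]
    have h2 : ((X : ℝ) ^ 24 / 2) ^ 2 ≤ (t₁ - T) ^ 2 := by gcongr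
    have h3 : (X : ℝ) ^ 30 / 4 ≤ (t₁ - T) ^ 2 / H ^ 2 := by
      rw [le_div_iff₀ (by positivity), hH]
      refine le_trans (le_of_eq ?_) h2
      ring
    have h4 : K * (X : ℝ) ^ 24 * Real.log ((X : ℝ) ^ 24) ≤ X ^ 30 / 8 := by
      rw [Real.log_pow]
      have h5 : Real.log X ≤ X := (Real.log_le_sub_one_of_pos hx0).trans (by linarith)
      have h6 : (X : ℝ) ≤ X ^ 5 := hpw 5 (by norm_num)
      calc K * (X : ℝ) ^ 24 * ((24 : ℕ) * Real.log X) ≤ K * (X : ℝ) ^ 24 * ((24 : ℕ) * X) := by gcongr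
        _ = (192 * K) * X ^ 25 / 8 := by push_cast; ring
        _ ≤ X ^ 5 * X ^ 25 / 8 := by gcongr; linarith
        _ = _ := by ring
    have h7 : (X : ℝ) ^ 2 ≤ X ^ 30 := pow_le_pow_right₀ hx1 (by norm_num)
    have h8 : 0 ≤ (X : ℝ) ^ 30 := by positivity
    rw [neg_div]
    linarith
  have hbE : 15 * (N : ℝ) ^ 8 * Real.exp (-(t₀ - T) ^ 2 / H ^ 2) / m ≤ 15 / m * X ^ 64 * E * H := by
    have hH1 : 1 ≤ H := by linarith
    calc 15 * (N : ℝ) ^ 8 * Real.exp (-(t₀ - T) ^ 2 / H ^ 2) / m ≤ 15 * (N : ℝ) ^ 8 * E / m * 1 := by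
          rw [mul_one]; gcongr
      _ ≤ 15 * (N : ℝ) ^ 8 * E / m * H := by gcongr
      _ = _ := by rw [hNX]; ring
  have htE : 15 * (N : ℝ) ^ 8 * Real.exp (-(t₁ - T) ^ 2 / H ^ 2) /
      Real.exp (-(K * (X : ℝ) ^ 24 * Real.log ((X : ℝ) ^ 24))) ≤ 15 * X ^ 64 * E * H := by
    have hH1 : 1 ≤ H := by linarith
    rw [mul_div_assoc]
    calc _ ≤ 15 * (N : ℝ) ^ 8 * E * 1 := by rw [mul_one]; gcongr
      _ ≤ 15 * (N : ℝ) ^ 8 * E * H := by gcongr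
      _ = _ := by rw [hNX]; ring
  have hrE : 4 * H * N ^ 4 * Real.exp (-(X : ℝ) ^ 2 / 32) + 18 * N ^ 8 * H * Real.exp (-((X : ℝ) ^ 3) ^ 2 / 8) ≤
      (4 + 18) * X ^ 64 * E * H := by
    have h1 : (X : ℝ) ^ 32 ≤ X ^ 64 := pow_le_pow_right₀ hx1 (by norm_num)
    calc _ ≤ 4 * H * N ^ 4 * E + 18 * N ^ 8 * H * E := by gcongr
      _ = (4 * X ^ 32 + 18 * X ^ 64) * E * H := by rw [hNX]; ring
      _ ≤ (4 * X ^ 64 + 18 * X ^ 64) * E * H := by gcongr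
      _ = _ := by ring
  have hlE : (9 * X ^ 64 * Real.exp (-(X : ℝ) ^ 6 / 8) + 108 / X ^ 2) * κ * X ^ 9 ≤
      (9 * κ * X ^ 64 * E + 108 * κ / X ^ 2) * H := by
    calc _ ≤ (9 * X ^ 64 * E + 108 / X ^ 2) * κ * X ^ 9 := by gcongr
      _ = _ := by rw [hH]; ring
  have hXH : (4 + 18 + 9 * κ + 15 / m + 15) * X ^ 64 * E * H + 108 * κ / X ^ 2 * H ≤ H := by
    have := mul_le_mul_of_nonneg_right hX hH0.le
    linarith
  unfold rectIntegral at hres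
  set Rt := ∫ y : ℝ in t₀..t₁, resonatorKernel r N H T ((3 : ℝ) + y * I) / riemannZeta ((3 : ℝ) + y * I) with hRt
  set Lf := ∫ y : ℝ in t₀..t₁, resonatorKernel r N H T ((-2 : ℝ) + y * I) / riemannZeta ((-2 : ℝ) + y * I) with hLf
  set Bt := ∫ x : ℝ in (-2)..3, resonatorKernel r N H T (x + t₀ * I) / riemannZeta (x + t₀ * I) with hBt
  set Tp := ∫ x : ℝ in (-2)..3, resonatorKernel r N H T (x + t₁ * I) / riemannZeta (x + t₁ * I) with hTp
  set S := ∑ ρ ∈ hfin.toFinset, resonatorKernel r N H T ρ / deriv riemannZeta ρ with hS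
  have hRt' : Rt = ∫ t in t₀..t₁, resonatorKernel r N H T (3 + t * I) / riemannZeta (3 + t * I) := by
    rw [hRt]; push_cast; rfl
  have hLf' : Lf = ∫ t in t₀..t₁, resonatorKernel r N H T (-2 + t * I) / riemannZeta (-2 + t * I) := by
    rw [hLf]; push_cast; rfl
  rw [← hRt'] at hright
  have hleft' : ‖Lf‖ ≤ (9 * X ^ 64 * Real.exp (-(X : ℝ) ^ 6 / 8) + 108 / X ^ 2) * κ * X ^ 9 := by
    rw [hLf']; exact hleft
  have hRnorm : ‖Rt‖ ≤ 2 * Real.pi * ‖S‖ + ‖Bt‖ + ‖Tp‖ + ‖Lf‖ := by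
    have h1 : I * Rt = 2 * Real.pi * I * S - Bt + Tp + I * Lf := by linear_combination hres
    have h2 : ‖Rt‖ = ‖I * Rt‖ := by simp
    rw [h2, h1]
    refine (norm_add_le _ _).trans ?_
    refine (add_le_add_left (norm_add_le _ _) _).trans ?_
    refine (add_le_add_left (add_le_add_left (norm_sub_le _ _) _) _).trans (le_of_eq ?_)
    simp [abs_of_pos Real.pi_pos]
  have hform : Real.sqrt Real.pi * H * resonatorForm r N ≤ ‖Rt‖ +
      ‖Rt - (Real.sqrt Real.pi * H * resonatorForm r N : ℝ)‖ := by
    have h1 : Real.sqrt Real.pi * H * resonatorForm r N ≤ ‖((Real.sqrt Real.pi * H * resonatorForm r N : ℝ) : ℂ)‖ := by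
      rw [Complex.norm_real]; exact le_abs_self _
    refine h1.trans ?_
    have := norm_sub_le Rt (Rt - (Real.sqrt Real.pi * H * resonatorForm r N : ℝ))
    rwa [sub_sub_cancel] at this
  have hS2 : 2 * Real.pi * ‖S‖ ≤ 2 * Real.pi * ∑ ρ ∈ hfin.toFinset, Real.exp (-(ρ.im - T) ^ 2 / H ^ 2) *
      ‖resonator r N ρ.im‖ ^ 2 / ‖deriv riemannZeta ρ‖ :=
    mul_le_mul_of_nonneg_left hsum (by positivity)
  linarith

end

/-! ### Mertens-type estimates for primes -/

section

open Filter Topology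

/-- The partial sums of `log p / p` over the primes up to `n`. -/
noncomputable def mertensSum (n : ℕ) : ℝ := ∑ p ∈ Finset.Ioc 0 n with p.Prime, Real.log p / p

lemma log_factorial_eq_sum (n : ℕ) : Real.log (n.factorial : ℝ) =
    ∑ p ∈ Finset.Ioc 0 n with p.Prime, (padicValNat p n.factorial : ℝ) * Real.log p := by
  rw [Real.log_nat_eq_sum_factorization, Finsupp.sum]
  have h : n.factorial.factorization.support ⊆ {p ∈ Finset.Ioc 0 n | p.Prime} := by
    intro p hp
    rw [Nat.support_factorization, Nat.mem_primeFactors] at hp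
    rw [Finset.mem_filter, Finset.mem_Ioc]
    exact ⟨⟨hp.1.pos, (Nat.Prime.dvd_factorial hp.1).mp hp.2.1⟩, hp.1⟩
  rw [Finset.sum_subset h (fun p _ hp => by rw [Finsupp.notMem_support_iff.mp hp]; simp)]
  refine Finset.sum_congr rfl fun p hp => ?_
  rw [Nat.factorization_def _ (Finset.mem_filter.mp hp).2]

/-- Since `v_p(n!) ≥ ⌊n/p⌋ > n/p - 1`, `n ∑ log p / p` is at most `log n! + θ(n)`. -/
lemma mertensSum_le {n : ℕ} (hn : n ≠ 0) : mertensSum n ≤ Real.log n + Real.log 4 := by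
  have hn0 : (0 : ℝ) < n := by positivity
  have hθ := Chebyshev.theta_le_log4_mul_x (x := n) (by positivity)
  rw [Chebyshev.theta, Nat.floor_natCast] at hθ
  have h1 : n * mertensSum n ≤ Real.log (n.factorial : ℝ) + ∑ p ∈ Finset.Ioc 0 n with p.Prime, Real.log p := by
    rw [log_factorial_eq_sum, mertensSum, Finset.mul_sum, ← Finset.sum_add_distrib]
    refine Finset.sum_le_sum fun p hp => ?_
    have hp' := (Finset.mem_filter.mp hp).2
    have : Fact p.Prime := ⟨hp'⟩
    have hp0 : (0 : ℝ) < p := by exact_mod_cast hp'.pos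
    have hlog : 0 ≤ Real.log p := Real.log_natCast_nonneg p
    have h2 : n / p ≤ padicValNat p n.factorial := by
      rw [padicValNat_factorial (b := Nat.log p n + 2) (by omega)]
      have := Finset.single_le_sum (f := fun i => n / p ^ i) (s := Finset.Ico 1 (Nat.log p n + 2))
        (fun _ _ => Nat.zero_le _) (show 1 ∈ _ by simp)
      simpa using this
    have h3 : (n : ℝ) / p ≤ padicValNat p n.factorial + 1 := by
      have h4 : (n : ℝ) / p < (n / p : ℕ) + 1 := by
        rw [← Nat.floor_div_eq_div (K := ℝ)]; exact Nat.lt_floor_add_one _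
      have h5 : ((n / p : ℕ) : ℝ) ≤ padicValNat p n.factorial := by exact_mod_cast h2
      linarith
    calc n * (Real.log p / p) = n / p * Real.log p := by ring
      _ ≤ (padicValNat p n.factorial + 1) * Real.log p := by gcongr
      _ = _ := by ring
  have h2 : Real.log (n.factorial : ℝ) ≤ n * Real.log n := by
    rw [← Real.log_pow]
    exact Real.log_le_log (by positivity) (by exact_mod_cast Nat.factorial_le_pow n)
  refine le_of_mul_le_mul_left (a := (n : ℝ)) ?_ hn0
  linarith

lemma log_div_mul_pred_le {m : ℕ} (hm : 2 ≤ m) :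
    Real.log m / (m * (m - 1)) ≤ 4 * ((m : ℝ) ^ (3 / 2 : ℝ))⁻¹ := by
  have hm2 : (2 : ℝ) ≤ m := by exact_mod_cast hm
  have hm0 : (0 : ℝ) < m := by linarith
  have h1 : Real.log m ≤ 2 * Real.sqrt m := by
    have h2 : Real.log m = 2 * Real.log (Real.sqrt m) := by rw [Real.log_sqrt hm0.le]; ring
    have := Real.log_le_sub_one_of_pos (Real.sqrt_pos.mpr hm0)
    linarith
  have hs : Real.sqrt m ^ 2 = m := Real.sq_sqrt hm0.le
  have h3 : (m : ℝ) ^ (3 / 2 : ℝ) = m * Real.sqrt m := by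
    rw [show (3 / 2 : ℝ) = 1 + 1 / 2 by norm_num, Real.rpow_add hm0, Real.rpow_one, Real.sqrt_eq_rpow]
  have hs0 : 0 < Real.sqrt m := Real.sqrt_pos.mpr hm0
  rw [h3, ← div_eq_mul_inv, div_le_div_iff₀ (by nlinarith) (by positivity)]
  calc Real.log m * (m * Real.sqrt m) ≤ 2 * Real.sqrt m * (m * Real.sqrt m) := by gcongr
    _ = 2 * m * Real.sqrt m ^ 2 := by ring
    _ = 2 * m * m := by rw [hs]
    _ ≤ 4 * (m * (m - 1)) := by nlinarith

/-- Here `v_p(n!) ≤ n/(p-1)`; the difference between `1/(p-1)` and `1/p` contributes a convergent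
sum, and Stirling bounds `log n!` from below. -/
lemma exists_log_le_mertensSum : ∃ C : ℝ, 0 ≤ C ∧ ∀ n : ℕ, n ≠ 0 → Real.log n - C ≤ mertensSum n := by
  have hsum : Summable fun m : ℕ => 4 * ((m : ℝ) ^ (3 / 2 : ℝ))⁻¹ :=
    (Real.summable_nat_rpow_inv.mpr (by norm_num)).mul_left 4
  have hpos : ∀ m : ℕ, 0 ≤ 4 * ((m : ℝ) ^ (3 / 2 : ℝ))⁻¹ := fun m => by positivity
  refine ⟨1 + ∑' m : ℕ, 4 * ((m : ℝ) ^ (3 / 2 : ℝ))⁻¹, add_nonneg zero_le_one (tsum_nonneg hpos), fun n hn => ?_⟩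
  have hn0 : (0 : ℝ) < n := by positivity
  have h1 : Real.log (n.factorial : ℝ) ≤ n * (mertensSum n + ∑' m : ℕ, 4 * ((m : ℝ) ^ (3 / 2 : ℝ))⁻¹) := by
    have h2 : Real.log (n.factorial : ℝ) ≤
        n * (mertensSum n + ∑ p ∈ Finset.Ioc 0 n with p.Prime, 4 * ((p : ℝ) ^ (3 / 2 : ℝ))⁻¹) := by
      rw [log_factorial_eq_sum, mertensSum, ← Finset.sum_add_distrib, Finset.mul_sum]
      refine Finset.sum_le_sum fun p hp => ?_
      have hp' := (Finset.mem_filter.mp hp).2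
      have : Fact p.Prime := ⟨hp'⟩
      have hp2 : (2 : ℝ) ≤ p := by exact_mod_cast hp'.two_le
      have hlog : 0 ≤ Real.log p := Real.log_natCast_nonneg p
      have h3 : (padicValNat p n.factorial : ℝ) ≤ n / (p - 1) := by
        rw [le_div_iff₀ (by linarith)]
        have h4 := (sub_one_mul_padicValNat_factorial_lt_of_ne_zero p hn).le
        have h5 : (((p - 1) * padicValNat p n.factorial : ℕ) : ℝ) ≤ n := by exact_mod_cast h4
        rw [Nat.cast_mul, Nat.cast_sub hp'.one_le, Nat.cast_one] at h5
        linarith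
      have h6 := log_div_mul_pred_le hp'.two_le
      calc _ ≤ n / (p - 1) * Real.log p := by gcongr
        _ = n * (Real.log p / p + Real.log p / (p * (p - 1))) := by
            have : (p : ℝ) - 1 ≠ 0 := by linarith
            field_simp
            ring
        _ ≤ _ := by gcongr
    refine h2.trans ?_
    gcongr
    exact hsum.sum_le_tsum _ (fun m _ => hpos m)
  have h2 := Stirling.le_log_factorial_stirling hn
  have h3 : 0 ≤ Real.log n := Real.log_natCast_nonneg n
  have h4 : 0 ≤ Real.log (2 * Real.pi) := Real.log_nonneg (by linarith [Real.pi_gt_three])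
  refine le_of_mul_le_mul_left (a := (n : ℝ)) ?_ hn0
  linarith

/-- The primes `p` with `u < log p ≤ v`. -/
noncomputable def primesBetween (u v : ℝ) : Finset ℕ := {p ∈ Finset.Ioc ⌊Real.exp u⌋₊ ⌊Real.exp v⌋₊ | p.Prime}

lemma mem_primesBetween {u v : ℝ} {p : ℕ} : p ∈ primesBetween u v ↔ p.Prime ∧ u < Real.log p ∧ Real.log p ≤ v := by
  rw [primesBetween, Finset.mem_filter, Finset.mem_Ioc]
  constructor
  · rintro ⟨⟨h1, h2⟩, hp⟩
    have hp0 : (0 : ℝ) < p := by exact_mod_cast hp.pos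
    exact ⟨hp, (Real.lt_log_iff_exp_lt hp0).mpr (Nat.lt_of_floor_lt h1),
      (Real.log_le_iff_le_exp hp0).mpr ((Nat.le_floor_iff (Real.exp_pos v).le).mp h2)⟩
  · rintro ⟨hp, h1, h2⟩
    have hp0 : (0 : ℝ) < p := by exact_mod_cast hp.pos
    exact ⟨⟨(Nat.floor_lt (Real.exp_pos u).le).mpr ((Real.lt_log_iff_exp_lt hp0).mp h1),
      Nat.le_floor ((Real.log_le_iff_le_exp hp0).mp h2)⟩, hp⟩

lemma sum_primesBetween_add (F : ℕ → ℝ) {u v w : ℝ} (huv : u ≤ v) (hvw : v ≤ w) :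
    ∑ p ∈ primesBetween u w, F p = ∑ p ∈ primesBetween u v, F p + ∑ p ∈ primesBetween v w, F p := by
  rw [← Finset.sum_union]
  · congr 1
    ext p
    simp only [Finset.mem_union, mem_primesBetween]
    constructor
    · rintro ⟨h1, h2, h3⟩
      rcases le_or_gt (Real.log p) v with h | h
      · exact Or.inl ⟨h1, h2, h⟩
      · exact Or.inr ⟨h1, h, h3⟩
    · rintro (⟨h1, h2, h3⟩ | ⟨h1, h2, h3⟩)
      · exact ⟨h1, h2, h3.trans hvw⟩
      · exact ⟨h1, huv.trans_lt h2, h3⟩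
  · rw [Finset.disjoint_left]
    intro p h1 h2
    rw [mem_primesBetween] at h1 h2
    linarith [h1.2.2, h2.2.1]

lemma exists_le_sum_primesBetween_log_div : ∃ C : ℝ, 0 ≤ C ∧ ∀ u v : ℝ, 0 ≤ u → u ≤ v →
    v - u - C ≤ ∑ p ∈ primesBetween u v, Real.log p / p := by
  obtain ⟨C, hC0, hC⟩ := exists_log_le_mertensSum
  refine ⟨C + Real.log 2 + Real.log 4, by positivity, fun u v hu huv => ?_⟩
  have hfl : ⌊Real.exp u⌋₊ ≤ ⌊Real.exp v⌋₊ := Nat.floor_le_floor (Real.exp_le_exp.mpr huv)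
  have h1u : 1 ≤ ⌊Real.exp u⌋₊ := Nat.le_floor (by simpa using Real.one_le_exp hu)
  have hsplit : mertensSum ⌊Real.exp v⌋₊ = mertensSum ⌊Real.exp u⌋₊ + ∑ p ∈ primesBetween u v, Real.log p / p := by
    rw [mertensSum, mertensSum, primesBetween, Finset.sum_filter, Finset.sum_filter, Finset.sum_filter,
      Finset.sum_Ioc_consecutive _ (Nat.zero_le _) hfl]
  have h1 := mertensSum_le (n := ⌊Real.exp u⌋₊) (by omega)
  have h2 := hC ⌊Real.exp v⌋₊ (by omega)
  have h3 : Real.log ⌊Real.exp u⌋₊ ≤ u := by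
    rw [Real.log_le_iff_le_exp (by exact_mod_cast h1u)]
    exact Nat.floor_le (Real.exp_pos u).le
  have h4 : v ≤ Real.log 2 + Real.log ⌊Real.exp v⌋₊ := by
    have h5 : (1 : ℝ) ≤ ⌊Real.exp v⌋₊ := by exact_mod_cast h1u.trans hfl
    rw [← Real.log_mul (by norm_num) (by linarith), Real.le_log_iff_exp_le (by linarith)]
    linarith [Nat.lt_floor_add_one (Real.exp v)]
  linarith

/-- The sum of `1 / (p log p)` over the primes with `u < log p ≤ v`. -/
noncomputable def invLogSum (u v : ℝ) : ℝ := ∑ p ∈ primesBetween u v, 1 / (p * Real.log p)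

/-- The heuristic value is `∫_u^{Bu} dv/v² = (1 - 1/B)/u`. It is reached by cutting into blocks `(w,
qw]` with `q` near 1, where `log p` is nearly constant. The number `K` of blocks is fixed, so the
bounded Mertens error of each adds up to `CK/u²`, which is `o(1/u)`. -/
lemma exists_le_invLogSum {ε : ℝ} (hε : 0 < ε) : ∃ B : ℝ, 1 ≤ B ∧ ∀ᶠ u : ℝ in atTop,
    (1 - ε) / u ≤ invLogSum u (B * u) := by
  obtain ⟨C, hC0, hC⟩ := exists_le_sum_primesBetween_log_div
  set q : ℝ := 1 + ε / 2 with hq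
  have hq1 : 1 < q := by linarith
  have hq0 : 0 < q := by linarith
  have hblock : ∀ w : ℝ, 0 < w → ((q - 1) * w - C) / (q * w) ^ 2 ≤ invLogSum w (q * w) := by
    intro w hw
    have h1 := hC w (q * w) hw.le (by nlinarith)
    rw [div_le_iff₀ (by positivity), invLogSum, Finset.sum_mul]
    refine le_trans (le_trans (by linarith) h1) (Finset.sum_le_sum fun p hp => ?_)
    obtain ⟨hp, hw1, hw2⟩ := mem_primesBetween.mp hp
    have hp0 : (0 : ℝ) < p := by exact_mod_cast hp.pos
    have hl0 : 0 < Real.log p := hw.trans hw1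
    rw [div_mul_eq_mul_div, one_mul, div_le_div_iff₀ hp0 (by positivity)]
    calc Real.log p * (p * Real.log p) = p * Real.log p ^ 2 := by ring
      _ ≤ p * (q * w) ^ 2 := by gcongr
      _ = _ := by ring
  have hiter : ∀ K : ℕ, ∀ u : ℝ, 1 ≤ u →
      (1 - (q⁻¹) ^ K) / (q * u) - C * K / u ^ 2 ≤ invLogSum u (q ^ K * u) := by
    intro K
    induction K with
    | zero => 
      intro u hu
      have : 0 ≤ invLogSum u (q ^ 0 * u) := Finset.sum_nonneg fun p hp => by
        have := Real.log_natCast_nonneg p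
        positivity
      simpa using this
    | succ K ih =>
      intro u hu
      have hqK : 1 ≤ q ^ K := one_le_pow₀ hq1.le
      have h1 := ih u hu
      have h2 := hblock (q ^ K * u) (by positivity)
      have h3 : invLogSum u (q ^ (K + 1) * u) = invLogSum u (q ^ K * u) + invLogSum (q ^ K * u) (q * (q ^ K * u)) := by
        rw [show q ^ (K + 1) * u = q * (q ^ K * u) by ring]
        exact sum_primesBetween_add _ (by nlinarith) (by nlinarith [mul_pos (by positivity : 0 < q ^ K) (by linarith : 0 < u)])
      rw [h3]
      have h4 : ((q - 1) * (q ^ K * u) - C) / (q * (q ^ K * u)) ^ 2 =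
          (q - 1) * (q⁻¹) ^ (K + 1) / (q * u) - C / (q * (q ^ K * u)) ^ 2 := by
        rw [inv_pow]
        field_simp
        ring
      have h5 : C / (q * (q ^ K * u)) ^ 2 ≤ C / u ^ 2 := by
        gcongr
        nlinarith [mul_pos hq0 (by linarith : 0 < u), mul_le_mul_of_nonneg_right hqK (by linarith : 0 ≤ u)]
      have h6 : (1 - (q⁻¹) ^ (K + 1)) / (q * u) = (1 - (q⁻¹) ^ K) / (q * u) + (q - 1) * (q⁻¹) ^ (K + 1) / (q * u) := by
        rw [← add_div, pow_succ]
        congr 1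
        field_simp
        ring
      have h7 : C * (K + 1 : ℕ) / u ^ 2 = C * K / u ^ 2 + C / u ^ 2 := by push_cast; ring
      rw [h6, h7]
      linarith
  obtain ⟨K, hK⟩ := exists_pow_lt_of_lt_one (show 0 < ε / 4 by positivity) (inv_lt_one_of_one_lt₀ hq1)
  refine ⟨q ^ K, one_le_pow₀ hq1.le, ?_⟩
  filter_upwards [eventually_ge_atTop (1 : ℝ), eventually_ge_atTop (C * K / (ε / 4))] with u hu hu2
  have hu0 : 0 < u := by linarith
  refine le_trans ?_ (hiter K u hu)
  have h1 : C * K / u ^ 2 ≤ ε / 4 / u := by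
    rw [div_le_iff₀ (by positivity)] at hu2
    rw [div_le_div_iff₀ (by positivity) hu0]
    nlinarith
  have h2 : (1 - 3 * ε / 4) / u ≤ (1 - (q⁻¹) ^ K) / (q * u) := by
    rw [div_le_div_iff₀ hu0 (by positivity), mul_comm q u, ← mul_assoc, mul_right_comm]
    gcongr
    calc (1 - 3 * ε / 4) * q ≤ 1 - ε / 4 := by rw [hq]; nlinarith [sq_nonneg ε]
      _ ≤ _ := by linarith
  have h3 : (1 - ε) / u = (1 - 3 * ε / 4) / u - ε / 4 / u := by ring
  linarith

end

/-! ### Multiplicative resonator coefficients and Rankin's trick -/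

section

open ArithmeticFunction ArithmeticFunction.Moebius

/-- The coefficients `μ(n) ∏_{p ∣ n} f(p)`, supported on products of primes in `P`. -/
noncomputable def moebiusWeight (P : Finset ℕ) (f : ℕ → ℝ) (n : ℕ) : ℝ :=
  if n.primeFactors ⊆ P then (μ n : ℝ) * ∏ p ∈ n.primeFactors, f p else 0

section
variable {P : Finset ℕ} {f : ℕ → ℝ}

lemma moebiusWeight_one : moebiusWeight P f 1 = 1 := by simp [moebiusWeight]

lemma abs_moebiusWeight_le (hf0 : ∀ p ∈ P, 0 ≤ f p) (hf1 : ∀ p ∈ P, f p ≤ 1) (n : ℕ) : |moebiusWeight P f n| ≤ 1 := by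
  unfold moebiusWeight
  split_ifs with h
  · rw [abs_mul, abs_of_nonneg (Finset.prod_nonneg fun p hp => hf0 p (h hp))]
    have h1 : |(μ n : ℝ)| ≤ 1 := by exact_mod_cast abs_moebius_le_one
    exact mul_le_one₀ h1 (Finset.prod_nonneg fun p hp => hf0 p (h hp))
      (Finset.prod_le_one (fun p hp => hf0 p (h hp)) fun p hp => hf1 p (h hp))
  · simp

lemma squarefree_prod_primes {A : Finset ℕ} (hA : ∀ p ∈ A, p.Prime) : Squarefree (∏ p ∈ A, p) := by
  refine Finset.squarefree_prod_of_pairwise_isCoprime (fun p hp q hq hpq => ?_) fun p hp => (hA p hp).squarefree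
  exact Nat.coprime_iff_isRelPrime.mp ((Nat.coprime_primes (hA p hp) (hA q hq)).mpr hpq)

lemma moebiusWeight_prod (hP : ∀ p ∈ P, p.Prime) {A : Finset ℕ} (hA : A ⊆ P) :
    moebiusWeight P f (∏ p ∈ A, p) = (μ (∏ p ∈ A, p) : ℝ) * ∏ p ∈ A, f p := by
  rw [moebiusWeight, Nat.primeFactors_prod fun p hp => hP p (hA hp), if_pos hA]

/-- A squarefree `n` is determined by its set of prime factors, so the sum is part of the expanded
product. -/
lemma sum_moebiusWeight_sq_le (N : ℕ) :
    ∑ n ∈ Finset.Icc 1 N, moebiusWeight P f n ^ 2 ≤ ∏ p ∈ P, (1 + f p ^ 2) := by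
  rw [Finset.prod_one_add]
  have hinj : Set.InjOn (fun n : ℕ => n.primeFactors)
      ({n ∈ Finset.Icc 1 N | Squarefree n ∧ n.primeFactors ⊆ P} : Finset ℕ) := by
    intro a ha b hb hab
    have ha' := (Finset.mem_filter.mp ha).2.1
    have hb' := (Finset.mem_filter.mp hb).2.1
    have hab' : a.primeFactors = b.primeFactors := hab
    rw [← Nat.prod_primeFactors_of_squarefree ha', hab', Nat.prod_primeFactors_of_squarefree hb']
  calc ∑ n ∈ Finset.Icc 1 N, moebiusWeight P f n ^ 2
      = ∑ n ∈ Finset.Icc 1 N with Squarefree n ∧ n.primeFactors ⊆ P, moebiusWeight P f n ^ 2 := by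
        refine (Finset.sum_filter_of_ne fun n _ hn => ?_).symm
        unfold moebiusWeight at hn
        refine ⟨moebius_ne_zero_iff_squarefree.mp fun h => hn (by simp [h]), ?_⟩
        by_contra h
        exact hn (by simp [h])
    _ = ∑ n ∈ Finset.Icc 1 N with Squarefree n ∧ n.primeFactors ⊆ P, ∏ p ∈ n.primeFactors, f p ^ 2 := by
        refine Finset.sum_congr rfl fun n hn => ?_
        obtain ⟨-, h1, h2⟩ := Finset.mem_filter.mp hn
        have h3 : (μ n : ℝ) ^ 2 = 1 := by exact_mod_cast moebius_sq_eq_one_of_squarefree h1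
        rw [moebiusWeight, if_pos h2, mul_pow, h3, one_mul, Finset.prod_pow]
    _ = ∑ A ∈ ({n ∈ Finset.Icc 1 N | Squarefree n ∧ n.primeFactors ⊆ P}).image (fun n : ℕ => n.primeFactors),
          ∏ p ∈ A, f p ^ 2 := (Finset.sum_image (f := fun A : Finset ℕ => ∏ p ∈ A, f p ^ 2) hinj).symm
    _ ≤ _ := by
        refine Finset.sum_le_sum_of_subset_of_nonneg ?_ fun A _ _ => Finset.prod_nonneg fun p _ => sq_nonneg _
        intro A hA
        obtain ⟨n, hn, rfl⟩ := Finset.mem_image.mp hA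
        exact Finset.mem_powerset.mpr (Finset.mem_filter.mp hn).2.2

/-- For squarefree `hn` the signs are `μ(n) μ(h) μ(hn) = (μ(n) μ(h))² = 1`. This is why the
resonator carries a Möbius factor, and it allows terms of the form to be discarded. -/
lemma moebius_mul_moebiusWeight_nonneg (hf0 : ∀ p ∈ P, 0 ≤ f p) (n h : ℕ) :
    0 ≤ (μ n : ℝ) / Real.sqrt n * (moebiusWeight P f h * moebiusWeight P f (h * n)) := by
  unfold moebiusWeight
  split_ifs with h1 h2
  · by_cases hsq : Squarefree (h * n)
    · have hcop := Nat.coprime_of_squarefree_mul hsq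
      rw [isMultiplicative_moebius.map_mul_of_coprime hcop]
      have e1 : 0 ≤ ∏ p ∈ h.primeFactors, f p := Finset.prod_nonneg fun p hp => hf0 p (h1 hp)
      have e2 : 0 ≤ ∏ p ∈ (h * n).primeFactors, f p := Finset.prod_nonneg fun p hp => hf0 p (h2 hp)
      have : (μ n : ℝ) / Real.sqrt n * ((μ h : ℝ) * (∏ p ∈ h.primeFactors, f p) *
          (((μ h * μ n : ℤ) : ℝ) * ∏ p ∈ (h * n).primeFactors, f p)) =
          (μ n : ℝ) ^ 2 * (μ h : ℝ) ^ 2 / Real.sqrt n * ((∏ p ∈ h.primeFactors, f p) *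
            ∏ p ∈ (h * n).primeFactors, f p) := by push_cast; ring
      rw [this]
      positivity
    · rw [moebius_eq_zero_of_not_squarefree hsq]; simp
  all_goals simp

lemma sum_prod_le_resonatorForm (hP : ∀ p ∈ P, p.Prime) (hf0 : ∀ p ∈ P, 0 ≤ f p) (N : ℕ) :
    ∑ A ∈ P.powerset with ∏ p ∈ A, p ≤ N, ∏ p ∈ A, (f p ^ 2 + f p / Real.sqrt p) ≤
      resonatorForm (moebiusWeight P f) N := by
  classical
  set Q : Finset (Finset ℕ) := {A ∈ P.powerset | ∏ p ∈ A, p ≤ N} with hQ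
  set G : ℕ × ℕ → ℝ := fun x => if x.2 * x.1 ≤ N then
    (μ x.1 : ℝ) / Real.sqrt x.1 * (moebiusWeight P f x.2 * moebiusWeight P f (x.2 * x.1)) else 0 with hG
  have hform : resonatorForm (moebiusWeight P f) N = ∑ x ∈ Finset.Icc 1 N ×ˢ Finset.Icc 1 N, G x := by
    rw [resonatorForm, Finset.sum_product]
    refine Finset.sum_congr rfl fun n hn => Finset.sum_congr rfl fun h hh => ?_
    rw [Finset.mem_Icc] at hn hh
    rw [← Finset.sum_filter]
    simp only [hG]
    have hpos : 1 ≤ h * n := Nat.mul_pos hh.1 hn.1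
    split_ifs with hle
    · rw [Finset.filter_eq' , if_pos (Finset.mem_Icc.mpr ⟨hpos, hle⟩), Finset.sum_singleton]
    · rw [Finset.filter_eq', if_neg (fun h => hle (Finset.mem_Icc.mp h).2), Finset.sum_empty]
  -- A choice of `D ⊆ A` from expanding `∏_{p ∈ A} (f² + f/√p)` corresponds to `h = ∏ D`, `n = ∏ (A
  -- \ D)`: a prime of `h` divides both `h` and `k = hn` and gives `f²`, while a prime of `n`
  -- divides only `k` and gives `f/√p`.
  set e : (Σ _ : Finset ℕ, Finset ℕ) → ℕ × ℕ := fun x => (∏ p ∈ x.1 \ x.2, p, ∏ p ∈ x.2, p) with he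
  have hsub : ∀ {x : Σ _ : Finset ℕ, Finset ℕ}, x ∈ Q.sigma (fun A => A.powerset) →
      x.1 ⊆ P ∧ x.2 ⊆ x.1 ∧ ∏ p ∈ x.1, p ≤ N := by
    intro x hx
    rw [Finset.mem_sigma, hQ, Finset.mem_filter, Finset.mem_powerset, Finset.mem_powerset] at hx
    exact ⟨hx.1.1, hx.2, hx.1.2⟩
  have hprodpos : ∀ {A : Finset ℕ}, A ⊆ P → 1 ≤ ∏ p ∈ A, p := fun hA =>
    Nat.one_le_iff_ne_zero.mpr (Finset.prod_ne_zero_iff.mpr fun p hp => (hP p (hA hp)).ne_zero)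
  have hmul : ∀ {x : Σ _ : Finset ℕ, Finset ℕ}, x.2 ⊆ x.1 → (∏ p ∈ x.2, p) * ∏ p ∈ x.1 \ x.2, p = ∏ p ∈ x.1, p :=
    fun h => by rw [mul_comm]; exact Finset.prod_sdiff h
  have hinj : Set.InjOn e (Q.sigma (fun A => A.powerset) : Finset _) := by
    rintro ⟨A, D⟩ hx ⟨A', D'⟩ hy hxy
    obtain ⟨a1, a2, -⟩ := hsub (Finset.mem_coe.mp hx)
    obtain ⟨b1, b2, -⟩ := hsub (Finset.mem_coe.mp hy)
    simp only at a1 a2 b1 b2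
    simp only [he, Prod.mk.injEq] at hxy
    have h2 : D = D' := by
      rw [← Nat.primeFactors_prod fun p hp => hP p (a1 (a2 hp)), hxy.2,
        Nat.primeFactors_prod fun p hp => hP p (b1 (b2 hp))]
    have h1 : A \ D = A' \ D' := by
      rw [← Nat.primeFactors_prod fun p hp => hP p (a1 (Finset.sdiff_subset hp)), hxy.1,
        Nat.primeFactors_prod fun p hp => hP p (b1 (Finset.sdiff_subset hp))]
    have h3 : A = A' := by
      rw [← Finset.sdiff_union_of_subset a2, h1, h2, Finset.sdiff_union_of_subset b2]
    subst h2 h3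
    rfl
  rw [hform]
  calc _ = ∑ x ∈ Q.sigma (fun A => A.powerset), (∏ p ∈ x.2, f p ^ 2) * ∏ p ∈ x.1 \ x.2, (f p / Real.sqrt p) := by
        rw [Finset.sum_sigma]
        exact Finset.sum_congr rfl fun A _ => Finset.prod_add _ _ _
    _ = ∑ x ∈ Q.sigma (fun A => A.powerset), G (e x) := by
        refine Finset.sum_congr rfl fun x hx => ?_
        obtain ⟨h1, h2, h3⟩ := hsub hx
        have hm := hmul h2
        have hs1 : ∀ p ∈ x.1, p.Prime := fun p hp => hP p (h1 hp)
        have hsq := squarefree_prod_primes hs1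
        have hcop : Nat.Coprime (∏ p ∈ x.2, p) (∏ p ∈ x.1 \ x.2, p) :=
          Nat.coprime_of_squarefree_mul (by rw [hm]; exact hsq)
        have hsqa : (μ (∏ p ∈ x.2, p) : ℝ) ^ 2 = 1 := by
          exact_mod_cast moebius_sq_eq_one_of_squarefree (squarefree_prod_primes fun p hp => hs1 p (h2 hp))
        have hsqb : (μ (∏ p ∈ x.1 \ x.2, p) : ℝ) ^ 2 = 1 := by
          exact_mod_cast moebius_sq_eq_one_of_squarefree
            (squarefree_prod_primes fun p hp => hs1 p (Finset.sdiff_subset hp))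
        have hmu : (μ (∏ p ∈ x.1, p) : ℝ) = μ (∏ p ∈ x.2, p) * μ (∏ p ∈ x.1 \ x.2, p) := by
          rw [← hm, isMultiplicative_moebius.map_mul_of_coprime hcop]; push_cast; rfl
        have hsqrt : Real.sqrt ((∏ p ∈ x.1 \ x.2, p : ℕ) : ℝ) = ∏ p ∈ x.1 \ x.2, Real.sqrt p := by
          rw [Nat.cast_prod, Real.sqrt_prod _ fun p _ => Nat.cast_nonneg p]
        simp only [hG, he]
        rw [hm, if_pos h3, moebiusWeight_prod hP (h2.trans h1), moebiusWeight_prod hP h1, hmu, hsqrt,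
          Finset.prod_div_distrib, ← Finset.prod_sdiff (f := f) h2, Finset.prod_pow]
        generalize (μ (∏ p ∈ x.2, p) : ℝ) = ma at hsqa ⊢
        generalize (μ (∏ p ∈ x.1 \ x.2, p) : ℝ) = mb at hsqb ⊢
        generalize (∏ p ∈ x.2, f p) = fa
        generalize (∏ p ∈ x.1 \ x.2, f p) = fb
        generalize (∏ p ∈ x.1 \ x.2, Real.sqrt (p : ℝ)) = sb
        calc fa ^ 2 * (fb / sb) = 1 * 1 * (fa ^ 2 * (fb / sb)) := by ring
          _ = ma ^ 2 * mb ^ 2 * (fa ^ 2 * (fb / sb)) := by rw [hsqa, hsqb]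
          _ = _ := by ring
    _ = ∑ y ∈ (Q.sigma (fun A => A.powerset)).image e, G y := (Finset.sum_image hinj).symm
    _ ≤ _ := by
        refine Finset.sum_le_sum_of_subset_of_nonneg ?_ fun x _ _ => ?_
        · intro y hy
          obtain ⟨x, hx, rfl⟩ := Finset.mem_image.mp hy
          obtain ⟨h1, h2, h3⟩ := hsub hx
          have hm := hmul h2
          have p1 := hprodpos (h2.trans h1)
          have p2 := hprodpos (A := x.1 \ x.2) (Finset.sdiff_subset.trans h1)
          rw [Finset.mem_product, Finset.mem_Icc, Finset.mem_Icc]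
          refine ⟨⟨p2, ?_⟩, ⟨p1, ?_⟩⟩
          · exact (Nat.le_mul_of_pos_left _ p1).trans (hm.le.trans h3)
          · exact (Nat.le_mul_of_pos_right _ p2).trans (hm.le.trans h3)
        · simp only [hG]
          split_ifs
          · exact moebius_mul_moebiusWeight_nonneg hf0 _ _
          · exact le_rfl

/-- Rankin's trick: a set with `∏ A > N` is weighted by `(∏ A / N)^α ≥ 1`. -/
lemma prod_one_add_sub_le_sum_prod {w : ℕ → ℝ} (hP : ∀ p ∈ P, p.Prime) (hw : ∀ p ∈ P, 0 ≤ w p) {N : ℕ} (hN : 1 ≤ N)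
    {α : ℝ} (hα : 0 ≤ α) :
    ∏ p ∈ P, (1 + w p) - Real.exp (-(α * Real.log N)) * ∏ p ∈ P, (1 + w p * Real.exp (α * Real.log p)) ≤
      ∑ A ∈ P.powerset with ∏ p ∈ A, p ≤ N, ∏ p ∈ A, w p := by
  rw [Finset.prod_one_add, Finset.prod_one_add, ← Finset.sum_filter_add_sum_filter_not P.powerset (fun A => ∏ p ∈ A, p ≤ N)]
  have h : ∑ A ∈ P.powerset with ¬ ∏ p ∈ A, p ≤ N, ∏ p ∈ A, w p ≤
      Real.exp (-(α * Real.log N)) * ∑ A ∈ P.powerset, ∏ p ∈ A, (w p * Real.exp (α * Real.log p)) := by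
    rw [Finset.mul_sum]
    refine le_trans (Finset.sum_le_sum fun A hA => ?_) (Finset.sum_le_sum_of_subset_of_nonneg
      (Finset.filter_subset _ _) fun A hA _ => mul_nonneg (Real.exp_pos _).le (Finset.prod_nonneg fun p hp =>
        mul_nonneg (hw p (Finset.mem_powerset.mp hA hp)) (Real.exp_pos _).le))
    rw [Finset.mem_filter, Finset.mem_powerset, not_le] at hA
    rw [Finset.prod_mul_distrib, ← Real.exp_sum, ← Finset.mul_sum, mul_left_comm, ← Real.exp_add]
    refine le_mul_of_one_le_right (Finset.prod_nonneg fun p hp => hw p (hA.1 hp)) (Real.one_le_exp ?_)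
    have hlog : Real.log N ≤ ∑ p ∈ A, Real.log p := by
      rw [← Real.log_prod fun p hp => by exact_mod_cast (hP p (hA.1 hp)).ne_zero]
      refine Real.log_le_log (by exact_mod_cast hN) ?_
      rw [← Nat.cast_prod]
      exact_mod_cast hA.2.le
    nlinarith
  linarith

end

end

/-! ### Choice of the resonator -/

section

open Filter Topology

/-- Used with `s = f²` and `t = f/√p`: the gain per prime of the form over `∑ r²` is nearly
`exp(f/√p)`. -/
lemma exp_le_one_add_add_of_le {ε s t : ℝ} (hε0 : 0 < ε) (hε1 : ε ≤ 1) (hs0 : 0 ≤ s) (hs : s ≤ ε) (ht0 : 0 ≤ t)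
    (ht : t ≤ ε) : Real.exp ((1 - 2 * ε) * t) * (1 + s) ≤ 1 + (s + t) := by
  set x := (1 - ε) * t with hx
  have hx0 : 0 ≤ x := mul_nonneg (by linarith) ht0
  have hxe : x ≤ ε := by nlinarith
  have h1 : Real.exp (x - x ^ 2) ≤ 1 + x := by
    rw [← Real.le_log_iff_exp_le (by linarith)]
    refine le_trans ?_ (Real.one_sub_inv_le_log_of_pos (by linarith))
    have : 1 - (1 + x)⁻¹ = x / (1 + x) := by field_simp; ring
    rw [this, le_div_iff₀ (by linarith)]
    nlinarith [pow_nonneg hx0 3]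
  have h2 : (1 - 2 * ε) * t ≤ x - x ^ 2 := by
    have : x * (1 - ε) ≤ x * (1 - x) := by gcongr
    have : 0 ≤ ε ^ 2 * t := by positivity
    nlinarith
  calc _ ≤ (1 + x) * (1 + s) := by gcongr; exact (Real.exp_le_exp.mpr h2).trans h1
    _ ≤ 1 + (s + t) := by
      have : (1 - ε) * (1 + s) ≤ 1 := by nlinarith
      have := mul_le_mul_of_nonneg_left this ht0
      rw [hx]
      linarith

lemma one_add_mul_exp_le {w x κ : ℝ} (hw : 0 ≤ w) (hx : 0 ≤ x) (hκ : Real.exp x ≤ κ) :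
    1 + w * Real.exp x ≤ (1 + w) * Real.exp (w * (x * κ)) := by
  have h1 : Real.exp x - 1 ≤ x * κ := by
    have h2 : 1 - x ≤ Real.exp (-x) := by linarith [Real.add_one_le_exp (-x)]
    have h3 : Real.exp x * Real.exp (-x) = 1 := by rw [← Real.exp_add]; simp
    have := mul_le_mul_of_nonneg_left h2 (Real.exp_pos x).le
    have := mul_le_mul_of_nonneg_left hκ hx
    linarith
  have h2 : 1 + w * (x * κ) ≤ Real.exp (w * (x * κ)) := by linarith [Real.add_one_le_exp (w * (x * κ))]
  have h3 : 0 ≤ x * κ := mul_nonneg hx ((Real.exp_pos x).le.trans hκ)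
  calc 1 + w * Real.exp x ≤ (1 + w) * (1 + w * (x * κ)) := by
        have := mul_le_mul_of_nonneg_left h1 hw
        have : 0 ≤ w * (w * (x * κ)) := by positivity
        nlinarith
    _ ≤ _ := by gcongr

lemma sum_primesBetween_one_div_le {u v : ℝ} (hv : 0 ≤ v) :
    ∑ p ∈ primesBetween u v, 1 / (p : ℝ) ≤ 1 + v := by
  have h1 : ∑ p ∈ primesBetween u v, 1 / (p : ℝ) ≤ ∑ p ∈ Finset.Icc 1 ⌊Real.exp v⌋₊, 1 / (p : ℝ) := by
    refine Finset.sum_le_sum_of_subset_of_nonneg (fun p hp => ?_) fun _ _ _ => by positivity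
    rw [primesBetween, Finset.mem_filter, Finset.mem_Ioc] at hp
    exact Finset.mem_Icc.mpr ⟨hp.2.one_le, hp.1.2⟩
  have h2 := harmonic_floor_le_one_add_log (Real.exp v) (Real.one_le_exp hv)
  rw [harmonic_eq_sum_Icc, Real.log_exp] at h2
  push_cast at h2
  simp only [one_div] at h1 ⊢
  exact h1.trans h2

set_option maxHeartbeats 1000000 in
-- The primes used are those in `(log N, (log N)^B]`, with `f(p) = lam/(√p log p)`. Without
-- truncation at `N` the ratio is about `exp(∑ f/√p) = exp(lam · S)`; truncation is harmless while
-- `∑ w(p) log p` stays below `log N`. As `∑ f² log p = lam² S`, this fixes `lam`, and then `lam ·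
-- S` is about `√(log N / log log N)`.
lemma exp_mul_sum_le_resonatorForm {ε B u : ℝ} {N : ℕ} (hε0 : 0 < ε) (hε : ε ≤ 1 / 6) (hB : 1 ≤ B) (hN : 1 ≤ N)
    (hu : Real.log N = Real.exp u) (hS : (1 - ε) / u ≤ invLogSum u (B * u)) (h1 : 1 ≤ ε ^ 2 * u)
    (h2 : Real.sqrt (Real.exp u * u) * (1 + B * u) ≤ ε ^ 2 / 2 * Real.exp u)
    (h3 : Real.log 2 ≤ Real.log (1 + ε) / B / u * Real.exp u * (ε ^ 2 / 4))
    (h4 : Real.log 2 ≤ 3 * ε * Real.sqrt (Real.exp u / u)) :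
    ∃ r : ℕ → ℝ, (∀ n, |r n| ≤ 1) ∧ r 1 = 1 ∧
      Real.exp ((1 - 6 * ε) * Real.sqrt (Real.exp u / u)) * ∑ n ∈ Finset.Icc 1 N, r n ^ 2 ≤ resonatorForm r N := by
  have hu0 : 0 < u := by
    by_contra h
    have : ε ^ 2 * u ≤ 0 := mul_nonpos_of_nonneg_of_nonpos (by positivity) (not_lt.mp h)
    linarith
  set ℓ := Real.exp u with hl
  have hl0 : 0 < ℓ := Real.exp_pos u
  set S := invLogSum u (B * u) with hSdef
  have hS0 : 0 < S := lt_of_lt_of_le (div_pos (by linarith) hu0) hS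
  -- Makes `∑ f² log p = (1 - ε) log N`, leaving a margin `ε` for the truncation.
  set lam := Real.sqrt ((1 - ε) * ℓ / S) with hlam
  have hlamsq : lam ^ 2 = (1 - ε) * ℓ / S := Real.sq_sqrt (div_nonneg (mul_nonneg (by linarith) hl0.le) hS0.le)
  have hlam0 : 0 ≤ lam := Real.sqrt_nonneg _
  have hlamle : lam ^ 2 ≤ ℓ * u := by
    rw [hlamsq, div_le_iff₀ hS0]
    rw [div_le_iff₀ hu0] at hS
    have := mul_le_mul_of_nonneg_left hS hl0.le
    linarith
  set P := primesBetween u (B * u) with hP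
  set f : ℕ → ℝ := fun p => lam / (Real.sqrt p * Real.log p) with hf
  have hmem : ∀ p ∈ P, p.Prime ∧ u < Real.log p ∧ Real.log p ≤ B * u := fun p hp => mem_primesBetween.mp hp
  have hprime : ∀ p ∈ P, p.Prime := fun p hp => (hmem p hp).1
  have hpl : ∀ p ∈ P, ℓ ≤ p := fun p hp => by
    obtain ⟨h, h', -⟩ := hmem p hp
    exact ((Real.lt_log_iff_exp_lt (by exact_mod_cast h.pos)).mp h').le
  have hp1 : ∀ p ∈ P, (1 : ℝ) ≤ p := fun p hp => by exact_mod_cast (hprime p hp).one_le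
  have hlog0 : ∀ p ∈ P, 0 < Real.log p := fun p hp => hu0.trans (hmem p hp).2.1
  have hf0 : ∀ p ∈ P, 0 ≤ f p := fun p hp => by
    have := hlog0 p hp
    simp only [hf]; positivity
  have hfsq : ∀ p ∈ P, f p ^ 2 = lam ^ 2 / (p * Real.log p ^ 2) := fun p hp => by
    simp only [hf]
    rw [div_pow, mul_pow, Real.sq_sqrt (Nat.cast_nonneg p)]
  have hfε : ∀ p ∈ P, f p ≤ ε := fun p hp => by
    refine (pow_le_pow_iff_left₀ (hf0 p hp) hε0.le two_ne_zero).mp ?_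
    have h0 : (0 : ℝ) < p := by linarith [hp1 p hp]
    have hl := hlog0 p hp
    rw [hfsq p hp, div_le_iff₀ (by positivity)]
    calc lam ^ 2 ≤ 1 * (ℓ * u) := by rw [one_mul]; exact hlamle
      _ ≤ ε ^ 2 * u * (ℓ * u) := by gcongr
      _ = ε ^ 2 * (ℓ * u ^ 2) := by ring
      _ ≤ ε ^ 2 * (p * Real.log p ^ 2) := by
        gcongr
        · exact hpl p hp
        · exact (hmem p hp).2.1.le
  have ht : ∀ p ∈ P, f p / Real.sqrt p = lam * (1 / (p * Real.log p)) := fun p hp => by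
    have h0 : (0 : ℝ) < p := by linarith [hp1 p hp]
    have := Real.mul_self_sqrt h0.le
    simp only [hf]
    rw [div_div, mul_right_comm, this, mul_one_div]
  have ht0 : ∀ p ∈ P, 0 ≤ f p / Real.sqrt p := fun p hp => div_nonneg (hf0 p hp) (Real.sqrt_nonneg _)
  have htε : ∀ p ∈ P, f p / Real.sqrt p ≤ ε := fun p hp =>
    (div_le_self (hf0 p hp) (Real.one_le_sqrt.mpr (hp1 p hp))).trans (hfε p hp)
  have hfsqε : ∀ p ∈ P, f p ^ 2 ≤ ε := fun p hp => by
    have := hf0 p hp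
    have := hfε p hp
    nlinarith
  set w : ℕ → ℝ := fun p => f p ^ 2 + f p / Real.sqrt p with hw
  have hw0 : ∀ p ∈ P, 0 ≤ w p := fun p hp => add_nonneg (sq_nonneg _) (ht0 p hp)
  have hsumt : ∑ p ∈ P, f p / Real.sqrt p = lam * S := by
    rw [Finset.sum_congr rfl ht, ← Finset.mul_sum]; rfl
  have hlamS : (1 - ε) * Real.sqrt (ℓ / u) ≤ lam * S := by
    have e1 : lam * S = Real.sqrt ((1 - ε) * ℓ * S) := by
      rw [← Real.sqrt_sq (mul_nonneg hlam0 hS0.le), mul_pow, hlamsq]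
      congr 1
      field_simp
    rw [e1]
    refine Real.le_sqrt_of_sq_le ?_
    rw [mul_pow, Real.sq_sqrt (by positivity)]
    have : 0 ≤ (1 - ε) * ℓ := mul_nonneg (by linarith) hl0.le
    calc (1 - ε) ^ 2 * (ℓ / u) = (1 - ε) * ℓ * ((1 - ε) / u) := by ring
      _ ≤ _ := by gcongr
  have hratio : Real.exp ((1 - 2 * ε) * (lam * S)) * ∏ p ∈ P, (1 + f p ^ 2) ≤ ∏ p ∈ P, (1 + w p) := by
    rw [← hsumt, Finset.mul_sum, Real.exp_sum, ← Finset.prod_mul_distrib]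
    exact Finset.prod_le_prod (fun p _ => by positivity) fun p hp =>
      exp_le_one_add_add_of_le hε0 (by linarith) (sq_nonneg _) (hfsqε p hp) (ht0 p hp) (htε p hp)
  -- The Rankin exponent for which `p^α ≤ 1 + ε` for every prime used.
  set α := Real.log (1 + ε) / B / u with hα
  have hlogε : 0 < Real.log (1 + ε) := Real.log_pos (by linarith)
  have hα0 : 0 < α := by positivity
  have hsumw : ∑ p ∈ P, w p * Real.log p ≤ (1 - ε + ε ^ 2 / 2) * ℓ := by
    have e1 : ∑ p ∈ P, w p * Real.log p = lam ^ 2 * S + lam * ∑ p ∈ P, 1 / (p : ℝ) := by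
      rw [hSdef, invLogSum, Finset.mul_sum, Finset.mul_sum, ← Finset.sum_add_distrib]
      refine Finset.sum_congr rfl fun p hp => ?_
      have h0 : (p : ℝ) ≠ 0 := by linarith [hp1 p hp]
      have hl := (hlog0 p hp).ne'
      simp only [hw]
      rw [ht p hp, hfsq p hp]
      field_simp
    have e2 : lam ^ 2 * S = (1 - ε) * ℓ := by rw [hlamsq]; field_simp
    have e3 : lam * ∑ p ∈ P, 1 / (p : ℝ) ≤ Real.sqrt (ℓ * u) * (1 + B * u) := by
      gcongr
      · exact Real.le_sqrt_of_sq_le hlamle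
      · exact sum_primesBetween_one_div_le (by positivity)
    rw [e1, e2]
    linarith
  have htail : Real.exp (-(α * Real.log N)) * ∏ p ∈ P, (1 + w p * Real.exp (α * Real.log p)) ≤
      1 / 2 * ∏ p ∈ P, (1 + w p) := by
    have e1 : ∏ p ∈ P, (1 + w p * Real.exp (α * Real.log p)) ≤
        ∏ p ∈ P, ((1 + w p) * Real.exp (w p * (α * Real.log p * (1 + ε)))) := by
      refine Finset.prod_le_prod (fun p hp => add_nonneg zero_le_one (mul_nonneg (hw0 p hp) (Real.exp_pos _).le)) fun p hp => ?_
      refine one_add_mul_exp_le (hw0 p hp) (mul_nonneg hα0.le (hlog0 p hp).le) ?_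
      rw [← Real.exp_log (show 0 < 1 + ε by linarith), Real.exp_le_exp]
      calc α * Real.log p ≤ α * (B * u) := by gcongr; exact (hmem p hp).2.2
        _ = _ := by rw [hα]; field_simp
    have hprod0 : 0 ≤ ∏ p ∈ P, (1 + w p) := Finset.prod_nonneg fun p hp => by linarith [hw0 p hp]
    rw [Finset.prod_mul_distrib, ← Real.exp_sum] at e1
    have e2 : ∑ p ∈ P, w p * (α * Real.log p * (1 + ε)) = α * (1 + ε) * ∑ p ∈ P, w p * Real.log p := by
      rw [Finset.mul_sum]
      exact Finset.sum_congr rfl fun p _ => by ring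
    have e3 : -(α * Real.log N) + ∑ p ∈ P, w p * (α * Real.log p * (1 + ε)) ≤ -Real.log 2 := by
      rw [e2, hu]
      have e4 : α * (1 + ε) * ∑ p ∈ P, w p * Real.log p ≤ α * (1 + ε) * ((1 - ε + ε ^ 2 / 2) * ℓ) := by gcongr
      -- The net Rankin exponent is therefore at most `-α log N · ε²/4`, which is at most `-log 2`
      -- by `h3`: truncation loses at most half of the product.
      have e5 : (1 + ε) * (1 - ε + ε ^ 2 / 2) ≤ 1 - ε ^ 2 / 4 := by nlinarith [sq_nonneg ε]
      have e6 := mul_le_mul_of_nonneg_left e5 (mul_pos hα0 hl0).le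
      linarith
    calc _ ≤ Real.exp (-(α * Real.log N)) * ((∏ p ∈ P, (1 + w p)) *
          Real.exp (∑ p ∈ P, w p * (α * Real.log p * (1 + ε)))) := by gcongr
      _ = Real.exp (-(α * Real.log N) + ∑ p ∈ P, w p * (α * Real.log p * (1 + ε))) * ∏ p ∈ P, (1 + w p) := by
          rw [Real.exp_add]; ring
      _ ≤ Real.exp (-Real.log 2) * ∏ p ∈ P, (1 + w p) := by gcongr
      _ = _ := by rw [Real.exp_neg, Real.exp_log (by norm_num)]; ring
  refine ⟨moebiusWeight P f, abs_moebiusWeight_le hf0 fun p hp => (hfε p hp).trans (by linarith), moebiusWeight_one, ?_⟩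
  have hform := sum_prod_le_resonatorForm hprime hf0 N
  have hrank := prod_one_add_sub_le_sum_prod hprime hw0 hN hα0.le
  have hsq := sum_moebiusWeight_sq_le (P := P) (f := f) N
  -- As `(1 - 2ε)(1 - ε) ≥ 1 - 3ε`, there remains `3ε √(ℓ/u)`, which pays for the factor `1/2` by
  -- `h4`.
  have hexp : Real.exp ((1 - 6 * ε) * Real.sqrt (ℓ / u)) ≤ 1 / 2 * Real.exp ((1 - 2 * ε) * (lam * S)) := by
    have e1 : (1 - 2 * ε) * ((1 - ε) * Real.sqrt (ℓ / u)) ≤ (1 - 2 * ε) * (lam * S) :=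
      mul_le_mul_of_nonneg_left hlamS (by linarith)
    have e2 : 0 ≤ ε ^ 2 * Real.sqrt (ℓ / u) := by positivity
    rw [show (1 / 2 : ℝ) = Real.exp (-Real.log 2) by rw [Real.exp_neg, Real.exp_log (by norm_num)]; norm_num,
      ← Real.exp_add, Real.exp_le_exp]
    linarith
  have hprod0 : 0 ≤ ∏ p ∈ P, (1 + f p ^ 2) := Finset.prod_nonneg fun p _ => by positivity
  calc _ ≤ Real.exp ((1 - 6 * ε) * Real.sqrt (ℓ / u)) * ∏ p ∈ P, (1 + f p ^ 2) := by gcongr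
    _ ≤ 1 / 2 * Real.exp ((1 - 2 * ε) * (lam * S)) * ∏ p ∈ P, (1 + f p ^ 2) := by gcongr
    _ ≤ 1 / 2 * ∏ p ∈ P, (1 + w p) := by linarith
    _ ≤ _ := by linarith

lemma exists_resonator_le_resonatorForm {a : ℝ} (ha : a < 1) : ∀ᶠ N : ℕ in atTop, ∃ r : ℕ → ℝ,
    (∀ n, |r n| ≤ 1) ∧ r 1 = 1 ∧
    Real.exp (a * Real.sqrt (Real.log N / Real.log (Real.log N))) * ∑ n ∈ Finset.Icc 1 N, r n ^ 2 ≤ resonatorForm r N := by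
  set ε := min ((1 - a) / 6) (1 / 6) with hεdef
  have hε0 : 0 < ε := lt_min (by linarith) (by norm_num)
  have hε : ε ≤ 1 / 6 := min_le_right _ _
  have hεa : a ≤ 1 - 6 * ε := by have := min_le_left ((1 - a) / 6) (1 / 6); linarith
  obtain ⟨B, hB, hS⟩ := exists_le_invLogSum hε0
  have hlog : Tendsto (fun N : ℕ => Real.log (N : ℝ)) atTop atTop :=
    Real.tendsto_log_atTop.comp tendsto_natCast_atTop_atTop
  have hloglog : Tendsto (fun N : ℕ => Real.log (Real.log (N : ℝ))) atTop atTop := Real.tendsto_log_atTop.comp hlog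
  have hlogε : 0 < Real.log (1 + ε) := Real.log_pos (by linarith)
  -- All remaining size conditions reduce to `log N` dominating a cube of `log log N`.
  have key : ∀ K : ℝ, ∀ᶠ N : ℕ in atTop, K * Real.log (Real.log (N : ℝ)) ^ 3 ≤ Real.log (N : ℝ) := by
    intro K
    have h := (Real.isLittleO_pow_log_id_atTop (n := 3)).def (c := 1 / (|K| + 1)) (by positivity)
    filter_upwards [hlog.eventually h, hlog.eventually_ge_atTop 1] with N hN h1
    have hll := Real.log_nonneg h1
    rw [id, Real.norm_of_nonneg (by positivity), Real.norm_of_nonneg (by linarith), div_mul_eq_mul_div, one_mul,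
      le_div_iff₀ (by positivity)] at hN
    have : K * Real.log (Real.log (N : ℝ)) ^ 3 ≤ (|K| + 1) * Real.log (Real.log (N : ℝ)) ^ 3 := by
      gcongr
      linarith [le_abs_self K]
    linarith
  filter_upwards [hloglog.eventually hS, hloglog.eventually_ge_atTop (1 / ε ^ 2), hloglog.eventually_ge_atTop 1,
    key (16 * B ^ 2 / ε ^ 4), key (4 * B * Real.log 2 / (Real.log (1 + ε) * ε ^ 2)), key ((Real.log 2 / (3 * ε)) ^ 2),
    eventually_ge_atTop 1, hlog.eventually_gt_atTop 0] with N k1 k2 k3 k4 k5 k6 k7 k8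
  have hexp : Real.exp (Real.log (Real.log N)) = Real.log N := Real.exp_log k8
  set u := Real.log (Real.log (N : ℝ)) with hu
  have hu0 : 0 < u := by linarith
  have hu3 : u ≤ u ^ 3 := le_self_pow₀ k3 (by norm_num)
  obtain ⟨r, hr, hr1, hform⟩ := exp_mul_sum_le_resonatorForm hε0 hε hB k7 hexp.symm k1
    (by rw [div_le_iff₀ (by positivity)] at k2; linarith)
    (by
      rw [hexp]
      have h1 : 1 + B * u ≤ 2 * B * u := by nlinarith
      have h2 : 0 ≤ 1 + B * u := by positivity
      rw [← Real.sqrt_sq h2, ← Real.sqrt_mul (by positivity)]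
      refine Real.sqrt_le_iff.mpr ⟨by positivity, ?_⟩
      rw [div_mul_eq_mul_div, div_le_iff₀ (by positivity)] at k4
      calc Real.log N * u * (1 + B * u) ^ 2 ≤ Real.log N * u * (2 * B * u) ^ 2 := by gcongr
        _ = Real.log N * (16 * B ^ 2 * u ^ 3) / 4 := by ring
        _ ≤ Real.log N * (Real.log N * ε ^ 4) / 4 := by gcongr
        _ = _ := by ring)
    (by
      rw [hexp]
      rw [div_mul_eq_mul_div, div_le_iff₀ (by positivity)] at k5
      have h1 : 4 * B * Real.log 2 * u ≤ 4 * B * Real.log 2 * u ^ 3 := by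
        have := Real.log_nonneg (show (1 : ℝ) ≤ 2 by norm_num)
        gcongr
      rw [div_div, div_mul_eq_mul_div, div_mul_eq_mul_div, le_div_iff₀ (by positivity)]
      linarith)
    (by
      rw [hexp]
      have h1 : Real.log 2 / (3 * ε) ≤ Real.sqrt (Real.log N / u) := by
        refine Real.le_sqrt_of_sq_le ?_
        rw [le_div_iff₀ hu0]
        refine le_trans ?_ k6
        gcongr
      rw [div_le_iff₀ (by positivity)] at h1
      linarith)
  refine ⟨r, hr, hr1, le_trans ?_ hform⟩
  rw [hexp]
  gcongr

end

/-! ### Comparison of the two bounds and contradiction -/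

section

open Complex MeasureTheory Filter Topology Set Metric

/-- Applied with `x = log N`, for which `log(2T) = (3/2) x + log 2`; this is where the constant
`√(2/3)` is decided. -/
lemma eventually_mul_exp_sqrt_lt {c a C : ℝ} (hc : 0 < c) (hca : c * Real.sqrt (3 / 2) < a) :
    ∀ᶠ x : ℝ in atTop, C * x ^ 3 * Real.exp (c * Real.sqrt ((3 / 2 * x + Real.log 2) / Real.log (3 / 2 * x + Real.log 2))) <
      Real.exp (a * Real.sqrt (x / Real.log x)) := by
  obtain ⟨c', h1, h2⟩ := exists_between hca
  have hc0 : 0 < c' := lt_of_le_of_lt (by positivity) h1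
  have hsq : c ^ 2 * (3 / 2) < c' ^ 2 := by
    have h3 : (c * Real.sqrt (3 / 2)) ^ 2 < c' ^ 2 := by gcongr
    rwa [mul_pow, Real.sq_sqrt (by norm_num)] at h3
  have hlog2 : 0 < Real.log 2 := Real.log_pos (by norm_num)
  have hd : 0 < (a - c') ^ 2 / 17 := by have : 0 < a - c' := by linarith
                                        positivity
  have hlo := (Real.isLittleO_pow_log_id_atTop (n := 3)).def hd
  -- The 17 in `hd` exceeds `4²`, so that `(a - c') g > 4 log x`, enough to absorb `C x³ < x⁴`.
  filter_upwards [hlo, eventually_ge_atTop (3 : ℝ), eventually_ge_atTop (C + 1),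
    eventually_ge_atTop (c ^ 2 * Real.log 2 / (c' ^ 2 - c ^ 2 * (3 / 2)))] with x hx hx3 hxC hxc
  have hx0 : 0 < x := by linarith
  have hl1 : 1 ≤ Real.log x := by
    rw [Real.le_log_iff_exp_le hx0]; linarith [Real.exp_one_lt_d9]
  have hl0 : 0 < Real.log x := by linarith
  rw [id, Real.norm_of_nonneg (by positivity), Real.norm_of_nonneg hx0.le] at hx
  set g := Real.sqrt (x / Real.log x) with hg
  have hg0 : 0 ≤ g := Real.sqrt_nonneg _
  have hll : Real.log x ≤ Real.log (3 / 2 * x + Real.log 2) := Real.log_le_log hx0 (by linarith)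
  have hf : c * Real.sqrt ((3 / 2 * x + Real.log 2) / Real.log (3 / 2 * x + Real.log 2)) ≤ c' * g := by
    rw [hg, ← Real.sqrt_sq hc.le, ← Real.sqrt_sq hc0.le, ← Real.sqrt_mul (by positivity), ← Real.sqrt_mul (by positivity)]
    apply Real.sqrt_le_sqrt
    rw [← mul_div_assoc, ← mul_div_assoc]
    have : c ^ 2 * (3 / 2 * x + Real.log 2) ≤ c' ^ 2 * x := by
      rw [div_le_iff₀ (by linarith)] at hxc
      linarith
    gcongr
  have hgl : 4 * Real.log x < (a - c') * g := by
    rw [hg, ← Real.sqrt_sq (show 0 ≤ a - c' by linarith), ← Real.sqrt_mul (by positivity)]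
    apply Real.lt_sqrt_of_sq_lt
    rw [← mul_div_assoc, lt_div_iff₀ hl0]
    have : 0 < Real.log x ^ 3 := by positivity
    nlinarith
  have hx4 : C * x ^ 3 < Real.exp (4 * Real.log x) := by
    rw [show 4 * Real.log x = (4 : ℕ) * Real.log x by push_cast; ring, Real.exp_nat_mul, Real.exp_log hx0]
    have : 0 < x ^ 3 := by positivity
    nlinarith
  calc _ ≤ C * x ^ 3 * Real.exp (c * Real.sqrt ((3 / 2 * x + Real.log 2) / Real.log (3 / 2 * x + Real.log 2))) := le_rfl
    _ < Real.exp (4 * Real.log x) * Real.exp (c' * g) :=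
        mul_lt_mul hx4 (Real.exp_le_exp.mpr hf) (Real.exp_pos _) (Real.exp_pos _).le
    _ = Real.exp (4 * Real.log x + c' * g) := (Real.exp_add _ _).symm
    _ ≤ _ := Real.exp_le_exp.mpr (by linarith)

/-- `log v / v` decreases for `v ≥ e`; the lower limit `e^e` puts `v = log y` in that range. -/
lemma sqrt_log_div_log_log_le {y z : ℝ} (hy : Real.exp (Real.exp 1) ≤ y) (hyz : y ≤ z) :
    Real.sqrt (Real.log y / Real.log (Real.log y)) ≤ Real.sqrt (Real.log z / Real.log (Real.log z)) := by
  have hy0 : 0 < y := (Real.exp_pos _).trans_le hy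
  have h1 : Real.exp 1 ≤ Real.log y := (Real.le_log_iff_exp_le hy0).mpr hy
  have h2 : Real.log y ≤ Real.log z := Real.log_le_log hy0 hyz
  have h3 := Real.log_div_self_antitoneOn (a := Real.log y) (b := Real.log z) h1 (h1.trans h2) h2
  have e1 : 0 < Real.log y := (Real.exp_pos _).trans_le h1
  have l1 : 0 < Real.log (Real.log y) := lt_of_lt_of_le zero_lt_one ((Real.le_log_iff_exp_le e1).mpr h1)
  have l2 : 0 < Real.log (Real.log z) := l1.trans_le (Real.log_le_log e1 h2)
  apply Real.sqrt_le_sqrt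
  rw [div_le_div_iff₀ l1 l2]
  rw [div_le_div_iff₀ (by linarith) e1] at h3
  linarith

/-- Up to `2T` monotonicity suffices. Beyond `2T` the assumed bound for `1/|ζ'|` exceeds its value
at `2T`, but half of the Gaussian exponent absorbs it, and the other half remains for the large
sieve. -/
lemma exp_gaussian_mul_exp_sqrt_le {c X γ : ℝ} (hc0 : 0 < c) (hc1 : c ≤ 1) (hX : 128 ≤ X)
    (hγ : Real.exp (Real.exp 1) ≤ γ) :
    Real.exp (-(γ - X ^ 12) ^ 2 / (X ^ 9) ^ 2) * Real.exp (c * Real.sqrt (Real.log γ / Real.log (Real.log γ))) ≤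
      Real.exp (c * Real.sqrt (Real.log (2 * X ^ 12) / Real.log (Real.log (2 * X ^ 12)))) *
        Real.exp (-(γ - X ^ 12) ^ 2 / (2 * (X ^ 9) ^ 2)) := by
  have hX0 : 0 < X := by linarith
  have hγ0 : 0 < γ := (Real.exp_pos _).trans_le hγ
  rw [← Real.exp_add, ← Real.exp_add, Real.exp_le_exp]
  have hhalf : -(γ - X ^ 12) ^ 2 / (X ^ 9) ^ 2 = 2 * (-(γ - X ^ 12) ^ 2 / (2 * (X ^ 9) ^ 2)) := by
    field_simp
  have hneg : -(γ - X ^ 12) ^ 2 / (2 * (X ^ 9) ^ 2) ≤ 0 := by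
    rw [neg_div]; exact neg_nonpos.mpr (by positivity)
  rcases le_total γ (2 * X ^ 12) with h | h
  · have := mul_le_mul_of_nonneg_left (sqrt_log_div_log_log_le hγ h) hc0.le
    linarith
  · have h1 : Real.exp 1 ≤ Real.log γ := (Real.le_log_iff_exp_le hγ0).mpr hγ
    have hl0 : 0 < Real.log γ := (Real.exp_pos _).trans_le h1
    have hll : 1 ≤ Real.log (Real.log γ) := (Real.le_log_iff_exp_le hl0).mpr h1
    have h12 : (128 : ℝ) ^ 2 ≤ γ := by
      have h2 : X ^ 2 ≤ X ^ 12 := pow_le_pow_right₀ (by linarith) (by norm_num)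
      have h3 : (128 : ℝ) ^ 2 ≤ X ^ 2 := by gcongr
      have : 0 < X ^ 12 := by positivity
      linarith
    set s := Real.sqrt γ with hs
    have hs2 : s ^ 2 = γ := Real.sq_sqrt hγ0.le
    have hs128 : 128 ≤ s := Real.le_sqrt_of_sq_le h12
    have hlog : Real.log γ ≤ s ^ 2 / 64 := by
      rw [← hs2, Real.log_pow]
      have := Real.log_le_sub_one_of_pos (show 0 < s by linarith)
      push_cast
      nlinarith
    have hsq : Real.sqrt (Real.log γ / Real.log (Real.log γ)) ≤ s / 8 := by
      apply Real.sqrt_le_iff.mpr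
      refine ⟨by positivity, (div_le_self hl0.le hll).trans (hlog.trans (le_of_eq ?_))⟩
      ring
    -- In terms of `s = √γ`: `(γ - T)² ≥ s^4/4` and `H² = X^18 ≤ s³`.
    have hfar : s / 8 ≤ (γ - X ^ 12) ^ 2 / (2 * (X ^ 9) ^ 2) := by
      rw [le_div_iff₀ (by positivity)]
      have h4 : (γ / 2) ^ 2 ≤ (γ - X ^ 12) ^ 2 := by
        have : 0 < X ^ 12 := by positivity
        gcongr
        linarith
      have h5 : (X ^ 6) ^ 3 ≤ s ^ 3 := by
        have : X ^ 6 ≤ s := by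
          apply Real.le_sqrt_of_sq_le
          have : 0 < X ^ 12 := by positivity
          calc (X ^ 6) ^ 2 = X ^ 12 := by ring
            _ ≤ γ := by linarith
        gcongr
      calc s / 8 * (2 * (X ^ 9) ^ 2) = s * (X ^ 6) ^ 3 / 4 := by ring
        _ ≤ s * s ^ 3 / 4 := by gcongr
        _ = (γ / 2) ^ 2 := by rw [← hs2]; ring
        _ ≤ _ := h4
    have hn : -(γ - X ^ 12) ^ 2 / (2 * (X ^ 9) ^ 2) = -((γ - X ^ 12) ^ 2 / (2 * (X ^ 9) ^ 2)) := neg_div _ _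
    have h6 : c * Real.sqrt (Real.log γ / Real.log (Real.log γ)) ≤ s / 8 :=
      (mul_le_of_le_one_left (Real.sqrt_nonneg _) hc1).trans hsq
    have h7 : 0 ≤ c * Real.sqrt (Real.log (2 * X ^ 12) / Real.log (Real.log (2 * X ^ 12))) := by positivity
    linarith

set_option maxHeartbeats 1000000 in
lemma not_forall_exp_lt_norm_deriv {c T₀ : ℝ} (hc0 : 0 < c) (hc : c < Real.sqrt (2 / 3))
    (hT₀ : Real.exp (Real.exp 1) ≤ T₀) (hT4 : 4 ≤ T₀)
    (hline : ∀ ρ : ℂ, riemannZeta ρ = 0 → 0 < ρ.im → ρ.re = 1 / 2)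
    (h : ∀ ρ : ℂ, riemannZeta ρ = 0 → T₀ ≤ ρ.im →
      Real.exp (-c * Real.sqrt (Real.log ρ.im / Real.log (Real.log ρ.im))) < ‖deriv riemannZeta ρ‖) : False := by
  have hsq : Real.sqrt (2 / 3) * Real.sqrt (3 / 2) = 1 := by
    rw [← Real.sqrt_mul (by norm_num)]; norm_num
  have hs32 : 0 < Real.sqrt (3 / 2) := Real.sqrt_pos.mpr (by norm_num)
  obtain ⟨a, hca, ha1⟩ := exists_between (show c * Real.sqrt (3 / 2) < 1 by
    rw [← hsq]; exact mul_lt_mul_of_pos_right hc hs32)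
  have hc1 : c ≤ 1 := hc.le.trans (Real.sqrt_le_one.mpr (by norm_num))
  have hsimple : ∀ ρ : ℂ, riemannZeta ρ = 0 → T₀ ≤ ρ.im → deriv riemannZeta ρ ≠ 0 := fun ρ h1 h2 h3 => by
    have := (Real.exp_pos _).trans (h ρ h1 h2)
    rw [h3, norm_zero] at this
    exact this.false
  obtain ⟨C, hC1, hC⟩ := exists_sum_gaussian_resonator_le
  have htN : Tendsto (fun X : ℕ => X ^ 8) atTop atTop := tendsto_pow_atTop (by norm_num)
  have htlog : Tendsto (fun X : ℕ => 8 * Real.log (X : ℝ)) atTop atTop :=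
    (Real.tendsto_log_atTop.comp tendsto_natCast_atTop_atTop).const_mul_atTop (by norm_num)
  -- One suitable `X` is enough. The instance with `A = 1`, `B = 0` and exponent 8 provides the
  -- condition `N exp(-(H/N)²/4) ≤ 1` of the large sieve.
  obtain ⟨X, hX1, hX2, hX3, hX4, hX5⟩ := ((exists_zeros_resonatorForm_le hT4 hline hsimple).and
    ((htN.eventually (exists_resonator_le_resonatorForm ha1)).and
    ((htlog.eventually (eventually_mul_exp_sqrt_lt (C := 1000 * C) hc0 hca)).and
    ((eventually_mul_pow_mul_exp_le (A := 1) (B := 0) zero_le_one 8).and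
    (eventually_ge_atTop 128))))).exists
  obtain ⟨r, hr, hr1, hform⟩ := hX2
  obtain ⟨Z, hZ, hZform⟩ := hX1 r hr
  have hx : (128 : ℝ) ≤ X := by exact_mod_cast hX5
  have hx0 : (0 : ℝ) < X := by linarith
  have hN : ((X ^ 8 : ℕ) : ℝ) = (X : ℝ) ^ 8 := by push_cast; rfl
  have hlogN : Real.log ((X ^ 8 : ℕ) : ℝ) = 8 * Real.log X := by rw [hN, Real.log_pow]; norm_num
  set x := 8 * Real.log (X : ℝ) with hxdef
  have hx8 : 8 ≤ x := by
    have : 1 ≤ Real.log (X : ℝ) := by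
      rw [Real.le_log_iff_exp_le hx0]; linarith [Real.exp_one_lt_d9]
    linarith
  have hlog2T : Real.log (2 * (X : ℝ) ^ 12) = 3 / 2 * x + Real.log 2 := by
    rw [Real.log_mul (by norm_num) (by positivity), Real.log_pow, hxdef]; push_cast; ring
  set F := Real.exp (c * Real.sqrt ((3 / 2 * x + Real.log 2) / Real.log (3 / 2 * x + Real.log 2))) with hF
  have hF1 : 1 ≤ F := Real.one_le_exp (by positivity)
  set S := ∑ n ∈ Finset.Icc 1 (X ^ 8), r n ^ 2 with hS
  -- Because `r 1 = 1`; this lets the contour error `X^9` be absorbed into `X^9 · S`.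
  have hS1 : 1 ≤ S := by
    have h1 := Finset.single_le_sum (f := fun n => r n ^ 2) (fun n _ => sq_nonneg (r n))
      (show 1 ∈ Finset.Icc 1 (X ^ 8) from Finset.mem_Icc.mpr ⟨le_rfl, Nat.one_le_pow _ _ (by omega)⟩)
    simpa [hr1] using h1
  have hH0 : (0 : ℝ) < (X : ℝ) ^ 9 := by positivity
  have hsum := hC r (X ^ 8) ((X : ℝ) ^ 9) ((X : ℝ) ^ 12) ((X : ℝ) ^ 24 + 1) Z
    (Nat.one_le_pow _ _ (by omega)) (one_le_pow₀ (by linarith)) (by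
      rw [hN, show (X : ℝ) ^ 9 / X ^ 8 = X by field_simp]
      rw [one_mul, zero_div, add_zero] at hX4
      refine le_trans ?_ hX4
      gcongr ?_ * Real.exp ?_
      have := sq_nonneg (X : ℝ)
      linarith) (by
      have : (X : ℝ) ≤ X ^ 24 := le_self_pow₀ (by linarith) (by norm_num)
      linarith)
    (fun ρ hρ => ⟨(hZ ρ hρ).1, (hZ ρ hρ).2.1, hT4.trans (hZ ρ hρ).2.2.1, (hZ ρ hρ).2.2.2⟩)
  have hterm : ∑ ρ ∈ Z, Real.exp (-(ρ.im - (X : ℝ) ^ 12) ^ 2 / ((X : ℝ) ^ 9) ^ 2) *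
          ‖resonator r (X ^ 8) ρ.im‖ ^ 2 / ‖deriv riemannZeta ρ‖ ≤
      F * ∑ ρ ∈ Z, Real.exp (-(ρ.im - (X : ℝ) ^ 12) ^ 2 / (2 * ((X : ℝ) ^ 9) ^ 2)) * ‖resonator r (X ^ 8) ρ.im‖ ^ 2 := by
    rw [Finset.mul_sum]
    refine Finset.sum_le_sum fun ρ hρ => ?_
    obtain ⟨z1, z2, z3, z4⟩ := hZ ρ hρ
    have h1 := h ρ z1 z3
    have h2 := exp_gaussian_mul_exp_sqrt_le hc0 hc1 hx (hT₀.trans z3)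
    rw [hlog2T, ← hF] at h2
    rw [neg_mul, Real.exp_neg] at h1
    have h3 : 1 / ‖deriv riemannZeta ρ‖ ≤ Real.exp (c * Real.sqrt (Real.log ρ.im / Real.log (Real.log ρ.im))) := by
      rw [one_div]
      exact inv_le_of_inv_le₀ (Real.exp_pos _) h1.le
    calc _ = Real.exp (-(ρ.im - (X : ℝ) ^ 12) ^ 2 / ((X : ℝ) ^ 9) ^ 2) * (1 / ‖deriv riemannZeta ρ‖) *
          ‖resonator r (X ^ 8) ρ.im‖ ^ 2 := by ring
      _ ≤ Real.exp (-(ρ.im - (X : ℝ) ^ 12) ^ 2 / ((X : ℝ) ^ 9) ^ 2) *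
          Real.exp (c * Real.sqrt (Real.log ρ.im / Real.log (Real.log ρ.im))) *
          ‖resonator r (X ^ 8) ρ.im‖ ^ 2 := by gcongr
      _ ≤ F * Real.exp (-(ρ.im - (X : ℝ) ^ 12) ^ 2 / (2 * ((X : ℝ) ^ 9) ^ 2)) * ‖resonator r (X ^ 8) ρ.im‖ ^ 2 := by
          gcongr
      _ = _ := by ring
  have hlogY : Real.log ((X : ℝ) ^ 24 + 1 + 1) ≤ 4 * x := by
    have h1 : (X : ℝ) ^ 24 + 1 + 1 ≤ X ^ 32 := by
      have : (X : ℝ) ^ 24 * 128 ≤ X ^ 24 * X ^ 8 := by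
        gcongr
        exact hx.trans (le_self_pow₀ (by linarith) (by norm_num))
      have : (1 : ℝ) ≤ X ^ 24 := one_le_pow₀ (by linarith)
      nlinarith
    refine (Real.log_le_log (by positivity) h1).trans (le_of_eq ?_)
    rw [Real.log_pow, hxdef]; push_cast; ring
  set E := Real.exp (a * Real.sqrt (x / Real.log x)) with hE
  rw [hlogN] at hform hsum
  have hpi1 : 1 ≤ Real.sqrt Real.pi := Real.one_le_sqrt.mpr (by linarith [Real.pi_gt_three])
  have hbig : X ^ 9 * (E * S) ≤ X ^ 9 * (S + 2 * Real.pi * (F * (C * (4 * x) * (2 + x ^ 2) * S))) := by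
    have hE0 : 0 < E := Real.exp_pos _
    have h1 : (X : ℝ) ^ 9 * (E * S) ≤ Real.sqrt Real.pi * X ^ 9 * resonatorForm r (X ^ 8) := by
      calc (X : ℝ) ^ 9 * (E * S) = 1 * X ^ 9 * (E * S) := by ring
        _ ≤ Real.sqrt Real.pi * X ^ 9 * resonatorForm r (X ^ 8) := by gcongr
    have h2 : 2 * Real.pi * ∑ ρ ∈ Z, Real.exp (-(ρ.im - (X : ℝ) ^ 12) ^ 2 / ((X : ℝ) ^ 9) ^ 2) *
          ‖resonator r (X ^ 8) ρ.im‖ ^ 2 / ‖deriv riemannZeta ρ‖ ≤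
        2 * Real.pi * (F * (C * (4 * x) * X ^ 9 * (2 + x ^ 2) * S)) := by
      gcongr
      refine hterm.trans ?_
      gcongr
      refine hsum.trans ?_
      gcongr
    have h3 : (X : ℝ) ^ 9 ≤ X ^ 9 * S := le_mul_of_one_le_right hH0.le hS1
    nlinarith
  have hbig2 := le_of_mul_le_mul_left hbig hH0
  have hbig3 : E ≤ 1 + 2 * Real.pi * (F * (C * (4 * x) * (2 + x ^ 2))) := by
    refine le_of_mul_le_mul_right (a := S) ?_ (by linarith)
    refine hbig2.trans (le_of_eq ?_)
    ring
  have hfin : 1 + 2 * Real.pi * (F * (C * (4 * x) * (2 + x ^ 2))) ≤ 1000 * C * x ^ 3 * F := by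
    have hCx : 1 ≤ C * x ^ 3 * F := by
      have : 1 ≤ x ^ 3 := one_le_pow₀ (by linarith)
      exact one_le_mul_of_one_le_of_one_le (one_le_mul_of_one_le_of_one_le hC1 this) hF1
    have h2x : 2 + x ^ 2 ≤ 2 * x ^ 2 := by nlinarith
    calc _ ≤ 1 + 2 * 4 * (F * (C * (4 * x) * (2 * x ^ 2))) := by
          gcongr
          exact Real.pi_lt_four.le
      _ = 1 + 64 * (C * x ^ 3 * F) := by ring
      _ ≤ 1000 * (C * x ^ 3 * F) := by linarith
      _ = _ := by ring
  linarith

end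

theorem theorem3 (hRH : RiemannHypothesis) (c : ℝ) (hc : c < Real.sqrt (2 / 3)) :
    ∃ C : ℝ, 0 < C ∧
      {γ : ℝ | ∃ ρ : ℂ, IsNontrivialZetaZero ρ ∧ ρ.im = γ ∧
        ‖deriv riemannZeta ρ‖ ≤
          C * Real.exp (-c * Real.sqrt (Real.log |γ| / Real.log (Real.log |γ|)))}.Infinite := by
  -- The constant 1 works for every admissible `c`.
  refine ⟨1, one_pos, fun hfin => ?_⟩
  obtain ⟨M, hM⟩ := hfin.bddAbove
  have hhalf : 1 / 2 < Real.sqrt (2 / 3) := Real.lt_sqrt_of_sq_lt (by norm_num)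
  have hline : ∀ ρ : ℂ, riemannZeta ρ = 0 → 0 < ρ.im → ρ.re = 1 / 2 := by
    intro ρ h1 h2
    refine hRH ρ h1 (fun ⟨n, hn⟩ => ?_) (fun h => ?_)
    · rw [hn] at h2
      simp at h2
    · rw [h] at h2
      simp at h2
  -- Replacing `c` by `max c (1/2)`, still below `√(2/3)`, makes it positive and only strengthens
  -- the upper bound to be contradicted.
  refine not_forall_exp_lt_norm_deriv (c := max c (1 / 2)) (T₀ := max (max (Real.exp (Real.exp 1)) 4) (M + 1))
    (lt_max_of_lt_right (by norm_num)) (max_lt hc hhalf) ((le_max_left _ _).trans (le_max_left _ _))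
    ((le_max_right _ _).trans (le_max_left _ _)) hline fun ρ h1 h2 => ?_
  by_contra hcon
  have hM1 : M + 1 ≤ ρ.im := (le_max_right _ _).trans h2
  have h4 : 4 ≤ ρ.im := (le_max_right _ _).trans ((le_max_left _ _).trans h2)
  have hre := hline ρ h1 (by linarith)
  have : ρ.im ≤ M := by
    refine hM ⟨ρ, ⟨h1, by rw [hre]; norm_num, by rw [hre]; norm_num⟩, rfl, (not_lt.mp hcon).trans ?_⟩
    rw [one_mul, abs_of_pos (by linarith)]
    gcongr
    exact le_max_left _ _
  linarith
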